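/- Let $Y=f^{*}+\varepsilon$ be a Gaussian vector in $\mathbb R^{n}$ with independent components, $Y\sim\mathcal N(f^{*},\Sigma)$, $\Sigma=\operatorname{diag}(\sigma_1^2,\dots,\sigma_n^2)$ with all $\sigma_i>0$. Let $\Psi$ be a $p\times n$ feature matrix with columns $\Psi_1,\dots,\Psi_n$ such that $S=\Psi\Sigma\Psi^{\top}$ is non-degenerate, and let $W$ be a $q\times p$ matrix. Let $\mathcal M$ be a finite family of models; to each $m\in\mathcal M$ belong an orthogonal projector $P_m$ of $\mathbb R^p$ (onto the span of the features of the model), the feature matrix $\Psi_m=P_m\Psi$ and the least squares matrix $\mathcal S_m=(\Psi_m\Psi_m^{\top})^{-1}\Psi_m$ (with pseudo-inversion). Put $\mathcal K_{m,m^\circ}=W(\mathcal S_m-\mathcal S_{m^\circ})$ and $\xi_{m,m^\circ}=\mathcal K_{m,m^\circ}\varepsilon$. Let $\Pi$ be a linear presmoothing operator on $\mathbb R^{n}$, $\breve Y=Y-\Pi Y$, let $w^\flat\sim\mathcal N(0,I_n)$ be independent of $Y$, and put $\xi^\flat_{m,m^\circ}=\mathcal K_{m,m^\circ}\operatorname{diag}(\breve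 Y)\,w^\flat$. Let $\mathbb Q$ be the joint law of $(\xi_{m,m^\circ})_{m,m^\circ\in\mathcal M}$ and let $\mathbb Q^\flat$ be the joint conditional law of $(\xi^\flat_{m,m^\circ})_{m,m^\circ\in\mathcal M}$ given $Y$. Define $$\delta_\Psi=\max_{i}\|S^{-1/2}\Psi_i\|\,\sigma_i,\qquad B=\Sigma^{-1/2}(f^{*}-\Pi f^{*}),\qquad \breve\varepsilon=\Sigma^{-1/2}(\varepsilon-\Pi\varepsilon),$$ $$\delta_1=\|\operatorname{Var}(\breve\varepsilon)-I_n\|_{\mathrm{op}},\qquad \delta_\varepsilon=\max_i|\mathbb E\breve\varepsilon_i^{2}-1|.$$ Assume $\delta_1\le 1$ and $\delta_\varepsilon\le \tfrac12$. Then for every $\mathtt x\ge 0$ there is a random event $\Omega_2(\mathtt x)$ with $\mathbb P(\Omega_2(\mathtt x))\ge 1-3e^{-\mathtt x}$ on which $$\|\mathbb Q-\mathbb Q^\flat\|_{\mathrm{TV}}=\sup_{A}|\mathbb Q(A)-\mathbb Q^\flat(A)|\le\tfrac12\Delta_2(\mathtt x),$$ where, with $\|B\|$ the Euclidean norm and $\|B\|_\infty$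 the maximum norm of $B$, $$\Delta_2(\mathtt x)=2\sqrt{\delta_\Psi^{2}\,p\,(\mathtt x+\log n)}+\sqrt{\delta_\varepsilon^{2}\,p}+\sqrt{\|B\|_\infty^{4}\,p}+4\,\delta_\Psi^{2}\,\|B\|\,(1+\sqrt{\mathtt x}).$$ -/

import Mathlib

open MeasureTheory ProbabilityTheory Matrix

noncomputable section

namespace OrderedSelection

/-- The noise covariance matrix `Σ = diag(σ₁², …, σₙ²)`. -/
def noiseCov {n : ℕ} (σ : Fin n → ℝ) : Matrix (Fin n) (Fin n) ℝ :=
  diagonal fun i => σ i ^ 2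

/-- The law `N(f, Σ)` on `ℝⁿ`, `Σ = diag(σ₁², …, σₙ²)`: the coordinates are independent and the
`i`-th one is `N(f i, σᵢ²)`. -/
def diagGaussian {n : ℕ} (f σ : Fin n → ℝ) : Measure (Fin n → ℝ) :=
  Measure.pi fun i => gaussianReal (f i) (Real.toNNReal (σ i ^ 2))

/-- `S = Ψ Σ Ψᵀ = ∑ᵢ Ψᵢ Ψᵢᵀ σᵢ²`, where `Ψᵢ` is the `i`-th column of `Ψ`. -/
def scoreCov {n p : ℕ} (Ψ : Matrix (Fin p) (Fin n) ℝ) (σ : Fin n → ℝ) :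
    Matrix (Fin p) (Fin p) ℝ :=
  Ψ * noiseCov σ * Ψᵀ

/-- The (Moore-Penrose) pseudo-inverse of a symmetric real matrix: in an orthonormal eigenbasis,
nonzero eigenvalues are inverted and zero eigenvalues are kept (as `0⁻¹ = 0`). -/
def symPinv {p : ℕ} (A : Matrix (Fin p) (Fin p) ℝ) : Matrix (Fin p) (Fin p) ℝ :=
  cfc (fun t : ℝ => t⁻¹) A

/-- The inverse square root `A^{-1/2}` of a symmetric positive definite real matrix. -/
def invSqrt {p : ℕ} (A : Matrix (Fin p) (Fin p) ℝ) : Matrix (Fin p) (Fin p) ℝ :=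
  cfc (fun t : ℝ => (√t)⁻¹) A

/-- The Euclidean norm of a vector. -/
def l2norm {k : ℕ} (v : Fin k → ℝ) : ℝ := ‖WithLp.toLp 2 v‖

/-- The maximum norm of a vector. -/
def supnorm {k : ℕ} (v : Fin k → ℝ) : ℝ := ⨆ i, |v i|

/-- The operator norm of a square matrix with respect to the Euclidean norm. -/
def opNorm {k : ℕ} (A : Matrix (Fin k) (Fin k) ℝ) : ℝ :=
  ‖toEuclideanCLM (n := Fin k) (𝕜 := ℝ) A‖

/-- Feature matrix `Ψ_m = P Ψ` of a model `m`, where `P` is the orthogonal projector of the feature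
space `ℝᵖ` onto the subspace spanned by the features of `m` (for a coordinate projector, the
rows of `Ψ` outside the model are replaced by zero). -/
def modelFeatures {n p : ℕ} (Ψ : Matrix (Fin p) (Fin n) ℝ) (P : Matrix (Fin p) (Fin p) ℝ) :
    Matrix (Fin p) (Fin n) ℝ :=
  P * Ψ

/-- The least squares matrix `𝒮_m = (Ψ_m Ψ_mᵀ)⁻¹ Ψ_m` of a model, with pseudo-inversion. -/
def lse {n p : ℕ} (Ψ : Matrix (Fin p) (Fin n) ℝ) (P : Matrix (Fin p) (Fin p) ℝ) :
    Matrix (Fin p) (Fin n) ℝ :=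
  symPinv (modelFeatures Ψ P * (modelFeatures Ψ P)ᵀ) * modelFeatures Ψ P

/-- The family `(K_{m,m'} v)_{m,m'}`, where `K_{m,m'} = W (𝒮_m - 𝒮_{m'})`. With `v = ε` these are
all stochastic terms `ξ_{m,m'}`, with `v = ε♭` their bootstrap counterparts. -/
def stochTerms {n p q : ℕ} {ι : Type*} (Ψ : Matrix (Fin p) (Fin n) ℝ)
    (W : Matrix (Fin q) (Fin p) ℝ) (P : ι → Matrix (Fin p) (Fin p) ℝ) (v : Fin n → ℝ) :
    ι × ι → Fin q → ℝ :=
  fun mm => (W * (lse Ψ (P mm.1) - lse Ψ (P mm.2))) *ᵥ v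

/-- `Σ^{-1/2} (v - Π v)`. -/
def stdResidual {n : ℕ} (σ : Fin n → ℝ) (Pre : Matrix (Fin n) (Fin n) ℝ) (v : Fin n → ℝ) :
    Fin n → ℝ :=
  diagonal (fun i => (σ i)⁻¹) *ᵥ (v - Pre *ᵥ v)

/-- The bootstrap noise `ε♭ = diag(Y - Π Y) w`. -/
def bootNoise {n : ℕ} (Pre : Matrix (Fin n) (Fin n) ℝ) (y w : Fin n → ℝ) : Fin n → ℝ :=
  diagonal (y - Pre *ᵥ y) *ᵥ w

/-- The design regularity `δ_Ψ = maxᵢ ‖S^{-1/2} Ψᵢ‖ σᵢ`. -/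
def designReg {n p : ℕ} (Ψ : Matrix (Fin p) (Fin n) ℝ) (σ : Fin n → ℝ) : ℝ :=
  ⨆ i, l2norm (invSqrt (scoreCov Ψ σ) *ᵥ Ψ.col i) * σ i

/-- The covariance matrix of a random vector. -/
def covMat {n : ℕ} {Ω : Type*} [MeasurableSpace Ω] (μ : Measure Ω) (Z : Ω → Fin n → ℝ) :
    Matrix (Fin n) (Fin n) ℝ :=
  Matrix.of fun i j => covariance (fun ω => Z ω i) (fun ω => Z ω j) μ

/-- `δ₁ = ‖Var(Z) - I‖_op`. -/
def delta1 {n : ℕ} {Ω : Type*} [MeasurableSpace Ω] (μ : Measure Ω) (Z : Ω → Fin n → ℝ) : ℝ :=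
  opNorm (covMat μ Z - 1)

/-- `δ_ε = maxᵢ |E Zᵢ² - 1|`. -/
def deltaEps {n : ℕ} {Ω : Type*} [MeasurableSpace Ω] (μ : Measure Ω) (Z : Ω → Fin n → ℝ) : ℝ :=
  ⨆ i, |∫ ω, Z ω i ^ 2 ∂μ - 1|

/-- The total variation distance `sup_A |μ(A) - ν(A)|`, over all measurable sets `A`. -/
def tvDist {E : Type*} [MeasurableSpace E] (μ ν : Measure E) : ℝ :=
  ⨆ A : {A : Set E // MeasurableSet A}, |μ.real A.1 - ν.real A.1|

/-- The error term `Δ₂(x)`, as a function of `n`, `p`, `δ_Ψ`, `δ_ε`, the bias vector and `x`. -/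
def errorTwo {n : ℕ} (p : ℕ) (δΨ δε : ℝ) (B : Fin n → ℝ) (x : ℝ) : ℝ :=
  2 * √(δΨ ^ 2 * p * (x + Real.log n)) + √(δε ^ 2 * p) + √(supnorm B ^ 4 * p)
    + 4 * δΨ ^ 2 * l2norm B * (1 + √x)

end OrderedSelection

end

/-!
Both laws come from one Gaussian law on `ℝᵖ`. With `U = S^{-1/2} Ψ Σ^{1/2}`, so that `U Uᵀ = 1`
and the columns `u i` of `U` have length at most `δ_Ψ`, the family `ξ` is a fixed measurable
function `Φ` of the score `U z`, where `z = Σ^{-1/2} ε` is standard normal. Given `Y`, the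
bootstrap family is the same function `Φ` of `U diag(η) w`, where `η = R z + b` are the
standardized residuals, `R Rᵀ` is the covariance of their noise and `b` is the bias
(`exists_stochTerms_eq`, `condDistrib_ae_eq_map_of_indepFun`). Images do not increase the total
variation distance, so it suffices to compare `N(0, 1)` with `N(0, ∑ η i ^ 2 • u i (u i)ᵀ)` for
random `η`. The hypothesis `δ₁ ≤ 1` enters only through `‖R‖² ≤ 2`, and the hypothesis `δ_ε ≤ 1 /
2` bounds the noise variances `v i = E (R z) i ^ 2` from below. The first three summands of `Δ₂`
already suffice; the last one, which is nonnegative, is discarded.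

The probabilistic input is a bound for the exponential moments of `∑ D i * η i ^ 2`
(`lintegral_exp_quadratic_le`). By a trace form of Jensen's inequality, the centred part contributes
at most as much as if the squares were independent Gamma variables of mean `v i` and scale four, and
a bias acts at most like an inflation of the variance.

In dimension `p ≥ 2` the deterministic and the random parts of the error are separated. The distance
from `N(0, 1)` to the normal law whose covariance is the mean `∑ (v i + b i ^ 2) • u i (u i)ᵀ` is
bounded by Pinsker's inequality, which improves on the allowed `(δ_ε + ‖b‖_∞²) √p / 2` by a certain
`slack`. After whitening by the mean covariance, the random part is again governed by Pinsker's
inequality, that is by `tr G - p - log det G`, and Markov's inequality is applied to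
`exp (m / 2 * (tr G - p - log det G))` for a natural number `m`
(`measure_lt_tvDist_whitened_le`). The power `det G ^ (-m / 2)` is handled one factor
`det G ^ (-1 / 2)` at a time: such a factor is a Gaussian integral over `ℝᵖ`, and integrating it out
is possible by the geometric Brascamp-Lieb inequality (`lintegral_prod_rpow_le`), for which the
identity `∑ (v i + b i ^ 2) • y i (y i)ᵀ = 1` of the whitened columns is exactly the hypothesis.
Together with a sharp form of Gautschi's inequality this gives
`lintegral_gaussianIntegral_pow_mul_le`, which loses so little that the constants of the claim come
out (`exists_moment`).

In dimension one Pinsker's inequality alone is too weak when the bootstrap variance is small. There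
the distance between two centred normal laws is bounded by its exact value `gaussSep`, both tails of
the bootstrap variance are bounded by Chernoff's method, and the two are compared numerically
(`sq_le_rate`). Dimension zero is trivial.
-/

namespace OrderedSelection

open Filter Set
open scoped ENNReal Topology

/-! ### Total variation distance -/

section TotalVariation

variable {E F : Type*} [MeasurableSpace E] [MeasurableSpace F]

lemma tvDist_le_of_forall {μ ν : Measure E} {c : ℝ}
    (h : ∀ A, MeasurableSet A → |μ.real A - ν.real A| ≤ c) : tvDist μ ν ≤ c := by
  have : Nonempty {A : Set E // MeasurableSet A} := ⟨⟨∅, .empty⟩⟩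
  exact ciSup_le fun A => h A.1 A.2

lemma abs_measureReal_sub_le_one (μ ν : Measure E) [IsProbabilityMeasure μ]
    [IsProbabilityMeasure ν] (A : Set E) : |μ.real A - ν.real A| ≤ 1 := by
  have h1 : μ.real A ≤ 1 := measureReal_le_one
  have h2 : ν.real A ≤ 1 := measureReal_le_one
  have h3 : 0 ≤ μ.real A := measureReal_nonneg
  have h4 : 0 ≤ ν.real A := measureReal_nonneg
  rw [abs_le]
  constructor <;> linarith

lemma abs_sub_le_tvDist (μ ν : Measure E) [IsProbabilityMeasure μ] [IsProbabilityMeasure ν]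
    {A : Set E} (hA : MeasurableSet A) : |μ.real A - ν.real A| ≤ tvDist μ ν := by
  refine le_ciSup (f := fun A : {A : Set E // MeasurableSet A} => |μ.real A.1 - ν.real A.1|)
    ⟨1, ?_⟩ ⟨A, hA⟩
  rintro _ ⟨B, rfl⟩
  exact abs_measureReal_sub_le_one μ ν B

lemma tvDist_le_one (μ ν : Measure E) [IsProbabilityMeasure μ] [IsProbabilityMeasure ν] :
    tvDist μ ν ≤ 1 :=
  tvDist_le_of_forall fun A _ => abs_measureReal_sub_le_one μ ν A

lemma tvDist_self (μ : Measure E) : tvDist μ μ = 0 := by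
  have : Nonempty {A : Set E // MeasurableSet A} := ⟨⟨∅, .empty⟩⟩
  simp [tvDist]

lemma tvDist_comm (μ ν : Measure E) : tvDist μ ν = tvDist ν μ := by
  simp only [tvDist, abs_sub_comm]

lemma tvDist_triangle (μ ν ξ : Measure E) [IsProbabilityMeasure μ] [IsProbabilityMeasure ν]
    [IsProbabilityMeasure ξ] : tvDist μ ξ ≤ tvDist μ ν + tvDist ν ξ :=
  tvDist_le_of_forall fun _ hA => (abs_sub_le _ _ _).trans
    (add_le_add (abs_sub_le_tvDist μ ν hA) (abs_sub_le_tvDist ν ξ hA))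

lemma tvDist_map_le (μ ν : Measure E) [IsProbabilityMeasure μ] [IsProbabilityMeasure ν]
    {f : E → F} (hf : Measurable f) : tvDist (μ.map f) (ν.map f) ≤ tvDist μ ν :=
  tvDist_le_of_forall fun A hA => by
    rw [map_measureReal_apply hf hA, map_measureReal_apply hf hA]
    exact abs_sub_le_tvDist μ ν (hf hA)

/-- For probability measures one-sided differences suffice, by passing to complements. -/
lemma tvDist_le_of_sub_le {μ ν : Measure E} [IsProbabilityMeasure μ] [IsProbabilityMeasure ν]
    {c : ℝ} (h : ∀ A, MeasurableSet A → ν.real A - μ.real A ≤ c) : tvDist μ ν ≤ c := by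
  refine tvDist_le_of_forall fun A hA => abs_le.2 ⟨by linarith [h A hA], ?_⟩
  have h1 := h Aᶜ hA.compl
  rw [probReal_compl_eq_one_sub hA, probReal_compl_eq_one_sub hA] at h1
  linarith

end TotalVariation

/-! ### Matrices and quadratic forms -/

section

variable {n p : ℕ}

lemma measurable_mulVec (A : Matrix (Fin p) (Fin n) ℝ) :
    Measurable fun z : Fin n → ℝ => A *ᵥ z :=
  (Continuous.matrix_mulVec continuous_const continuous_id).measurable

lemma measurable_mulVec_apply (A : Matrix (Fin p) (Fin n) ℝ) (i : Fin p) :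
    Measurable fun z : Fin n → ℝ => (A *ᵥ z) i :=
  (measurable_pi_apply i).comp (measurable_mulVec A)

lemma sum_sq_eq_dotProduct (x : Fin n → ℝ) : ∑ i, x i ^ 2 = x ⬝ᵥ x := by
  simp [dotProduct, sq]

lemma isHermitian_mul_diagonal_mul (U : Matrix (Fin p) (Fin n) ℝ) (M : Fin n → ℝ) :
    (U * diagonal M * Uᵀ).IsHermitian := by
  rw [Matrix.IsHermitian, conjTranspose_eq_transpose_of_trivial]
  simp [transpose_mul, Matrix.mul_assoc]

lemma exists_orthogonal_diagonal {G : Matrix (Fin p) (Fin p) ℝ} (hG : G.IsHermitian) :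
    ∃ O : Matrix (Fin p) (Fin p) ℝ, O * Oᵀ = 1 ∧ Oᵀ * O = 1 ∧
      G = O * diagonal hG.eigenvalues * Oᵀ := by
  have hOO : (hG.eigenvectorUnitary : Matrix (Fin p) (Fin p) ℝ)
      * (hG.eigenvectorUnitary : Matrix (Fin p) (Fin p) ℝ)ᵀ = 1 := by
    have := Unitary.mul_star_self_of_mem hG.eigenvectorUnitary.2
    simpa [star_eq_conjTranspose, conjTranspose_eq_transpose_of_trivial] using this
  refine ⟨_, hOO, mul_eq_one_comm.1 hOO, ?_⟩
  have := hG.spectral_theorem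
  rw [Unitary.conjStarAlgAut_apply] at this
  simpa [star_eq_conjTranspose, conjTranspose_eq_transpose_of_trivial, Function.comp_def]
    using this

lemma dotProduct_transpose_mul_diagonal (Y : Matrix (Fin n) (Fin p) ℝ) (D : Fin n → ℝ)
    (z : Fin p → ℝ) : z ⬝ᵥ (Yᵀ * diagonal D * Y) *ᵥ z = ∑ i, D i * (Y *ᵥ z) i ^ 2 := by
  rw [← mulVec_mulVec, ← mulVec_mulVec, dotProduct_mulVec, vecMul_transpose]
  simp only [dotProduct, mulVec_diagonal]
  exact Finset.sum_congr rfl fun i _ => by ring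

lemma trace_transpose_mul_diagonal {Y : Matrix (Fin n) (Fin p) ℝ} {c : Fin n → ℝ}
    (hY : ∀ i, c i ≠ 0 → ∑ j, Y i j ^ 2 = 1) : (Yᵀ * diagonal c * Y).trace = ∑ i, c i := by
  rw [trace_mul_comm, ← Matrix.mul_assoc]
  simp only [trace, diag_apply, mul_diagonal]
  refine Finset.sum_congr rfl fun i _ => ?_
  by_cases h : c i = 0
  · simp [h]
  · have := hY i h
    simp only [sq] at this
    simp [mul_apply, this]

end

/-! ### Images of the standard normal law under matrices -/

/-- The standard normal law on `ℝⁿ`. -/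
noncomputable def stdNormal (n : ℕ) : Measure (Fin n → ℝ) := Measure.pi fun _ => gaussianReal 0 1

instance (n : ℕ) : IsProbabilityMeasure (stdNormal n) := by
  unfold stdNormal; infer_instance

/-- The centred normal law with covariance `A Aᵀ`, as the image of the standard normal law. -/
noncomputable def gaussLaw {p n : ℕ} (A : Matrix (Fin p) (Fin n) ℝ) : Measure (Fin p → ℝ) :=
  (stdNormal n).map fun z => A *ᵥ z

instance {p n : ℕ} (A : Matrix (Fin p) (Fin n) ℝ) : IsProbabilityMeasure (gaussLaw A) :=
  Measure.isProbabilityMeasure_map (measurable_mulVec A).aemeasurable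

lemma gaussLaw_one (n : ℕ) : gaussLaw (1 : Matrix (Fin n) (Fin n) ℝ) = stdNormal n := by
  simp [gaussLaw]

lemma gaussLaw_mul {p n m : ℕ} (A : Matrix (Fin p) (Fin n) ℝ) (B : Matrix (Fin n) (Fin m) ℝ) :
    gaussLaw (A * B) = (gaussLaw B).map fun z => A *ᵥ z := by
  rw [gaussLaw, gaussLaw, Measure.map_map (measurable_mulVec A) (measurable_mulVec B)]
  congr 1
  ext z : 1
  simp

lemma charFunDual_gaussLaw {p n : ℕ} (A : Matrix (Fin p) (Fin n) ℝ)
    (L : StrongDual ℝ (Fin p → ℝ)) :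
    charFunDual (gaussLaw A) L =
      Complex.exp (-(((fun a => L (Pi.single a 1)) ᵥ* (A * Aᵀ) ⬝ᵥ
        (fun a => L (Pi.single a 1)) : ℝ) : ℂ) / 2) := by
  have hL : ∀ z : Fin p → ℝ, L z = (fun a => L (Pi.single a 1)) ⬝ᵥ z := by
    intro z
    have h := (L : (Fin p → ℝ) →ₗ[ℝ] ℝ).pi_apply_eq_sum_univ z
    simp only [ContinuousLinearMap.coe_coe, smul_eq_mul] at h
    rw [h, dotProduct]
    refine Finset.sum_congr rfl fun a _ => ?_
    rw [mul_comm]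
    congr 2
    ext b
    simp [Pi.single_apply, eq_comm]
  set l : Fin p → ℝ := fun a => L (Pi.single a 1) with hl
  let M : (Fin n → ℝ) →L[ℝ] (Fin p → ℝ) := LinearMap.toContinuousLinearMap A.mulVecLin
  have hM : gaussLaw A = (stdNormal n).map M := rfl
  rw [hM, charFunDual_map, stdNormal, charFunDual_pi]
  have h1 : ∀ i, charFunDual (gaussianReal 0 1)
      ((L.comp M).comp (ContinuousLinearMap.single ℝ (fun _ : Fin n => ℝ) i))
        = Complex.exp (-(((l ᵥ* A) i ^ 2 : ℝ) : ℂ) / 2) := by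
    intro i
    have h2 : ((L.comp M).comp (ContinuousLinearMap.single ℝ (fun _ : Fin n => ℝ) i)) 1
        = (l ᵥ* A) i := by
      have : M ((ContinuousLinearMap.single ℝ (fun _ : Fin n => ℝ) i) 1) = A.col i := by
        change A *ᵥ (Pi.single i 1) = _
        simp
      simp only [ContinuousLinearMap.comp_apply]
      rw [this, hL]
      rfl
    have h3 : ∀ x : ℝ, ((L.comp M).comp (ContinuousLinearMap.single ℝ (fun _ : Fin n => ℝ) i)) x
        = (l ᵥ* A) i * x := by
      intro x
      conv_lhs => rw [show x = x • (1 : ℝ) by simp, map_smul, h2, smul_eq_mul, mul_comm]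
    rw [charFunDual_apply]
    simp_rw [h3]
    have h4 := charFun_gaussianReal (μ := 0) (v := 1) ((l ᵥ* A) i)
    rw [charFun_apply_real] at h4
    convert h4 using 2
    · push_cast; rfl
    · push_cast; simp; ring
  simp_rw [h1]
  rw [← Complex.exp_sum]
  congr 1
  have h5 : l ᵥ* (A * Aᵀ) ⬝ᵥ l = ∑ i, (l ᵥ* A) i ^ 2 := by
    rw [← vecMul_vecMul, ← dotProduct_mulVec, mulVec_transpose]
    simp [dotProduct, sq]
  rw [h5]
  push_cast
  rw [← Finset.sum_div, Finset.sum_neg_distrib]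

/-- A centred normal law is determined by its covariance matrix. -/
lemma gaussLaw_congr {p n m : ℕ} {A : Matrix (Fin p) (Fin n) ℝ} {B : Matrix (Fin p) (Fin m) ℝ}
    (h : A * Aᵀ = B * Bᵀ) : gaussLaw A = gaussLaw B := by
  apply Measure.ext_of_charFunDual
  ext L
  rw [charFunDual_gaussLaw, charFunDual_gaussLaw, h]

lemma gaussLaw_eq_stdNormal {p n : ℕ} {U : Matrix (Fin p) (Fin n) ℝ} (hU : U * Uᵀ = 1) :
    gaussLaw U = stdNormal p := by
  rw [← gaussLaw_one]; exact gaussLaw_congr (by simpa using hU)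

lemma gaussLaw_diagonal {n : ℕ} (s : Fin n → ℝ) :
    gaussLaw (diagonal s) = Measure.pi fun i => gaussianReal 0 (Real.toNNReal (s i ^ 2)) := by
  have h : (fun z : Fin n → ℝ => diagonal s *ᵥ z) = fun z i => s i * z i := by
    ext z i; simp [mulVec_diagonal]
  have h2 : ∀ i, (gaussianReal 0 1).map (fun x => s i * x)
      = gaussianReal 0 (Real.toNNReal (s i ^ 2)) := by
    intro i
    rw [gaussianReal_map_const_mul]
    simp only [mul_zero, mul_one]
    congr 1
    ext
    simp [sq_nonneg]
  have h3 : ∀ i, SigmaFinite ((gaussianReal 0 1).map (fun x => s i * x)) := by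
    intro i; rw [h2]; infer_instance
  rw [gaussLaw, stdNormal, h, Measure.pi_map_pi fun i => by fun_prop]
  simp_rw [h2]

/-- The integral of a product of functions of the separate coordinates. -/
lemma lintegral_pi_prod {n : ℕ} (μ : Fin n → Measure ℝ) [∀ i, SigmaFinite (μ i)]
    {f : Fin n → ℝ → ℝ≥0∞} (hf : ∀ i, Measurable (f i)) :
    ∫⁻ z, ∏ i, f i (z i) ∂(Measure.pi μ) = ∏ i, ∫⁻ x, f i x ∂(μ i) := by
  induction n with
  | zero => simp
  | succ n ih =>
    have h := (measurePreserving_piFinSuccAbove μ 0).symm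
    rw [← h.lintegral_comp_emb (MeasurableEquiv.measurableEmbedding _)]
    simp only [Fin.prod_univ_succ]
    have h2 : ∀ a : ℝ × (Fin n → ℝ),
        f 0 ((MeasurableEquiv.piFinSuccAbove (fun _ : Fin (n+1) => ℝ) 0).symm a 0) *
          ∏ i : Fin n, f i.succ
            ((MeasurableEquiv.piFinSuccAbove (fun _ : Fin (n+1) => ℝ) 0).symm a i.succ)
        = f 0 a.1 * ∏ i : Fin n, f i.succ (a.2 i) := by
      intro a
      simp [MeasurableEquiv.piFinSuccAbove]
    simp_rw [h2]
    rw [lintegral_prod_mul (f := f 0) (g := fun y : Fin n → ℝ => ∏ i, f i.succ (y i))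
      (hf 0).aemeasurable
      (Finset.measurable_fun_prod _ fun i _ => (hf _).comp (measurable_pi_apply i)).aemeasurable]
    congr 1
    exact ih (fun i => μ i.succ) fun i => hf _

/-- Rotation invariance of the standard normal law. -/
lemma lintegral_stdNormal_rotate {n : ℕ} {O : Matrix (Fin n) (Fin n) ℝ} (hO : O * Oᵀ = 1)
    {f : (Fin n → ℝ) → ℝ≥0∞} (hf : Measurable f) :
    ∫⁻ z, f (O *ᵥ z) ∂(stdNormal n) = ∫⁻ z, f z ∂(stdNormal n) := by
  conv_rhs => rw [← gaussLaw_eq_stdNormal hO, gaussLaw, lintegral_map hf (measurable_mulVec O)]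

/-! ### Pinsker's inequality for centred normal laws -/

/-- Pinsker's inequality for a measure with a positive density. The proof tests the variational
formula for the relative entropy with multiples of an indicator and bounds the resulting
exponential moment by Hoeffding's lemma. -/
lemma tvDist_withDensity_le {E : Type*} [MeasurableSpace E] (μ : Measure E)
    [IsProbabilityMeasure μ] {h : E → ℝ} (hm : Measurable h) (hpos : ∀ z, 0 < h z)
    (hν : IsProbabilityMeasure (μ.withDensity fun z => ENNReal.ofReal (h z)))
    {K : ℝ} (hint : Integrable (fun z => Real.log (h z))
      (μ.withDensity fun z => ENNReal.ofReal (h z)))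
    (hK : ∫ z, Real.log (h z) ∂(μ.withDensity fun z => ENNReal.ofReal (h z)) ≤ K) :
    tvDist μ (μ.withDensity fun z => ENNReal.ofReal (h z)) ≤ √(K / 2) := by
  set ν := μ.withDensity fun z => ENNReal.ofReal (h z) with hνdef
  refine tvDist_le_of_sub_le fun A hA => ?_
  set d := ν.real A - μ.real A with hd
  set X : E → ℝ := A.indicator fun _ => (1 : ℝ) with hX
  have hXm : Measurable X := measurable_const.indicator hA
  have hX01 : ∀ z, X z ∈ Set.Icc (0 : ℝ) 1 := fun z => by
    by_cases hz : z ∈ A <;> simp [hX, hz]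
  have hXμ : ∫ z, X z ∂μ = μ.real A := by simp [hX, integral_indicator hA]
  have hXν : ∫ z, X z ∂ν = ν.real A := by simp [hX, integral_indicator hA]
  have hsub := hasSubgaussianMGF_of_mem_Icc (μ := μ) hXm.aemeasurable (ae_of_all _ hX01)
  rw [hXμ] at hsub
  -- `t = 4 d` maximises the resulting lower bound `t d - t² / 8` for the relative entropy
  set t := 4 * d with ht
  have hmgf := hsub.mgf_le t
  have hexpint := hsub.integrable_exp_mul t
  -- `a` is the test function; its exponential moment under `μ` is at most one
  let a : E → ℝ := fun z => t * (X z - μ.real A) - t ^ 2 / 8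
  have ham : Measurable a := by fun_prop
  have haint : Integrable (fun z => Real.exp (a z)) μ := by
    have : (fun z => Real.exp (a z))
        = fun z => Real.exp (t * (X z - μ.real A)) * Real.exp (-(t ^ 2 / 8)) := by
      ext z; rw [← Real.exp_add]; rfl
    rw [this]; exact hexpint.mul_const _
  have hexp : ∫ z, Real.exp (a z) ∂μ ≤ 1 := by
    have : (fun z => Real.exp (a z))
        = fun z => Real.exp (t * (X z - μ.real A)) * Real.exp (-(t ^ 2 / 8)) := by
      ext z; rw [← Real.exp_add]; rfl
    rw [this, integral_mul_const]
    have h1 : ∫ z, Real.exp (t * (X z - μ.real A)) ∂μ ≤ Real.exp (t ^ 2 / 8) := by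
      refine hmgf.trans (le_of_eq ?_)
      congr 1
      simp
      ring
    calc _ ≤ Real.exp (t ^ 2 / 8) * Real.exp (-(t ^ 2 / 8)) := by gcongr
      _ = 1 := by rw [← Real.exp_add]; simp
  have hXint : Integrable X ν := Integrable.of_mem_Icc 0 1 hXm.aemeasurable (ae_of_all _ hX01)
  have ha_int : Integrable a ν :=
    ((hXint.sub (integrable_const _)).const_mul t).sub (integrable_const _)
  have hq_int : Integrable (fun z => Real.exp (a z) / h z) ν := by
    rw [hνdef, integrable_withDensity_iff_integrable_smul' (by fun_prop)
      (ae_of_all _ fun _ => ENNReal.ofReal_lt_top)]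
    refine haint.congr (ae_of_all _ fun z => ?_)
    simp only [smul_eq_mul]
    rw [ENNReal.toReal_ofReal (hpos z).le]
    field_simp [(hpos z).ne']
  have hq : ∫ z, Real.exp (a z) / h z ∂ν = ∫ z, Real.exp (a z) ∂μ := by
    rw [hνdef, integral_withDensity_eq_integral_toReal_smul (by fun_prop)
      (ae_of_all _ fun _ => ENNReal.ofReal_lt_top)]
    refine integral_congr_ae (ae_of_all _ fun z => ?_)
    simp only [smul_eq_mul]
    rw [ENNReal.toReal_ofReal (hpos z).le]
    field_simp [(hpos z).ne']
  have hq_sub : Integrable (fun z => Real.exp (a z) / h z - 1) ν :=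
    hq_int.sub (integrable_const _)
  have hpt : ∀ z, a z ≤ Real.log (h z) + (Real.exp (a z) / h z - 1) := fun z => by
    have h1 := Real.add_one_le_exp (a z - Real.log (h z))
    rw [Real.exp_sub, Real.exp_log (hpos z)] at h1
    linarith
  have hmono : ∫ z, a z ∂ν ≤ ∫ z, (Real.log (h z) + (Real.exp (a z) / h z - 1)) ∂ν :=
    integral_mono ha_int (hint.add hq_sub) hpt
  have hal : ∫ z, a z ∂ν = t * d - t ^ 2 / 8 := by
    have : ∫ z, a z ∂ν = ∫ z, (t * (X z - μ.real A)) ∂ν - ∫ _, t ^ 2 / 8 ∂ν :=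
      integral_sub ((hXint.sub (integrable_const _)).const_mul t) (integrable_const _)
    rw [this, integral_const_mul, integral_sub hXint (integrable_const _), hXν]
    simp [hd]
  have har : ∫ z, (Real.log (h z) + (Real.exp (a z) / h z - 1)) ∂ν
      = ∫ z, Real.log (h z) ∂ν + (∫ z, Real.exp (a z) ∂μ - 1) := by
    rw [integral_add hint hq_sub,
      integral_sub hq_int (integrable_const _), hq]
    simp
  rw [hal, har] at hmono
  refine Real.le_sqrt_of_sq_le ?_
  rw [ht] at hmono
  nlinarith

lemma pi_withDensity {n : ℕ} (μ : Fin n → Measure ℝ) [∀ i, IsProbabilityMeasure (μ i)]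
    {f : Fin n → ℝ → ℝ≥0∞} (hf : ∀ i, Measurable (f i))
    [∀ i, SigmaFinite ((μ i).withDensity (f i))] :
    Measure.pi (fun i => (μ i).withDensity (f i))
      = (Measure.pi μ).withDensity fun z => ∏ i, f i (z i) := by
  refine Measure.pi_eq fun s hs => ?_
  rw [withDensity_apply _ (MeasurableSet.univ_pi hs),
    ← lintegral_indicator (MeasurableSet.univ_pi hs)]
  have h : ∀ z : Fin n → ℝ, (Set.univ.pi s).indicator (fun z => ∏ i, f i (z i)) z
      = ∏ i, (s i).indicator (f i) (z i) := by
    intro z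
    by_cases hz : z ∈ Set.univ.pi s
    · rw [Set.indicator_of_mem hz]
      refine Finset.prod_congr rfl fun i _ => ?_
      rw [Set.indicator_of_mem (hz i (Set.mem_univ i))]
    · rw [Set.indicator_of_notMem hz]
      simp only [Set.mem_univ_pi, not_forall] at hz
      obtain ⟨i, hi⟩ := hz
      exact (Finset.prod_eq_zero (Finset.mem_univ i) (Set.indicator_of_notMem hi _)).symm
  simp_rw [h]
  rw [lintegral_pi_prod μ fun i => (hf i).indicator (hs i)]
  refine Finset.prod_congr rfl fun i _ => ?_
  rw [withDensity_apply _ (hs i), lintegral_indicator (hs i)]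

/-- The density of `N(0, l)` with respect to `N(0, 1)`. -/
noncomputable def gaussRatio (l x : ℝ) : ℝ := (√l)⁻¹ * Real.exp (-(l⁻¹ - 1) * x ^ 2 / 2)

lemma gaussRatio_pos {l : ℝ} (hl : 0 < l) (x : ℝ) : 0 < gaussRatio l x := by
  unfold gaussRatio; positivity

lemma measurable_gaussRatio (l : ℝ) : Measurable (gaussRatio l) := by
  unfold gaussRatio; fun_prop

lemma withDensity_gaussRatio {l : ℝ} (hl : 0 < l) :
    (gaussianReal 0 1).withDensity (fun x => ENNReal.ofReal (gaussRatio l x))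
      = gaussianReal 0 (Real.toNNReal l) := by
  have hl' : Real.toNNReal l ≠ 0 := by simpa using hl
  rw [gaussianReal_of_var_ne_zero _ one_ne_zero, gaussianReal_of_var_ne_zero _ hl',
    ← withDensity_mul _ (measurable_gaussianPDF _ _) (measurable_gaussRatio l).ennreal_ofReal]
  congr 1
  ext x
  simp only [Pi.mul_apply, gaussianPDF]
  rw [← ENNReal.ofReal_mul (gaussianPDFReal_nonneg _ _ _)]
  congr 1
  simp only [gaussianPDFReal, gaussRatio, NNReal.coe_one, Real.coe_toNNReal _ hl.le, sub_zero,
    mul_one]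
  have h1 : √(2 * Real.pi * l) = √(2 * Real.pi) * √l := Real.sqrt_mul (by positivity) _
  rw [h1, mul_inv]
  rw [show ∀ a b c e : ℝ, a * b * (c * e) = a * c * (b * e) by intros; ring, ← Real.exp_add]
  congr 2
  field_simp
  ring

lemma integral_sq_gaussianReal (v : NNReal) : ∫ x, x ^ 2 ∂(gaussianReal 0 v) = v := by
  have h := variance_fun_id_gaussianReal (μ := 0) (v := v)
  rw [variance_eq_integral (by fun_prop)] at h
  simpa using h

lemma integrable_sq_gaussianReal (v : NNReal) : Integrable (fun x => x ^ 2) (gaussianReal 0 v) := by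
  simpa using (memLp_id_gaussianReal (μ := 0) (v := v) 2).integrable_sq

/-- Pinsker's inequality for diagonal covariances, where the relative entropy is the sum of those of
the coordinates. -/
lemma tvDist_gaussLaw_diagonal_le {p : ℕ} {l : Fin p → ℝ} (hl : ∀ k, 0 < l k) :
    tvDist (stdNormal p) (gaussLaw (diagonal fun k => √(l k)))
      ≤ √(∑ k, (l k - 1 - Real.log (l k))) / 2 := by
  have hsq : ∀ k, √(l k) ^ 2 = l k := fun k => Real.sq_sqrt (hl k).le
  have hν : gaussLaw (diagonal fun k => √(l k))
      = (stdNormal p).withDensity fun z => ENNReal.ofReal (∏ k, gaussRatio (l k) (z k)) := by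
    rw [gaussLaw_diagonal]
    simp_rw [hsq, ← withDensity_gaussRatio (hl _)]
    have : ∀ k, SigmaFinite ((gaussianReal 0 1).withDensity
        fun x => ENNReal.ofReal (gaussRatio (l k) x)) := fun k => by
      rw [withDensity_gaussRatio (hl k)]; infer_instance
    rw [pi_withDensity (fun _ => gaussianReal 0 1)
      (f := fun k x => ENNReal.ofReal (gaussRatio (l k) x))
      fun k => (measurable_gaussRatio _).ennreal_ofReal]
    congr 1
    ext z
    rw [ENNReal.ofReal_prod_of_nonneg fun k _ => (gaussRatio_pos (hl k) _).le]
  have hlog : ∀ z : Fin p → ℝ, Real.log (∏ k, gaussRatio (l k) (z k))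
      = ∑ k, (-(Real.log (l k) / 2) + -((l k)⁻¹ - 1) / 2 * z k ^ 2) := by
    intro z
    rw [Real.log_prod fun k _ => (gaussRatio_pos (hl k) _).ne']
    refine Finset.sum_congr rfl fun k _ => ?_
    have := Real.sqrt_pos.2 (hl k)
    rw [gaussRatio, Real.log_mul (by positivity) (by positivity), Real.log_exp, Real.log_inv,
      Real.log_sqrt (hl k).le]
    ring
  have hpi : gaussLaw (diagonal fun k => √(l k))
      = Measure.pi fun k => gaussianReal 0 (Real.toNNReal (l k)) := by
    rw [gaussLaw_diagonal]; simp_rw [hsq]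
  have hi2 : ∀ k, Integrable (fun z : Fin p → ℝ => z k ^ 2)
      (Measure.pi fun k => gaussianReal 0 (Real.toNNReal (l k))) := fun k =>
    integrable_comp_eval (μ := fun k => gaussianReal 0 (Real.toNNReal (l k))) (i := k)
      (f := fun x : ℝ => x ^ 2) (integrable_sq_gaussianReal _)
  have hI : ∀ k, Integrable (fun z : Fin p → ℝ =>
        -(Real.log (l k) / 2) + -((l k)⁻¹ - 1) / 2 * z k ^ 2)
      (Measure.pi fun k => gaussianReal 0 (Real.toNNReal (l k))) := fun k =>
    (integrable_const _).add ((hi2 k).const_mul _)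
  have hm : Measurable fun z : Fin p → ℝ => ∏ k, gaussRatio (l k) (z k) :=
    Finset.measurable_fun_prod _ fun k _ => (measurable_gaussRatio _).comp (measurable_pi_apply k)
  have hp : IsProbabilityMeasure (gaussLaw (diagonal fun k => √(l k))) := inferInstance
  have key := tvDist_withDensity_le (stdNormal p) hm
    (fun z => Finset.prod_pos fun k _ => gaussRatio_pos (hl k) _) (hν ▸ hp)
    (K := (∑ k, (l k - 1 - Real.log (l k))) / 2)
  rw [← hν, hpi] at key
  simp_rw [hlog] at key
  rw [hpi]
  refine (key (integrable_finsetSum _ fun k _ => hI k) ?_).trans (le_of_eq ?_)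
  · rw [integral_finsetSum _ fun k _ => hI k, Finset.sum_div]
    refine Finset.sum_le_sum fun k _ => le_of_eq ?_
    rw [integral_add (integrable_const _) ((hi2 k).const_mul _), integral_const_mul,
      integral_comp_eval (μ := fun k => gaussianReal 0 (Real.toNNReal (l k))) (i := k)
        (f := fun x : ℝ => x ^ 2) (by fun_prop), integral_sq_gaussianReal,
      Real.coe_toNNReal _ (hl k).le]
    have := (hl k).ne'
    simp
    field_simp
    ring
  · rw [div_div, Real.sqrt_div' _ (by norm_num)]
    congr 1
    rw [show (2 * 2 : ℝ) = 2 ^ 2 by norm_num]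
    exact Real.sqrt_sq (by norm_num)

/-- Pinsker's inequality between `N(0, 1)` and `N(0, G)`, where `G = A Aᵀ` is positive definite. -/
lemma tvDist_gaussLaw_le {p n : ℕ} {A : Matrix (Fin p) (Fin n) ℝ} (hA : (A * Aᵀ).PosDef) :
    tvDist (stdNormal p) (gaussLaw A)
      ≤ √((A * Aᵀ).trace - p - Real.log (A * Aᵀ).det) / 2 := by
  have hlpos := hA.eigenvalues_pos
  obtain ⟨O, hOO, -, hspec⟩ := exists_orthogonal_diagonal hA.isHermitian
  set l := hA.isHermitian.eigenvalues with hl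
  have h1 : gaussLaw A = (gaussLaw (diagonal fun k => √(l k))).map fun z => O *ᵥ z := by
    rw [← gaussLaw_mul]
    refine gaussLaw_congr ?_
    rw [hspec, transpose_mul, diagonal_transpose, Matrix.mul_assoc O, Matrix.mul_assoc O,
      ← Matrix.mul_assoc (diagonal _) (diagonal _), diagonal_mul_diagonal]
    simp_rw [Real.mul_self_sqrt (hlpos _).le]
  have h2 : stdNormal p = (stdNormal p).map fun z => O *ᵥ z := (gaussLaw_eq_stdNormal hOO).symm
  have h3 : tvDist (stdNormal p) (gaussLaw A)
      ≤ tvDist (stdNormal p) (gaussLaw (diagonal fun k => √(l k))) := by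
    rw [h1]
    conv_lhs => rw [h2]
    exact tvDist_map_le _ _ (measurable_mulVec O)
  refine h3.trans ((tvDist_gaussLaw_diagonal_le hlpos).trans (le_of_eq ?_))
  congr 2
  rw [Finset.sum_sub_distrib, Finset.sum_sub_distrib, hA.isHermitian.trace_eq_sum_eigenvalues,
    hA.isHermitian.det_eq_prod_eigenvalues]
  simp only [RCLike.ofReal_real_eq_id, id]
  rw [Real.log_prod fun k _ => (hlpos k).ne']
  simp [hl]

/-! ### Exponential moments of Gaussian quadratic forms -/

lemma lintegral_exp_quadratic_gaussianReal {m w : ℝ} (hm : 2 * m < 1) :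
    ∫⁻ x, ENNReal.ofReal (Real.exp (m * x ^ 2 + 2 * w * x)) ∂(gaussianReal 0 1)
      = ENNReal.ofReal ((√(1 - 2 * m))⁻¹ * Real.exp (2 * w ^ 2 / (1 - 2 * m))) := by
  have hs : 0 < 1 - 2 * m := by linarith
  have hv : Real.toNNReal (1 - 2 * m)⁻¹ ≠ 0 := by simpa using hs
  rw [gaussianReal_of_var_ne_zero _ one_ne_zero,
    lintegral_withDensity_eq_lintegral_mul _ (measurable_gaussianPDF _ _) (by fun_prop)]
  have h : ∀ x : ℝ, (gaussianPDF 0 1 * fun x =>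
      ENNReal.ofReal (Real.exp (m * x ^ 2 + 2 * w * x))) x
      = ENNReal.ofReal ((√(1 - 2 * m))⁻¹ * Real.exp (2 * w ^ 2 / (1 - 2 * m)))
        * ENNReal.ofReal (gaussianPDFReal (2 * w / (1 - 2 * m))
          (Real.toNNReal (1 - 2 * m)⁻¹) x) := by
    intro x
    simp only [Pi.mul_apply, gaussianPDF]
    rw [← ENNReal.ofReal_mul (gaussianPDFReal_nonneg _ _ _), ← ENNReal.ofReal_mul (by positivity)]
    congr 1
    simp only [gaussianPDFReal, NNReal.coe_one, Real.coe_toNNReal _ (inv_pos.2 hs).le, sub_zero,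
      mul_one]
    have h1 : √(2 * Real.pi * (1 - 2 * m)⁻¹) = √(2 * Real.pi) * (√(1 - 2 * m))⁻¹ := by
      rw [Real.sqrt_mul (by positivity), Real.sqrt_inv]
    have h2 : √(1 - 2 * m) ≠ 0 := (Real.sqrt_pos.2 hs).ne'
    rw [h1, mul_inv, inv_inv, mul_assoc, ← Real.exp_add,
      show ∀ a b c d e : ℝ, a * b * (c * d * e) = (a * d) * c * (b * e) by intros; ring,
      ← Real.exp_add, inv_mul_cancel₀ h2, one_mul]
    congr 2
    field_simp
    ring
  rw [lintegral_congr h, lintegral_const_mul _ (measurable_gaussianPDFReal _ _).ennreal_ofReal,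
    lintegral_gaussianPDFReal_eq_one _ hv, mul_one]

/-- Weighted arithmetic-geometric mean inequality with total weight at most one. -/
lemma prod_one_sub_rpow_le {n : ℕ} {a x : Fin n → ℝ} (ha : ∀ i, 0 ≤ a i) (hs : ∑ i, a i ≤ 1)
    (hx : ∀ i, x i ≤ 1) : ∏ i, (1 - x i) ^ a i ≤ 1 - ∑ i, x i * a i := by
  have h := Real.geom_mean_le_arith_mean_weighted (Finset.univ : Finset (Option (Fin n)))
    (fun o => o.elim (1 - ∑ i, a i) a) (fun o => o.elim 1 fun i => 1 - x i)
    (by rintro (_ | i) - <;> simp [hs, ha]) (by simp [Fintype.sum_option])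
    (by rintro (_ | i) - <;> simp [hx])
  simp only [Fintype.prod_option, Fintype.sum_option, Option.elim, Real.one_rpow, one_mul,
    mul_one] at h
  refine h.trans (le_of_eq ?_)
  simp only [mul_sub, mul_one, Finset.sum_sub_distrib]
  rw [sub_add_sub_cancel]
  congr 1
  exact Finset.sum_congr rfl fun i _ => mul_comm _ _

/-- Exponential moments of a noncentral Gaussian quadratic form whose noise covariance `R Rᵀ` is at
most twice the identity. In an eigenbasis of `Rᵀ diag(D) R` the moment factorises, and the
eigenvalues are combinations of the `2 D i` with total weight at most one; the inequality is a trace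
version of Jensen's inequality, with equality for `R Rᵀ = 2` and `b = 0`. -/
lemma lintegral_exp_quadratic_le {m n : ℕ} {R : Matrix (Fin m) (Fin n) ℝ}
    (hR : ∀ z, ∑ i, (R *ᵥ z) i ^ 2 ≤ 2 * ∑ j, z j ^ 2) (b : Fin m → ℝ) {D : Fin m → ℝ}
    (hD : ∀ i, 4 * D i < 1) :
    ∫⁻ z, ENNReal.ofReal (Real.exp (∑ i, D i * ((R *ᵥ z) i + b i) ^ 2)) ∂(stdNormal n)
      ≤ ENNReal.ofReal ((∏ i, (1 - 4 * D i) ^ (-(∑ j, R i j ^ 2) / 4))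
        * Real.exp (∑ i, b i ^ 2 * D i / (1 - 4 * D i))) := by
  have hM : (Rᵀ * diagonal D * R).IsHermitian := by
    simpa using isHermitian_mul_diagonal_mul Rᵀ D
  obtain ⟨O, hOO, hOO', hspec⟩ := exists_orthogonal_diagonal hM
  set μ := hM.eigenvalues
  set K := R * O with hK
  have hKspec : Kᵀ * diagonal D * K = diagonal μ := by
    calc Kᵀ * diagonal D * K = Oᵀ * (Rᵀ * diagonal D * R) * O := by
          simp only [hK, transpose_mul, Matrix.mul_assoc]
      _ = (Oᵀ * O) * diagonal μ * (Oᵀ * O) := by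
          rw [hspec]; simp only [Matrix.mul_assoc]
      _ = diagonal μ := by simp [hOO']
  have hnorm : ∀ z, ∑ j, (O *ᵥ z) j ^ 2 = ∑ j, z j ^ 2 := by
    intro z
    have : (O *ᵥ z) ⬝ᵥ (O *ᵥ z) = z ⬝ᵥ z := by
      rw [dotProduct_mulVec, vecMul_mulVec, ← dotProduct_mulVec, hOO']; simp
    simpa [dotProduct, sq] using this
  have hKz : ∀ z, K *ᵥ z = R *ᵥ (O *ᵥ z) := fun z => by simp [hK]
  have hKb : ∀ z, ∑ i, (K *ᵥ z) i ^ 2 ≤ 2 * ∑ j, z j ^ 2 := fun z => by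
    rw [hKz, ← hnorm z]; exact hR _
  have hquad : ∀ z, ∑ i, D i * (K *ᵥ z) i ^ 2 = ∑ j, μ j * z j ^ 2 := by
    intro z
    rw [← dotProduct_transpose_mul_diagonal, hKspec]
    simp only [dotProduct, mulVec_diagonal]
    exact Finset.sum_congr rfl fun i _ => by ring
  -- column `j` of `K` gives the Jensen weights for the eigenvalue `μ j`
  have hcol : ∀ j i, (K *ᵥ Pi.single j 1) i = K i j := fun j i => by simp
  have hKcol : ∀ j, ∑ i, K i j ^ 2 ≤ 2 := by
    intro j
    have := hKb (Pi.single j 1)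
    simp_rw [hcol] at this
    simpa [Pi.single_apply] using this
  have hμj : ∀ j, μ j = ∑ i, D i * K i j ^ 2 := by
    intro j
    have := hquad (Pi.single j 1)
    simp_rw [hcol] at this
    simpa [Pi.single_apply] using this.symm
  have hpos : ∀ i, 0 < 1 - 4 * D i := fun i => by linarith [hD i]
  have hgeo : ∀ j, ∏ i, (1 - 4 * D i) ^ (K i j ^ 2 / 2) ≤ 1 - 2 * μ j := by
    intro j
    have := prod_one_sub_rpow_le (a := fun i => K i j ^ 2 / 2) (x := fun i => 4 * D i)
      (fun i => by positivity) (by rw [← Finset.sum_div]; linarith [hKcol j])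
      (fun i => (hD i).le)
    refine this.trans (le_of_eq ?_)
    rw [hμj, Finset.mul_sum]
    congr 1
    exact Finset.sum_congr rfl fun i _ => by ring
  have hgpos : ∀ j, 0 < ∏ i, (1 - 4 * D i) ^ (K i j ^ 2 / 2) := fun j =>
    Finset.prod_pos fun i _ => Real.rpow_pos_of_pos (hpos i) _
  have hμ1 : ∀ j, 0 < 1 - 2 * μ j := fun j => (hgpos j).trans_le (hgeo j)
  set w : Fin n → ℝ := fun j => ∑ i, K i j * (D i * b i) with hw
  have hexpand : ∀ z, ∑ i, D i * ((R *ᵥ (O *ᵥ z)) i + b i) ^ 2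
      = ∑ i, D i * b i ^ 2 + ∑ j, (μ j * z j ^ 2 + 2 * w j * z j) := by
    intro z
    rw [← hKz, Finset.sum_add_distrib, ← hquad z]
    have h1 : ∑ j, 2 * w j * z j = ∑ i, 2 * (D i * b i) * (K *ᵥ z) i := by
      simp only [hw, mulVec, dotProduct, Finset.mul_sum, Finset.sum_mul]
      rw [Finset.sum_comm]
      exact Finset.sum_congr rfl fun i _ => Finset.sum_congr rfl fun j _ => by ring
    rw [h1, ← Finset.sum_add_distrib, ← Finset.sum_add_distrib]
    exact Finset.sum_congr rfl fun i _ => by ring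
  -- completing the square costs at most the stated exponential factor
  have hbias : ∑ i, D i * b i ^ 2 + ∑ j, 2 * w j ^ 2 / (1 - 2 * μ j)
      ≤ ∑ i, b i ^ 2 * D i / (1 - 4 * D i) := by
    set h : Fin n → ℝ := fun j => w j / (1 - 2 * μ j) with hh
    set y := K *ᵥ h with hy
    have hq1 : ∑ j, w j * h j = ∑ i, D i * b i * y i := by
      simp only [hw, hy, mulVec, dotProduct, Finset.mul_sum, Finset.sum_mul]
      rw [Finset.sum_comm]
      exact Finset.sum_congr rfl fun i _ => Finset.sum_congr rfl fun j _ => by ring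
    have hq2 : ∑ j, w j * h j = ∑ j, h j ^ 2 - 2 * ∑ i, D i * y i ^ 2 := by
      rw [hy, hquad h, Finset.mul_sum, ← Finset.sum_sub_distrib]
      refine Finset.sum_congr rfl fun j _ => ?_
      have := (hμ1 j).ne'
      simp only [hh]
      field_simp
    have hq3 : ∑ i, (1 - 4 * D i) * y i ^ 2 ≤ 2 * ∑ j, w j * h j := by
      rw [hq2]
      have h1 := hKb h
      rw [← hy] at h1
      have h2 : ∑ i, (1 - 4 * D i) * y i ^ 2 = ∑ i, y i ^ 2 - 4 * ∑ i, D i * y i ^ 2 := by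
        rw [Finset.mul_sum, ← Finset.sum_sub_distrib]
        exact Finset.sum_congr rfl fun i _ => by ring
      rw [h2]; linarith
    have hq4 : ∑ j, w j * h j ≤ ∑ i, ((1 - 4 * D i) * y i ^ 2 / 4
        + D i ^ 2 * b i ^ 2 / (1 - 4 * D i)) := by
      rw [hq1]
      refine Finset.sum_le_sum fun i _ => ?_
      have h1 := hpos i
      rw [← sub_nonneg, show (1 - 4 * D i) * y i ^ 2 / 4 + D i ^ 2 * b i ^ 2 / (1 - 4 * D i)
        - D i * b i * y i = ((1 - 4 * D i) * y i - 2 * (D i * b i)) ^ 2 / (4 * (1 - 4 * D i)) by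
          field_simp; ring]
      positivity
    rw [Finset.sum_add_distrib, ← Finset.sum_div] at hq4
    have h5 : ∑ j, 2 * w j ^ 2 / (1 - 2 * μ j) = 2 * ∑ j, w j * h j := by
      rw [Finset.mul_sum]
      refine Finset.sum_congr rfl fun j _ => ?_
      simp only [hh]; ring
    have h6 : ∑ i, b i ^ 2 * D i / (1 - 4 * D i)
        = ∑ i, D i * b i ^ 2 + 4 * ∑ i, D i ^ 2 * b i ^ 2 / (1 - 4 * D i) := by
      rw [Finset.mul_sum, ← Finset.sum_add_distrib]
      refine Finset.sum_congr rfl fun i _ => ?_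
      have h7 := (hpos i).ne'
      rw [div_eq_iff h7, add_mul, mul_assoc 4, div_mul_cancel₀ _ h7]
      ring
    rw [h5, h6]
    linarith
  have hrow : ∀ i, ∑ j, K i j ^ 2 = ∑ j, R i j ^ 2 := by
    intro i
    have h1 : K * Kᵀ = R * Rᵀ := by
      rw [hK, transpose_mul, Matrix.mul_assoc, ← Matrix.mul_assoc O, hOO, Matrix.one_mul]
    have h2 := congrFun (congrFun h1 i) i
    simpa [mul_apply, sq] using h2
  have hmeas : Measurable fun z : Fin n → ℝ =>
      ENNReal.ofReal (Real.exp (∑ i, D i * ((R *ᵥ z) i + b i) ^ 2)) := by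
    have h1 : ∀ i, Measurable fun z : Fin n → ℝ => (R *ᵥ z) i := measurable_mulVec_apply R
    fun_prop
  rw [← lintegral_stdNormal_rotate hOO hmeas]
  have hsplit : ∀ z : Fin n → ℝ,
      ENNReal.ofReal (Real.exp (∑ i, D i * ((R *ᵥ (O *ᵥ z)) i + b i) ^ 2))
        = ENNReal.ofReal (Real.exp (∑ i, D i * b i ^ 2))
          * ∏ j, ENNReal.ofReal (Real.exp (μ j * z j ^ 2 + 2 * w j * z j)) := by
    intro z
    rw [hexpand, Real.exp_add, ENNReal.ofReal_mul (Real.exp_pos _).le,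
      ← ENNReal.ofReal_prod_of_nonneg fun j _ => (Real.exp_pos _).le, ← Real.exp_sum]
  rw [lintegral_congr hsplit, lintegral_const_mul' _ _ ENNReal.ofReal_ne_top, stdNormal,
    lintegral_pi_prod (fun _ => gaussianReal 0 1)
      (f := fun j x => ENNReal.ofReal (Real.exp (μ j * x ^ 2 + 2 * w j * x)))
      fun j => by fun_prop]
  simp_rw [fun j => lintegral_exp_quadratic_gaussianReal (m := μ j) (w := w j)
    (by linarith [hμ1 j])]
  rw [← ENNReal.ofReal_prod_of_nonneg fun j _ => by positivity,
    ← ENNReal.ofReal_mul (Real.exp_pos _).le]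
  refine ENNReal.ofReal_le_ofReal ?_
  rw [Finset.prod_mul_distrib, ← Real.exp_sum, mul_left_comm, ← Real.exp_add]
  refine mul_le_mul ?_ (Real.exp_le_exp.2 hbias) (Real.exp_pos _).le
    (Finset.prod_nonneg fun i _ => (Real.rpow_pos_of_pos (hpos i) _).le)
  calc ∏ j, (√(1 - 2 * μ j))⁻¹ ≤ ∏ j, ∏ i, (1 - 4 * D i) ^ (-(K i j ^ 2) / 4) := by
        refine Finset.prod_le_prod (fun j _ => by positivity) fun j _ => ?_
        have h1 : ∏ i, (1 - 4 * D i) ^ (-(K i j ^ 2) / 4)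
            = (√(∏ i, (1 - 4 * D i) ^ (K i j ^ 2 / 2)))⁻¹ := by
          rw [Real.sqrt_eq_rpow, ← Real.rpow_neg (hgpos j).le,
            ← Real.finsetProd_rpow _ _ fun i _ => (Real.rpow_pos_of_pos (hpos i) _).le]
          refine Finset.prod_congr rfl fun i _ => ?_
          rw [← Real.rpow_mul (hpos i).le]
          congr 1; ring
        rw [h1]
        exact inv_anti₀ (Real.sqrt_pos.2 (hgpos j)) (Real.sqrt_le_sqrt (hgeo j))
    _ = ∏ i, (1 - 4 * D i) ^ (-(∑ j, R i j ^ 2) / 4) := by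
        rw [Finset.prod_comm]
        refine Finset.prod_congr rfl fun i _ => ?_
        rw [← Real.rpow_sum_of_pos (hpos i), ← Finset.sum_div, Finset.sum_neg_distrib, hrow]

/-- A bias `b i` of the `i`-th coordinate acts on exponential moments at most like an inflation of
its noise by the factor `1 + b i ^ 2 / v i`, where `v i` is the noise variance. -/
lemma lintegral_exp_quadratic_le_of_inflate {m n : ℕ} {R : Matrix (Fin m) (Fin n) ℝ}
    (hR : ∀ z, ∑ i, (R *ᵥ z) i ^ 2 ≤ 2 * ∑ j, z j ^ 2) (b : Fin m → ℝ) {D v : Fin m → ℝ}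
    (hv : ∀ i, ∑ j, R i j ^ 2 = v i) (hvpos : ∀ i, 0 < v i)
    (hD : ∀ i, 4 * ((1 + b i ^ 2 / v i) * D i) < 1) :
    ∫⁻ z, ENNReal.ofReal (Real.exp (∑ i, D i * ((R *ᵥ z) i + b i) ^ 2)) ∂(stdNormal n)
      ≤ ENNReal.ofReal (∏ i, (1 - 4 * ((1 + b i ^ 2 / v i) * D i)) ^ (-(v i) / 4)) := by
  have hc : ∀ i, 0 ≤ b i ^ 2 / v i := fun i => div_nonneg (sq_nonneg _) (hvpos i).le
  have hD' : ∀ i, 4 * D i < 1 := by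
    intro i
    by_cases h : D i ≤ 0
    · linarith
    · nlinarith [hD i, mul_nonneg (hc i) (not_le.1 h).le]
  refine (lintegral_exp_quadratic_le hR b hD').trans (ENNReal.ofReal_le_ofReal ?_)
  rw [Real.exp_sum, ← Finset.prod_mul_distrib]
  refine Finset.prod_le_prod (fun i _ => mul_nonneg (Real.rpow_nonneg (by linarith [hD' i]) _)
    (Real.exp_pos _).le) fun i _ => ?_
  have h1 : 0 < 1 - 4 * D i := by linarith [hD' i]
  have h2 : 0 < 1 - 4 * ((1 + b i ^ 2 / v i) * D i) := by linarith [hD i]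
  rw [hv, Real.rpow_def_of_pos h1, Real.rpow_def_of_pos h2, ← Real.exp_add]
  refine Real.exp_le_exp.2 ?_
  -- `log (1 - 4 m D) - log (1 - 4 D) ≤ (1 - 4 m D) / (1 - 4 D) - 1`
  have h3 := Real.log_le_sub_one_of_pos (div_pos h2 h1)
  rw [Real.log_div h2.ne' h1.ne'] at h3
  have h4 : (1 - 4 * ((1 + b i ^ 2 / v i) * D i)) / (1 - 4 * D i) - 1
      = -(4 / v i) * (b i ^ 2 * D i / (1 - 4 * D i)) := by
    have := (hvpos i).ne'
    have := h1.ne'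
    field_simp
    ring
  rw [h4] at h3
  have h5 := mul_le_mul_of_nonneg_left h3 (by linarith [hvpos i] : 0 ≤ v i / 4)
  have h6 : v i / 4 * (-(4 / v i) * (b i ^ 2 * D i / (1 - 4 * D i)))
      = -(b i ^ 2 * D i / (1 - 4 * D i)) := by
    have := (hvpos i).ne'
    field_simp
  rw [h6] at h5
  linarith

/-! ### A Brascamp-Lieb inequality -/

section Transport

variable {f : ℝ → ℝ}

lemma hasDerivAt_integral_Iic (hf : Continuous f) (hi : Integrable f) (t : ℝ) :
    HasDerivAt (fun t => ∫ x in Iic t, f x) (f t) t := by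
  have h : (fun t => ∫ x in Iic t, f x)
      = fun t => (∫ x in Iic 0, f x) + ∫ x in (0 : ℝ)..t, f x := by
    ext t
    rw [← intervalIntegral.integral_Iic_sub_Iic hi.integrableOn hi.integrableOn]
    ring
  rw [h]
  exact (intervalIntegral.integral_hasDerivAt_right (hf.intervalIntegrable _ _)
    (hf.stronglyMeasurableAtFilter _ _) hf.continuousAt).const_add _

lemma strictMono_integral_Iic (hf : Continuous f) (hi : Integrable f) (hpos : ∀ x, 0 < f x) :
    StrictMono fun t => ∫ x in Iic t, f x :=
  strictMono_of_hasDerivAt_pos (hasDerivAt_integral_Iic hf hi) hpos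

lemma tendsto_integral_Iic_atTop (hi : Integrable f) (h1 : ∫ x, f x = 1) :
    Tendsto (fun t => ∫ x in Iic t, f x) atTop (𝓝 1) := by
  rw [← h1]
  exact (aecover_Iic tendsto_id).integral_tendsto_of_countably_generated hi

lemma tendsto_integral_Iic_atBot (hi : Integrable f) (h1 : ∫ x, f x = 1) :
    Tendsto (fun t => ∫ x in Iic t, f x) atBot (𝓝 0) := by
  have h : (fun t => ∫ x in Iic t, f x) = fun t => 1 - ∫ x in Ioi t, f x := by
    ext t
    rw [← h1, ← intervalIntegral.integral_Iic_add_Ioi (b := t) hi.integrableOn hi.integrableOn]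
    ring
  rw [h]
  have h2 : Tendsto (fun t => ∫ x in Ioi t, f x) atBot (𝓝 1) := by
    rw [← h1]
    exact (aecover_Ioi tendsto_id).integral_tendsto_of_countably_generated hi
  simpa using h2.const_sub 1

lemma range_integral_Iic (hf : Continuous f) (hi : Integrable f) (hpos : ∀ x, 0 < f x)
    (h1 : ∫ x, f x = 1) : range (fun t => ∫ x in Iic t, f x) = Ioo 0 1 := by
  have hm := strictMono_integral_Iic hf hi hpos
  have hb := tendsto_integral_Iic_atBot hi h1
  have ht := tendsto_integral_Iic_atTop hi h1
  have hc : Continuous fun t => ∫ x in Iic t, f x :=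
    continuous_iff_continuousAt.2 fun t => (hasDerivAt_integral_Iic hf hi t).continuousAt
  refine Subset.antisymm ?_ fun y hy => ?_
  · rintro _ ⟨t, rfl⟩
    exact ⟨(hm.monotone.le_of_tendsto hb (t - 1)).trans_lt (hm (by linarith)),
      (hm (by linarith : t < t + 1)).trans_le (hm.monotone.ge_of_tendsto ht (t + 1))⟩
  · obtain ⟨a, ha⟩ := (hb.eventually (gt_mem_nhds hy.1)).exists
    obtain ⟨b, hb⟩ := (ht.eventually (lt_mem_nhds hy.2)).exists
    exact mem_range_of_exists_le_of_exists_ge hc ⟨a, ha.le⟩ ⟨b, hb.le⟩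

/-- Monotone transport of a positive continuous probability density to the standard normal one. -/
lemma exists_gaussian_transport (hf : Continuous f) (hi : Integrable f) (hpos : ∀ x, 0 < f x)
    (h1 : ∫ x, f x = 1) :
    ∃ T T' : ℝ → ℝ, ∀ t, HasDerivAt T (T' t) t ∧ 0 < T' t ∧
      f t = T' t * gaussianPDFReal 0 1 (T t) := by
  set F := fun t => ∫ x in Iic t, f x with hF
  have hgc : Continuous (gaussianPDFReal 0 1) := by
    unfold gaussianPDFReal; fun_prop
  have hgi := integrable_gaussianPDFReal 0 1
  have hgp := fun x => gaussianPDFReal_pos 0 1 x one_ne_zero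
  have hg1 := integral_gaussianPDFReal_eq_one 0 (v := 1) one_ne_zero
  set G := fun t => ∫ x in Iic t, gaussianPDFReal 0 1 x with hG
  have hGm : StrictMono G := strictMono_integral_Iic hgc hgi hgp
  have hGr : range G = Ioo 0 1 := range_integral_Iic hgc hgi hgp hg1
  have hFr : range F = Ioo 0 1 := range_integral_Iic hf hi hpos h1
  have hinv : ∀ y ∈ Ioo (0 : ℝ) 1, G (Function.invFun G y) = y := fun y hy => by
    rw [← hGr] at hy; exact Function.invFun_eq hy
  have hinvm : StrictMonoOn (Function.invFun G) (Ioo 0 1) := fun a ha b hb hab => by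
    rw [← hGm.lt_iff_lt, hinv a ha, hinv b hb]; exact hab
  have himg : Function.invFun G '' Ioo 0 1 = univ := by
    refine eq_univ_of_forall fun x => ⟨G x, hGr ▸ mem_range_self x, ?_⟩
    exact Function.leftInverse_invFun hGm.injective x
  have hFmem : ∀ t, F t ∈ Ioo (0 : ℝ) 1 := fun t => hFr ▸ mem_range_self t
  have hder : ∀ t, HasDerivAt (fun t => Function.invFun G (F t))
      ((gaussianPDFReal 0 1 (Function.invFun G (F t)))⁻¹ * f t) t := by
    intro t
    have hn : Ioo (0 : ℝ) 1 ∈ 𝓝 (F t) := isOpen_Ioo.mem_nhds (hFmem t)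
    have hcont : ContinuousAt (Function.invFun G) (F t) :=
      hinvm.continuousAt_of_image_mem_nhds hn (by rw [himg]; exact univ_mem)
    have h2 : HasDerivAt (Function.invFun G)
        (gaussianPDFReal 0 1 (Function.invFun G (F t)))⁻¹ (F t) :=
      HasDerivAt.of_local_left_inverse hcont (hasDerivAt_integral_Iic hgc hgi _) (hgp _).ne'
        (by filter_upwards [hn] with y hy using hinv y hy)
    exact h2.comp t (hasDerivAt_integral_Iic hf hi t)
  refine ⟨_, _, fun t => ⟨hder t, mul_pos (inv_pos.2 (hgp _)) (hpos t), ?_⟩⟩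
  field_simp [(hgp (Function.invFun G (F t))).ne']

end Transport

/-- If `∑ c i • y i (y i)ᵀ = 1` for unit vectors `y i` (the rows of `Y`), then
`det (∑ τ i • c i • y i (y i)ᵀ) ≥ ∏ τ i ^ c i`. -/
lemma prod_rpow_le_det {N p : ℕ} {Y : Matrix (Fin N) (Fin p) ℝ} {c τ : Fin N → ℝ}
    (hc : ∀ i, 0 ≤ c i) (hY : Yᵀ * diagonal c * Y = 1)
    (hY1 : ∀ i, c i ≠ 0 → ∑ j, Y i j ^ 2 = 1) (hτ : ∀ i, 0 < τ i) :
    ∏ i, τ i ^ c i ≤ (Yᵀ * diagonal (fun i => c i * τ i) * Y).det := by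
  have hM : (Yᵀ * diagonal (fun i => c i * τ i) * Y).IsHermitian := by
    simpa using isHermitian_mul_diagonal_mul Yᵀ fun i => c i * τ i
  have hdet : (Yᵀ * diagonal (fun i => c i * τ i) * Y).det = ∏ j, hM.eigenvalues j := by
    simpa using hM.det_eq_prod_eigenvalues
  obtain ⟨O, hOO, hOO', hspec⟩ := exists_orthogonal_diagonal hM
  set l := hM.eigenvalues
  set K := Y * O with hK
  have hKd : ∀ D : Fin N → ℝ, Kᵀ * diagonal D * K = Oᵀ * (Yᵀ * diagonal D * Y) * O := fun D => by
    simp only [hK, transpose_mul, Matrix.mul_assoc]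
  have hentry : ∀ (D : Fin N → ℝ) j, (Kᵀ * diagonal D * K) j j = ∑ i, D i * K i j ^ 2 := by
    intro D j
    rw [mul_apply]
    simp only [mul_diagonal, transpose_apply]
    exact Finset.sum_congr rfl fun i _ => by ring
  have hlj : ∀ j, l j = ∑ i, c i * τ i * K i j ^ 2 := by
    intro j
    rw [← hentry, hKd, hspec]
    have : Oᵀ * (O * diagonal l * Oᵀ) * O = (Oᵀ * O) * diagonal l * (Oᵀ * O) := by
      simp only [Matrix.mul_assoc]
    rw [this, hOO']; simp
  have hwj : ∀ j, ∑ i, c i * K i j ^ 2 = 1 := by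
    intro j
    rw [← hentry, hKd, hY]; simp [hOO']
  have hrow : ∀ i, c i ≠ 0 → ∑ j, K i j ^ 2 = 1 := by
    intro i hi
    have h1 : K * Kᵀ = Y * Yᵀ := by
      rw [hK, transpose_mul, Matrix.mul_assoc, ← Matrix.mul_assoc O, hOO, Matrix.one_mul]
    have h2 := congrFun (congrFun h1 i) i
    rw [← hY1 i hi]
    simpa [mul_apply, sq] using h2
  have hgeo : ∀ j, ∏ i, τ i ^ (c i * K i j ^ 2) ≤ l j := by
    intro j
    refine (Real.geom_mean_le_arith_mean_weighted Finset.univ (fun i => c i * K i j ^ 2) τ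
      (fun i _ => mul_nonneg (hc i) (sq_nonneg _)) (hwj j) fun i _ => (hτ i).le).trans
      (le_of_eq ?_)
    rw [hlj]
    exact Finset.sum_congr rfl fun i _ => by ring
  rw [hdet]
  calc ∏ i, τ i ^ c i = ∏ j, ∏ i, τ i ^ (c i * K i j ^ 2) := by
        rw [Finset.prod_comm]
        refine Finset.prod_congr rfl fun i _ => ?_
        rw [← Real.rpow_sum_of_pos (hτ i), ← Finset.mul_sum]
        by_cases h : c i = 0
        · simp [h]
        · rw [hrow i h, mul_one]
    _ ≤ ∏ j, l j := Finset.prod_le_prod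
        (fun j _ => Finset.prod_nonneg fun i _ => Real.rpow_nonneg (hτ i).le _) fun j _ => hgeo j

/-- The geometric Brascamp-Lieb inequality for positive continuous functions of one-dimensional
projections, by Barthe's transport argument: the map `z ↦ ∑ c i • T i (⟨y i, z⟩) • y i`, where `T i`
transports the normalised `f i` to the standard normal density, is injective with Jacobian at least
`∏ (T i)' ^ c i`, and pulls back a Gaussian integral of total mass one. -/
lemma lintegral_prod_rpow_le {N p : ℕ} {Y : Matrix (Fin N) (Fin p) ℝ} {c : Fin N → ℝ}
    (hc : ∀ i, 0 ≤ c i) (hY : Yᵀ * diagonal c * Y = 1)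
    (hY1 : ∀ i, c i ≠ 0 → ∑ j, Y i j ^ 2 = 1) {f : Fin N → ℝ → ℝ} (hf : ∀ i, Continuous (f i))
    (hi : ∀ i, Integrable (f i)) (hpos : ∀ i x, 0 < f i x) :
    ∫⁻ z : Fin p → ℝ, ENNReal.ofReal (∏ i, f i ((Y *ᵥ z) i) ^ c i)
      ≤ ENNReal.ofReal (∏ i, (∫ x, f i x) ^ c i) := by
  set I : Fin N → ℝ := fun i => ∫ x, f i x with hI
  have hIpos : ∀ i, 0 < I i := fun i => by
    rw [hI, integral_pos_iff_support_of_nonneg (fun x => (hpos i x).le) (hi i)]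
    have : Function.support (f i) = univ := eq_univ_of_forall fun x => (hpos i x).ne'
    simp [this]
  have hex : ∀ i, ∃ T T' : ℝ → ℝ, ∀ t, HasDerivAt T (T' t) t ∧ 0 < T' t ∧
      f i t / I i = T' t * gaussianPDFReal 0 1 (T t) := fun i =>
    exists_gaussian_transport ((hf i).div_const _) ((hi i).div_const _)
      (fun x => div_pos (hpos i x) (hIpos i))
      (by rw [integral_div]; exact div_self (hIpos i).ne')
  choose T T' hT using hex
  have hTm : ∀ i, StrictMono (T i) := fun i =>
    strictMono_of_hasDerivAt_pos (fun t => (hT i t).1) fun t => (hT i t).2.1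
  set M : (Fin p → ℝ) → Matrix (Fin p) (Fin p) ℝ := fun z =>
    Yᵀ * diagonal (fun i => c i * T' i ((Y *ᵥ z) i)) * Y with hM
  set Θ : (Fin p → ℝ) → Fin p → ℝ := fun z => Yᵀ *ᵥ fun i => c i * T i ((Y *ᵥ z) i) with hΘ
  have hquad : ∀ z, ∑ i, c i * (Y *ᵥ z) i ^ 2 = ∑ j, z j ^ 2 := by
    intro z
    rw [← dotProduct_transpose_mul_diagonal, hY, one_mulVec, sum_sq_eq_dotProduct]
  have hsumc : ∑ i, c i = p := by
    rw [← trace_transpose_mul_diagonal hY1, hY]; simp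
  -- `M z` is the Jacobian matrix of the transport map `Θ` at `z`
  have hΘM : ∀ z, HasFDerivAt Θ (toLin' (M z)).toContinuousLinearMap z := by
    intro z
    have hB : HasFDerivAt (fun z => Y *ᵥ z) (toLin' Y).toContinuousLinearMap z :=
      (toLin' Y).toContinuousLinearMap.hasFDerivAt
    have hA : ∀ x, HasFDerivAt (fun x => Yᵀ *ᵥ x) (toLin' Yᵀ).toContinuousLinearMap x := fun x =>
      (toLin' Yᵀ).toContinuousLinearMap.hasFDerivAt
    have hD : ∀ x : Fin N → ℝ, HasFDerivAt (fun (x : Fin N → ℝ) i => c i * T i (x i))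
        (toLin' (diagonal fun i => c i * T' i (x i))).toContinuousLinearMap x := by
      intro x
      rw [hasFDerivAt_pi']
      intro i
      have h1 : HasFDerivAt (fun x : Fin N → ℝ => x i)
        (ContinuousLinearMap.proj (R := ℝ) (φ := fun _ : Fin N => ℝ) i) x :=
        (ContinuousLinearMap.proj (R := ℝ) (φ := fun _ : Fin N => ℝ) i).hasFDerivAt
      have h2 := (((hT i (x i)).1).comp_hasFDerivAt x h1).const_mul (c i)
      refine h2.congr_fderiv ?_
      ext v
      simp [mulVec_diagonal, mul_assoc]
    have h := (hA _).comp z ((hD _).comp z hB)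
    refine h.congr_fderiv ?_
    ext v
    simp [hM, mulVec_mulVec, Matrix.mul_assoc]
  have hdet : ∀ z, (toLin' (M z)).toContinuousLinearMap.det = (M z).det := fun z => by
    rw [ContinuousLinearMap.det, LinearMap.coe_toContinuousLinearMap, LinearMap.det_toLin']
  -- `⟨z - z', Θ z - Θ z'⟩` is a sum of nonnegative terms, as every `T i` is strictly increasing
  have hinj : InjOn Θ univ := by
    intro z _ z' _ hzz
    have h1 : (z - z') ⬝ᵥ (Θ z - Θ z') = ∑ i, c i * ((T i ((Y *ᵥ z) i) - T i ((Y *ᵥ z') i))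
        * ((Y *ᵥ z) i - (Y *ᵥ z') i)) := by
      rw [hΘ, ← mulVec_sub, dotProduct_mulVec, vecMul_transpose, mulVec_sub]
      simp only [dotProduct, Pi.sub_apply]
      exact Finset.sum_congr rfl fun i _ => by ring
    have hmono : ∀ i a b, a ≠ b → 0 < (T i a - T i b) * (a - b) := by
      intro i a b hab
      rcases lt_or_gt_of_ne hab with h | h
      · exact mul_pos_of_neg_of_neg (sub_neg.2 (hTm i h)) (sub_neg.2 h)
      · exact mul_pos (sub_pos.2 (hTm i h)) (sub_pos.2 h)
    have hnn : ∀ i a b, 0 ≤ (T i a - T i b) * (a - b) := fun i a b => by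
      by_cases h : a = b
      · simp [h]
      · exact (hmono i a b h).le
    rw [hzz, sub_self, dotProduct_zero] at h1
    have h2 := (Finset.sum_eq_zero_iff_of_nonneg fun i _ => mul_nonneg (hc i) (hnn i _ _)).1 h1.symm
    have h3 : ∑ i, c i * (Y *ᵥ (z - z')) i ^ 2 = 0 := by
      refine Finset.sum_eq_zero fun i hi => ?_
      rcases mul_eq_zero.1 (h2 i hi) with h | h
      · simp [h]
      · have : (Y *ᵥ z) i = (Y *ᵥ z') i := by
          by_contra hne
          exact (hmono i _ _ hne).ne' h
        simp [mulVec_sub, this]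
    rw [hquad] at h3
    have h4 := (Finset.sum_eq_zero_iff_of_nonneg fun j _ => sq_nonneg _).1 h3
    ext j
    have := h4 j (Finset.mem_univ _)
    simpa [sub_eq_zero] using this
  -- `∑ c i • τ i • y i` is at most as long as the vector `τ` in the Euclidean norm with weights `c`
  have hnorm : ∀ z, ∑ j, Θ z j ^ 2 ≤ ∑ i, c i * T i ((Y *ᵥ z) i) ^ 2 := by
    intro z
    set τ : Fin N → ℝ := fun i => T i ((Y *ᵥ z) i) with hτ
    have h1 : ∑ j, Θ z j ^ 2 = ∑ i, c i * (τ i * (Y *ᵥ Θ z) i) := by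
      have : Θ z ⬝ᵥ Θ z = ∑ i, c i * (τ i * (Y *ᵥ Θ z) i) := by
        conv_lhs => rw [hΘ]
        rw [← hΘ, dotProduct_comm, dotProduct_mulVec, vecMul_transpose]
        simp only [dotProduct]
        exact Finset.sum_congr rfl fun i _ => by ring
      rw [← this]; simp [dotProduct, sq]
    have h2 : ∑ i, c i * (τ i * (Y *ᵥ Θ z) i)
        ≤ ∑ i, (c i * τ i ^ 2 / 2 + c i * (Y *ᵥ Θ z) i ^ 2 / 2) := by
      refine Finset.sum_le_sum fun i _ => ?_
      nlinarith [mul_nonneg (hc i) (sq_nonneg (τ i - (Y *ᵥ Θ z) i))]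
    rw [Finset.sum_add_distrib, ← Finset.sum_div, ← Finset.sum_div, hquad] at h2
    linarith
  have hpoint : ∀ z, ∏ i, f i ((Y *ᵥ z) i) ^ c i
      ≤ (∏ i, I i ^ c i) * ((M z).det * ∏ j, gaussianPDFReal 0 1 (Θ z j)) := by
    intro z
    set τ : Fin N → ℝ := fun i => T i ((Y *ᵥ z) i) with hτ
    have hfi : ∀ i, f i ((Y *ᵥ z) i) ^ c i
        = I i ^ c i * (T' i ((Y *ᵥ z) i) ^ c i * gaussianPDFReal 0 1 (τ i) ^ c i) := by
      intro i
      have h1 := (hT i ((Y *ᵥ z) i)).2.2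
      rw [div_eq_iff (hIpos i).ne'] at h1
      rw [h1, mul_comm, Real.mul_rpow (hIpos i).le (mul_pos (hT i _).2.1
        (gaussianPDFReal_pos _ _ _ one_ne_zero)).le, Real.mul_rpow (hT i _).2.1.le
        (gaussianPDFReal_nonneg _ _ _)]
    simp_rw [hfi]
    rw [Finset.prod_mul_distrib, Finset.prod_mul_distrib]
    refine mul_le_mul_of_nonneg_left ?_
      (Finset.prod_nonneg fun i _ => Real.rpow_nonneg (hIpos i).le _)
    have hd := prod_rpow_le_det hc hY hY1 (τ := fun i => T' i ((Y *ᵥ z) i))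
      fun i => (hT i _).2.1
    refine mul_le_mul hd ?_ (Finset.prod_nonneg fun i _ =>
      Real.rpow_nonneg (gaussianPDFReal_nonneg _ _ _) _) ((Finset.prod_nonneg fun i _ =>
        Real.rpow_nonneg (hT i _).2.1.le _).trans hd)
    have hg : ∀ x, gaussianPDFReal 0 1 x = (√(2 * Real.pi))⁻¹ * Real.exp (-x ^ 2 / 2) := by
      intro x; simp [gaussianPDFReal]
    have hs : (0 : ℝ) < (√(2 * Real.pi))⁻¹ := by positivity
    have hl : ∏ i, gaussianPDFReal 0 1 (τ i) ^ c i
        = (√(2 * Real.pi))⁻¹ ^ p * Real.exp (-(∑ i, c i * τ i ^ 2) / 2) := by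
      simp_rw [hg, Real.mul_rpow hs.le (Real.exp_pos _).le]
      rw [Finset.prod_mul_distrib, ← Real.rpow_sum_of_pos hs, hsumc, Real.rpow_natCast]
      simp_rw [← Real.exp_mul]
      rw [← Real.exp_sum, ← Finset.sum_neg_distrib, Finset.sum_div]
      congr 2
      exact Finset.sum_congr rfl fun i _ => by ring
    have hr : ∏ j, gaussianPDFReal 0 1 (Θ z j)
        = (√(2 * Real.pi))⁻¹ ^ p * Real.exp (-(∑ j, Θ z j ^ 2) / 2) := by
      simp_rw [hg]
      rw [Finset.prod_mul_distrib, ← Real.exp_sum, ← Finset.sum_neg_distrib, Finset.sum_div]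
      simp
    rw [hl, hr]
    refine mul_le_mul_of_nonneg_left (Real.exp_le_exp.2 ?_) (by positivity)
    linarith [hnorm z]
  have hone : ∫⁻ z : Fin p → ℝ, ∏ j, gaussianPDF 0 1 (z j) = 1 := by
    rw [volume_pi, lintegral_pi_prod (fun _ => volume) (f := fun _ x => gaussianPDF 0 1 x)
      fun j => measurable_gaussianPDF _ _]
    simp [lintegral_gaussianPDF_eq_one 0 one_ne_zero]
  calc ∫⁻ z : Fin p → ℝ, ENNReal.ofReal (∏ i, f i ((Y *ᵥ z) i) ^ c i)
      ≤ ∫⁻ z : Fin p → ℝ, ENNReal.ofReal (∏ i, I i ^ c i)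
        * (ENNReal.ofReal |(toLin' (M z)).toContinuousLinearMap.det|
          * ∏ j, gaussianPDF 0 1 (Θ z j)) := by
        refine lintegral_mono fun z => ?_
        have hPi : 0 ≤ ∏ i, I i ^ c i :=
          Finset.prod_nonneg fun i _ => Real.rpow_nonneg (hIpos i).le _
        refine (ENNReal.ofReal_le_ofReal ((hpoint z).trans (mul_le_mul_of_nonneg_left
          (mul_le_mul_of_nonneg_right (le_abs_self _) (Finset.prod_nonneg fun j _ =>
            gaussianPDFReal_nonneg _ _ _)) hPi))).trans (le_of_eq ?_)
        rw [ENNReal.ofReal_mul hPi, ENNReal.ofReal_mul (abs_nonneg _), hdet,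
          ENNReal.ofReal_prod_of_nonneg fun j _ => gaussianPDFReal_nonneg _ _ _]
        rfl
    _ = ENNReal.ofReal (∏ i, I i ^ c i)
        * ∫⁻ z in Θ '' univ, ∏ j, gaussianPDF 0 1 (z j) := by
        rw [lintegral_const_mul' _ _ ENNReal.ofReal_ne_top,
          lintegral_image_eq_lintegral_abs_det_fderiv_mul volume MeasurableSet.univ
            (fun z _ => (hΘM z).hasFDerivWithinAt) hinj, Measure.restrict_univ]
    _ ≤ ENNReal.ofReal (∏ i, I i ^ c i) * 1 := by
        gcongr
        exact (setLIntegral_le_lintegral _ _).trans hone.le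
    _ = _ := mul_one _

/-! ### Powers of quadratic forms -/

/-- Log-convexity of `Γ` at `b`, the midpoint of `b - 1 / 2` and `b + 1 / 2`. -/
lemma Gamma_sq_mul_sub_half_le {b : ℝ} (hb : 1 / 2 < b) :
    Real.Gamma b ^ 2 * (b - 1 / 2) ≤ Real.Gamma (b + 1 / 2) ^ 2 := by
  have h0 : 0 < b - 1 / 2 := by linarith
  have h1 := Real.Gamma_mul_add_mul_le_rpow_Gamma_mul_rpow_Gamma (s := b - 1 / 2) (t := b + 1 / 2)
    (a := 1 / 2) (b := 1 / 2) h0 (by linarith) (by norm_num) (by norm_num) (by norm_num)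
  rw [show (1 : ℝ) / 2 * (b - 1 / 2) + 1 / 2 * (b + 1 / 2) = b by ring, ← Real.sqrt_eq_rpow,
    ← Real.sqrt_eq_rpow] at h1
  have hg := Real.Gamma_pos_of_pos h0
  have hg' := Real.Gamma_pos_of_pos (by linarith : 0 < b + 1 / 2)
  have h2 : Real.Gamma b ^ 2 ≤ Real.Gamma (b - 1 / 2) * Real.Gamma (b + 1 / 2) := by
    calc Real.Gamma b ^ 2 ≤ (√(Real.Gamma (b - 1 / 2)) * √(Real.Gamma (b + 1 / 2))) ^ 2 := by
          have := (Real.Gamma_pos_of_pos (by linarith : 0 < b)).le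
          gcongr
      _ = _ := by rw [mul_pow, Real.sq_sqrt hg.le, Real.sq_sqrt hg'.le]
  have h3 : Real.Gamma (b + 1 / 2) = (b - 1 / 2) * Real.Gamma (b - 1 / 2) := by
    rw [← Real.Gamma_add_one h0.ne']; congr 1; ring
  calc Real.Gamma b ^ 2 * (b - 1 / 2)
      ≤ (Real.Gamma (b - 1 / 2) * Real.Gamma (b + 1 / 2)) * (b - 1 / 2) := by gcongr
    _ = Real.Gamma (b + 1 / 2) ^ 2 := by rw [sq, h3]; ring

lemma Gamma_sq_mul_le_add_nat {b : ℝ} (hb : 1 / 4 < b) (N : ℕ) :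
    Real.Gamma b ^ 2 * (b - 1 / 4) * Real.Gamma (b + N + 1 / 2) ^ 2
      ≤ Real.Gamma (b + N) ^ 2 * (b + N - 1 / 4) * Real.Gamma (b + 1 / 2) ^ 2 := by
  induction N with
  | zero => simp only [Nat.cast_zero, add_zero]; linarith
  | succ N ih =>
    set c := b + N with hc
    have hc4 : 1 / 4 < c := by have := N.cast_nonneg (α := ℝ); linarith
    have e1 : b + (N + 1 : ℕ) = c + 1 := by push_cast; ring
    have e2 : c + 1 + 1 / 2 = (c + 1 / 2) + 1 := by ring
    rw [e1, e2, Real.Gamma_add_one (by linarith : c ≠ 0),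
      Real.Gamma_add_one (by linarith : c + 1 / 2 ≠ 0)]
    have h1 : (c + 1 / 2) ^ 2 * (c - 1 / 4) ≤ c ^ 2 * (c + 1 - 1 / 4) := by nlinarith
    have h2 := mul_le_mul_of_nonneg_left ih (sq_nonneg (c + 1 / 2))
    calc Real.Gamma b ^ 2 * (b - 1 / 4) * ((c + 1 / 2) * Real.Gamma (c + 1 / 2)) ^ 2
        = (c + 1 / 2) ^ 2 * (Real.Gamma b ^ 2 * (b - 1 / 4) * Real.Gamma (c + 1 / 2) ^ 2) := by ring
      _ ≤ ((c + 1 / 2) ^ 2 * (c - 1 / 4)) * (Real.Gamma c ^ 2 * Real.Gamma (b + 1 / 2) ^ 2) := by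
          refine h2.trans (le_of_eq ?_); ring
      _ ≤ (c ^ 2 * (c + 1 - 1 / 4)) * (Real.Gamma c ^ 2 * Real.Gamma (b + 1 / 2) ^ 2) := by
          gcongr
      _ = _ := by ring

/-- A sharp form of Gautschi's inequality: `Γ(b)² (b - 1/4) / Γ(b + 1/2)²` increases along
`b ↦ b + 1` and tends to one. -/
lemma Gamma_sq_mul_sub_quarter_le {b : ℝ} (hb : 1 / 4 < b) :
    Real.Gamma b ^ 2 * (b - 1 / 4) ≤ Real.Gamma (b + 1 / 2) ^ 2 := by
  set A := Real.Gamma b ^ 2 * (b - 1 / 4) with hA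
  set C := Real.Gamma (b + 1 / 2) ^ 2 with hC
  have hkey : ∀ N : ℕ, 0 < N → A * (b + N - 1 / 2) ≤ (b + N - 1 / 4) * C := by
    intro N hN
    have hN1 : (1 : ℝ) ≤ N := by exact_mod_cast hN
    have h1 := Gamma_sq_mul_le_add_nat hb N
    have h2 := Gamma_sq_mul_sub_half_le (b := b + N) (by linarith)
    have hg : 0 < Real.Gamma (b + N) ^ 2 := by
      have := Real.Gamma_pos_of_pos (by linarith : 0 < b + N); positivity
    have hA0 : 0 ≤ A := mul_nonneg (sq_nonneg _) (by linarith)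
    have h3 := (mul_le_mul_of_nonneg_left h2 hA0).trans h1
    refine le_of_mul_le_mul_left ?_ hg
    calc Real.Gamma (b + N) ^ 2 * (A * (b + N - 1 / 2))
        = A * (Real.Gamma (b + N) ^ 2 * (b + N - 1 / 2)) := by ring
      _ ≤ _ := h3
      _ = _ := by ring
  by_contra! hlt
  obtain ⟨N, hN⟩ := exists_nat_gt (C / (A - C))
  have hN' := hkey (N + 1) (Nat.succ_pos _)
  rw [div_lt_iff₀ (sub_pos.2 hlt)] at hN
  push_cast at hN'
  have hC0 : 0 ≤ C := sq_nonneg _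
  nlinarith

lemma lintegral_rpow_mul_exp_neg_mul_Ioi {a r : ℝ} (ha : 0 < a) (hr : 0 < r) :
    ∫⁻ t in Ioi (0 : ℝ), ENNReal.ofReal (t ^ (a - 1) * Real.exp (-(r * t)))
      = ENNReal.ofReal ((1 / r) ^ a * Real.Gamma a) := by
  have h := Real.integral_rpow_mul_exp_neg_mul_Ioi ha hr
  have hpos : 0 < (1 / r) ^ a * Real.Gamma a :=
    mul_pos (Real.rpow_pos_of_pos (by positivity) _) (Real.Gamma_pos_of_pos ha)
  have hi : IntegrableOn (fun t : ℝ => t ^ (a - 1) * Real.exp (-(r * t))) (Ioi 0) := by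
    by_contra hn
    rw [integral_undef hn] at h
    exact hpos.ne h
  rw [← h, ofReal_integral_eq_lintegral_ofReal hi]
  filter_upwards [ae_restrict_mem measurableSet_Ioi] with t ht
  have : (0 : ℝ) < t := ht
  positivity

/-- The integral of `(1 + x²) ^ (-a)`, computed by writing this power as a mixture of Gaussian
functions with Gamma weights. -/
lemma lintegral_one_add_sq_rpow {a : ℝ} (ha : 1 / 2 < a) :
    ∫⁻ x : ℝ, ENNReal.ofReal ((1 + x ^ 2) ^ (-a))
      = ENNReal.ofReal (√Real.pi * Real.Gamma (a - 1 / 2) / Real.Gamma a) := by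
  have hg := Real.Gamma_pos_of_pos (by linarith : 0 < a)
  have h1 : ∀ x : ℝ, ENNReal.ofReal ((1 + x ^ 2) ^ (-a)) = ENNReal.ofReal (Real.Gamma a)⁻¹
      * ∫⁻ t in Ioi (0 : ℝ), ENNReal.ofReal (t ^ (a - 1) * Real.exp (-((1 + x ^ 2) * t))) := by
    intro x
    have hx : (0 : ℝ) < 1 + x ^ 2 := by positivity
    rw [lintegral_rpow_mul_exp_neg_mul_Ioi (by linarith) hx,
      ← ENNReal.ofReal_mul (by positivity), one_div, Real.inv_rpow hx.le, Real.rpow_neg hx.le]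
    congr 1
    field_simp
  rw [lintegral_congr h1, lintegral_const_mul' _ _ ENNReal.ofReal_ne_top,
    lintegral_lintegral_swap (by fun_prop)]
  have h2 : ∀ t ∈ Ioi (0 : ℝ), ∫⁻ x : ℝ, ENNReal.ofReal (t ^ (a - 1)
      * Real.exp (-((1 + x ^ 2) * t))) = ENNReal.ofReal √Real.pi
        * ENNReal.ofReal (t ^ (a - 1 / 2 - 1) * Real.exp (-(1 * t))) := by
    intro t ht
    have ht0 : (0 : ℝ) < t := ht
    have h3 : ∀ x : ℝ, ENNReal.ofReal (t ^ (a - 1) * Real.exp (-((1 + x ^ 2) * t)))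
        = ENNReal.ofReal (t ^ (a - 1) * Real.exp (-t))
          * ENNReal.ofReal (Real.exp (-t * x ^ 2)) := by
      intro x
      rw [← ENNReal.ofReal_mul (by positivity), mul_assoc, ← Real.exp_add]
      congr 3; ring
    rw [lintegral_congr h3, lintegral_const_mul' _ _ ENNReal.ofReal_ne_top,
      ← ofReal_integral_eq_lintegral_ofReal (integrable_exp_neg_mul_sq ht0)
        (Eventually.of_forall fun x => (Real.exp_pos _).le), integral_gaussian,
      ← ENNReal.ofReal_mul (by positivity), ← ENNReal.ofReal_mul (by positivity)]
    congr 1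
    rw [Real.sqrt_div Real.pi_pos.le, one_mul, show a - 1 / 2 - 1 = a - 1 - 1 / 2 by ring,
      Real.rpow_sub ht0 (a - 1) (1 / 2), ← Real.sqrt_eq_rpow]
    ring
  rw [setLIntegral_congr_fun measurableSet_Ioi h2,
    lintegral_const_mul' _ _ ENNReal.ofReal_ne_top,
    lintegral_rpow_mul_exp_neg_mul_Ioi (by linarith) one_pos,
    ← ENNReal.ofReal_mul (by positivity), ← ENNReal.ofReal_mul (by positivity)]
  congr 1
  simp
  ring

lemma integrable_one_add_sq_rpow {a : ℝ} (ha : 1 / 2 < a) :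
    Integrable fun x : ℝ => (1 + x ^ 2) ^ (-a) := by
  have h := integrable_rpow_neg_one_add_norm_sq (E := ℝ) (μ := volume) (r := 2 * a)
    (by simp; linarith)
  simpa [neg_div] using h

lemma integral_one_add_sq_rpow_le {a : ℝ} (ha : 3 / 4 < a) :
    ∫ x : ℝ, (1 + x ^ 2) ^ (-a) ≤ √(Real.pi / (a - 3 / 4)) := by
  have h1 : ENNReal.ofReal (∫ x : ℝ, (1 + x ^ 2) ^ (-a))
      = ENNReal.ofReal (√Real.pi * Real.Gamma (a - 1 / 2) / Real.Gamma a) := by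
    rw [← lintegral_one_add_sq_rpow (by linarith), ofReal_integral_eq_lintegral_ofReal
      (integrable_one_add_sq_rpow (by linarith))
      (Eventually.of_forall fun x => Real.rpow_nonneg (by positivity) _)]
  have hg := Real.Gamma_pos_of_pos (by linarith : 0 < a)
  have hg' := Real.Gamma_pos_of_pos (by linarith : 0 < a - 1 / 2)
  rw [ENNReal.ofReal_eq_ofReal_iff (integral_nonneg fun x => Real.rpow_nonneg (by positivity) _)
    (by positivity)] at h1
  rw [h1]
  refine Real.le_sqrt_of_sq_le ?_
  have h2 := Gamma_sq_mul_sub_quarter_le (b := a - 1 / 2) (by linarith)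
  rw [sub_add_cancel, show a - 1 / 2 - 1 / 4 = a - 3 / 4 by ring] at h2
  have h3 : 0 < a - 3 / 4 := by linarith
  rw [div_pow, mul_pow, Real.sq_sqrt Real.pi_pos.le, div_le_div_iff₀ (by positivity) h3]
  nlinarith [Real.pi_pos]

lemma integral_add_sq_rpow {a K : ℝ} (hK : 0 < K) :
    ∫ x : ℝ, (K + x ^ 2 / 2) ^ (-a)
      = K ^ (-(a - 1 / 2)) * (√2 * ∫ x : ℝ, (1 + x ^ 2) ^ (-a)) := by
  have hs : 0 < √(2 * K) := by positivity
  have h1 : ∀ x : ℝ, (K + x ^ 2 / 2) ^ (-a) = K ^ (-a) * (1 + ((√(2 * K))⁻¹ * x) ^ 2) ^ (-a) := by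
    intro x
    rw [← Real.mul_rpow hK.le (by positivity)]
    congr 1
    rw [mul_pow, inv_pow, Real.sq_sqrt (by positivity)]
    field_simp
  simp_rw [h1]
  rw [integral_const_mul, Measure.integral_comp_mul_left (fun x => (1 + x ^ 2) ^ (-a)), inv_inv,
    abs_of_pos hs, smul_eq_mul, Real.sqrt_mul zero_le_two,
    show -(a - 1 / 2) = -a + 1 / 2 by ring, Real.rpow_add hK, ← Real.sqrt_eq_rpow]
  ring

lemma integrable_add_sq_rpow {a K : ℝ} (ha : 1 / 2 < a) (hK : 0 < K) :
    Integrable fun x : ℝ => (K + x ^ 2 / 2) ^ (-a) := by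
  have hs : 0 < √(2 * K) := by positivity
  have h1 : (fun x : ℝ => (K + x ^ 2 / 2) ^ (-a))
      = fun x => K ^ (-a) * (1 + ((√(2 * K))⁻¹ * x) ^ 2) ^ (-a) := by
    ext x
    rw [← Real.mul_rpow hK.le (by positivity)]
    congr 1
    rw [mul_pow, inv_pow, Real.sq_sqrt (by positivity)]
    field_simp
  rw [h1]
  exact ((integrable_one_add_sq_rpow ha).comp_mul_left' (inv_pos.2 hs).ne').const_mul _

/-- The Brascamp-Lieb inequality for powers of one-dimensional quadratics. -/
lemma lintegral_prod_add_sq_rpow_le {N p : ℕ} {Y : Matrix (Fin N) (Fin p) ℝ} {c K : Fin N → ℝ}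
    (hc : ∀ i, 0 ≤ c i) (hY : Yᵀ * diagonal c * Y = 1)
    (hY1 : ∀ i, c i ≠ 0 → ∑ j, Y i j ^ 2 = 1) (hcp : ∑ i, c i = p) (hK : ∀ i, 0 < K i) {a : ℝ}
    (ha : 3 / 4 < a) :
    ∫⁻ z : Fin p → ℝ, ENNReal.ofReal (∏ i, (K i + (Y *ᵥ z) i ^ 2 / 2) ^ (-(a * c i)))
      ≤ ENNReal.ofReal (√(2 * Real.pi / (a - 3 / 4)) ^ p * ∏ i, K i ^ (-((a - 1 / 2) * c i))) := by
  have h := lintegral_prod_rpow_le hc hY hY1 (f := fun i x => (K i + x ^ 2 / 2) ^ (-a))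
    (fun i => Continuous.rpow_const (by fun_prop) fun x => Or.inl (by have := hK i; positivity))
    (fun i => integrable_add_sq_rpow (by linarith) (hK i))
    fun i x => Real.rpow_pos_of_pos (by have := hK i; positivity) _
  have e1 : ∀ z : Fin p → ℝ, ∏ i, (K i + (Y *ᵥ z) i ^ 2 / 2) ^ (-(a * c i))
      = ∏ i, ((K i + (Y *ᵥ z) i ^ 2 / 2) ^ (-a)) ^ c i := fun z =>
    Finset.prod_congr rfl fun i _ => by
      rw [← Real.rpow_mul (by have := hK i; positivity), neg_mul]
  simp_rw [e1]
  refine h.trans (ENNReal.ofReal_le_ofReal ?_)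
  simp_rw [fun i => integral_add_sq_rpow (a := a) (hK i)]
  have hJ : 0 ≤ ∫ x : ℝ, (1 + x ^ 2) ^ (-a) :=
    integral_nonneg fun x => Real.rpow_nonneg (by positivity) _
  have e2 : ∏ i, (K i ^ (-(a - 1 / 2)) * (√2 * ∫ x : ℝ, (1 + x ^ 2) ^ (-a))) ^ c i
      = (∏ i, K i ^ (-((a - 1 / 2) * c i))) * (√2 * ∫ x : ℝ, (1 + x ^ 2) ^ (-a)) ^ p := by
    rw [← Real.rpow_natCast, ← hcp, Real.rpow_sum_of_nonneg (by positivity) (fun i _ => hc i),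
      ← Finset.prod_mul_distrib]
    refine Finset.prod_congr rfl fun i _ => ?_
    rw [Real.mul_rpow (Real.rpow_nonneg (hK i).le _) (by positivity), ← Real.rpow_mul (hK i).le,
      neg_mul]
  rw [e2, mul_comm]
  refine mul_le_mul_of_nonneg_right (pow_le_pow_left₀ (by positivity) ?_ _)
    (Finset.prod_nonneg fun i _ => Real.rpow_nonneg (hK i).le _)
  rw [mul_div_assoc, Real.sqrt_mul zero_le_two]
  exact mul_le_mul_of_nonneg_left (integral_one_add_sq_rpow_le ha) (Real.sqrt_nonneg _)

/-! ### Negative moments of random determinants -/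

/-- Hermite-Hadamard for the logarithm on `[a - 1/2, a]`. -/
lemma mul_log_sub_mul_log_le {a : ℝ} (ha : 1 / 2 < a) :
    a * Real.log a - (a - 1 / 2) * Real.log (a - 1 / 2) - 1 / 2 ≤ Real.log (a - 1 / 4) / 2 := by
  have h0 : 0 < a - 1 / 4 := by linarith
  have h1 : ∫ u in (a - 1 / 2)..a, Real.log u
      ≤ ∫ u in (a - 1 / 2)..a, (Real.log (a - 1 / 4) + (u - (a - 1 / 4)) / (a - 1 / 4)) := by
    refine intervalIntegral.integral_mono_on (by linarith) intervalIntegral.intervalIntegrable_log'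
      (by apply Continuous.intervalIntegrable; fun_prop) fun u hu => ?_
    have hu0 : 0 < u := by linarith [hu.1]
    have h2 := Real.log_le_sub_one_of_pos (div_pos hu0 h0)
    rw [Real.log_div hu0.ne' h0.ne'] at h2
    rw [sub_div, div_self h0.ne']
    linarith
  rw [integral_log, intervalIntegral.integral_add (by simp)
    (by apply Continuous.intervalIntegrable; fun_prop), intervalIntegral.integral_const,
    intervalIntegral.integral_div, intervalIntegral.integral_sub (by simp) (by simp),
    integral_id, intervalIntegral.integral_const] at h1
  have h3 : ((a ^ 2 - (a - 1 / 2) ^ 2) / 2 - (a - (a - 1 / 2)) • (a - 1 / 4)) / (a - 1 / 4)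
      = 0 := by
    rw [div_eq_zero_iff]; left; rw [smul_eq_mul]; ring
  rw [h3, smul_eq_mul] at h1
  linarith

section Det

variable {p : ℕ} {G : Matrix (Fin p) (Fin p) ℝ}

/-- The Gaussian integral `(2π)^(-p/2) ∫ exp (-zᵀ G z / 2) dz`, which is `det G ^ (-1/2)` for
positive definite `G` and infinite for singular positive semidefinite `G`. -/
noncomputable def gaussianIntegral (G : Matrix (Fin p) (Fin p) ℝ) : ℝ≥0∞ :=
  ∫⁻ z : Fin p → ℝ, ENNReal.ofReal ((√(2 * Real.pi))⁻¹ ^ p * Real.exp (-(z ⬝ᵥ G *ᵥ z) / 2))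

lemma lintegral_comp_orthogonal {O : Matrix (Fin p) (Fin p) ℝ} (hO : O * Oᵀ = 1)
    {f : (Fin p → ℝ) → ℝ≥0∞} (hf : Measurable f) : ∫⁻ z, f (O *ᵥ z) = ∫⁻ z, f z := by
  have hdet : |O.det| = 1 := by
    have h := congrArg Matrix.det hO
    rw [det_mul, det_transpose, det_one, ← sq] at h
    rwa [← sq_eq_sq₀ (abs_nonneg _) zero_le_one, sq_abs, one_pow]
  have hmap : Measure.map (toLin' O) (volume : Measure (Fin p → ℝ)) = volume := by
    have h0 : O.det ≠ 0 := by intro h; simp [h] at hdet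
    rw [Real.map_matrix_volume_pi_eq_smul_volume_pi h0, abs_inv, hdet]
    simp
  conv_rhs => rw [← hmap]
  exact (lintegral_map hf (measurable_mulVec O)).symm

lemma gaussianIntegral_eq_prod (hG : G.IsHermitian) :
    gaussianIntegral G = ∏ j, ∫⁻ x : ℝ,
      ENNReal.ofReal ((√(2 * Real.pi))⁻¹ * Real.exp (-(hG.eigenvalues j / 2) * x ^ 2)) := by
  obtain ⟨O, hO, hO', hspec⟩ := exists_orthogonal_diagonal hG
  set l := hG.eigenvalues with hl
  have hquad : ∀ z, (O *ᵥ z) ⬝ᵥ (G *ᵥ (O *ᵥ z)) = ∑ j, l j * z j ^ 2 := by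
    intro z
    have h1 : G *ᵥ (O *ᵥ z) = O *ᵥ (diagonal l *ᵥ z) := by
      rw [hspec]
      simp only [mulVec_mulVec, Matrix.mul_assoc, hO', Matrix.mul_one]
    rw [h1, dotProduct_mulVec, vecMul_mulVec, ← dotProduct_mulVec, mulVec_mulVec,
      hO', Matrix.one_mul]
    simp only [dotProduct, mulVec_diagonal]
    exact Finset.sum_congr rfl fun j _ => by ring
  have hm : Measurable fun z : Fin p → ℝ =>
      ENNReal.ofReal ((√(2 * Real.pi))⁻¹ ^ p * Real.exp (-(z ⬝ᵥ G *ᵥ z) / 2)) := by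
    have : ∀ j, Measurable fun z : Fin p → ℝ => (G *ᵥ z) j := measurable_mulVec_apply G
    simp only [dotProduct]
    fun_prop
  rw [gaussianIntegral, ← lintegral_comp_orthogonal hO hm, volume_pi,
    ← lintegral_pi_prod (fun _ => volume) (f := fun j x => ENNReal.ofReal ((√(2 * Real.pi))⁻¹
      * Real.exp (-(l j / 2) * x ^ 2))) fun j => by fun_prop]
  refine lintegral_congr fun z => ?_
  rw [← ENNReal.ofReal_prod_of_nonneg fun j _ => by positivity, Finset.prod_mul_distrib,
    ← Real.exp_sum, hquad, neg_div, Finset.sum_div, ← Finset.sum_neg_distrib]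
  congr 2
  · simp
  · congr 1
    exact Finset.sum_congr rfl fun j _ => by ring

lemma lintegral_exp_neg_sq {l : ℝ} (hl : 0 < l) :
    ∫⁻ x : ℝ, ENNReal.ofReal ((√(2 * Real.pi))⁻¹ * Real.exp (-(l / 2) * x ^ 2))
      = ENNReal.ofReal (√l)⁻¹ := by
  rw [← ofReal_integral_eq_lintegral_ofReal ((integrable_exp_neg_mul_sq (half_pos hl)).const_mul _)
    (Eventually.of_forall fun x => by positivity), integral_const_mul, integral_gaussian]
  congr 1
  rw [show Real.pi / (l / 2) = 2 * Real.pi * l⁻¹ by field_simp,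
    Real.sqrt_mul (by positivity : 0 ≤ 2 * Real.pi) l⁻¹, Real.sqrt_inv,
    inv_mul_cancel_left₀ (by positivity)]

lemma gaussianIntegral_of_posDef (hG : G.PosDef) :
    gaussianIntegral G = ENNReal.ofReal (√G.det)⁻¹ := by
  rw [gaussianIntegral_eq_prod hG.isHermitian,
    Finset.prod_congr rfl fun j _ => lintegral_exp_neg_sq (hG.eigenvalues_pos j),
    ← ENNReal.ofReal_prod_of_nonneg fun j _ => by positivity]
  have h : G.det = ∏ j, hG.isHermitian.eigenvalues j := by
    simpa using hG.isHermitian.det_eq_prod_eigenvalues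
  rw [h, Finset.prod_inv_distrib, Real.sqrt_eq_rpow,
    ← Real.finsetProd_rpow _ _ fun j _ => (hG.eigenvalues_pos j).le]
  simp_rw [Real.sqrt_eq_rpow]

lemma gaussianIntegral_of_not_posDef (hG : G.PosSemidef) (hG' : ¬ G.PosDef) :
    gaussianIntegral G = ⊤ := by
  rw [gaussianIntegral_eq_prod hG.isHermitian]
  have hz : ∫⁻ _ : ℝ, ENNReal.ofReal (√(2 * Real.pi))⁻¹ = ⊤ := by
    rw [lintegral_const, Real.volume_univ, ENNReal.mul_top]
    simp [Real.pi_pos]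
  rw [hG.isHermitian.posDef_iff_eigenvalues_pos] at hG'
  push Not at hG'
  obtain ⟨j, hj⟩ := hG'
  have hj0 : hG.isHermitian.eigenvalues j = 0 := le_antisymm hj (hG.eigenvalues_nonneg j)
  rw [← Finset.mul_prod_erase _ _ (Finset.mem_univ j), hj0]
  simp only [zero_div, neg_zero, zero_mul, Real.exp_zero, mul_one]
  rw [hz, ENNReal.top_mul]
  refine Finset.prod_ne_zero_iff.2 fun i _ => ?_
  rcases (hG.eigenvalues_nonneg i).eq_or_lt with h | h
  · rw [← h]; simp only [zero_div, neg_zero, zero_mul, Real.exp_zero, mul_one]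
    rw [hz]; exact ENNReal.top_ne_zero
  · rw [lintegral_exp_neg_sq h]
    simpa using h

end Det

/-- The exponent, per dimension, in the bound for the `m`-th moment of `det ^ (-1/2)`, where `1 / k`
bounds four times the bias-inflated weights of the random matrix. It is chosen so that the losses
in successive Brascamp-Lieb steps telescope. -/
noncomputable def momentExponent (k : ℝ) (m : ℕ) : ℝ :=
  m / 2 + (k - m / 2) * Real.log (k - m / 2)
    + (Real.log (k - 1 / 4) - Real.log (k - m / 2 - 1 / 4)) / 2

/-- One Brascamp-Lieb step multiplies the moment bound by at most the ratio of its values at `m + 1`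
and at `m`, by the Hermite-Hadamard inequality. -/
lemma exp_momentExponent_mul_le {k : ℝ} {m p : ℕ} (hm : 3 / 4 < k - m / 2) :
    Real.exp (p * momentExponent k m) * √(1 / (k - m / 2 - 3 / 4)) ^ p
      ≤ Real.exp (p * momentExponent k (m + 1)) := by
  have h0 : 0 < k - m / 2 - 3 / 4 := by linarith
  have h1 : √(1 / (k - m / 2 - 3 / 4)) = Real.exp (-Real.log (k - m / 2 - 3 / 4) / 2) := by
    rw [Real.sqrt_eq_rpow, Real.rpow_def_of_pos (by positivity), one_div, Real.log_inv]
    congr 1; ring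
  rw [h1, ← Real.exp_nat_mul, ← Real.exp_add, ← mul_add]
  refine Real.exp_le_exp.2 (mul_le_mul_of_nonneg_left ?_ p.cast_nonneg)
  have h2 := mul_log_sub_mul_log_le (a := k - m / 2) (by linarith)
  unfold momentExponent
  push_cast
  rw [show k - (m + 1) / 2 = k - m / 2 - 1 / 2 by ring,
    show k - m / 2 - 1 / 2 - 1 / 4 = k - (m : ℝ) / 2 - 3 / 4 by ring]
  linarith

section Moment

variable {n p : ℕ} {R : Matrix (Fin n) (Fin n) ℝ} {b v a : Fin n → ℝ}
  {Y : Matrix (Fin n) (Fin p) ℝ} {k : ℝ}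

lemma measurable_gaussianIntegral_comp {D : (Fin n → ℝ) → Fin n → ℝ} (hD : Measurable D) :
    Measurable fun g => gaussianIntegral (Yᵀ * diagonal (D g) * Y) := by
  unfold gaussianIntegral
  simp_rw [dotProduct_transpose_mul_diagonal]
  have h1 : ∀ i, Measurable fun g => D g i := fun i => (measurable_pi_apply i).comp hD
  have h2 : ∀ i, Measurable fun z : Fin p → ℝ => (Y *ᵥ z) i := measurable_mulVec_apply Y
  refine Measurable.lintegral_prod_right' (f := fun gz : (Fin n → ℝ) × (Fin p → ℝ) =>
    ENNReal.ofReal ((√(2 * Real.pi))⁻¹ ^ p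
      * Real.exp (-(∑ i, D gz.1 i * (Y *ᵥ gz.2) i ^ 2) / 2))) ?_
  have h3 : ∀ i, Measurable fun gz : (Fin n → ℝ) × (Fin p → ℝ) => D gz.1 i := fun i =>
    (h1 i).comp measurable_fst
  have h4 : ∀ i, Measurable fun gz : (Fin n → ℝ) × (Fin p → ℝ) => (Y *ᵥ gz.2) i := fun i =>
    (h2 i).comp measurable_snd
  fun_prop

/-- Bernoulli's inequality in the form `(1 + β κ) ^ (-r) ≤ (1 + κ / k) ^ (-k β r)` for
`β ≤ 1 / k`. -/
lemma one_add_mul_rpow_neg_le {β κ r : ℝ} (hk : 0 < k) (hβ : 0 ≤ β) (hβk : β * k ≤ 1)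
    (hr : 0 ≤ r) (hκ : -k < κ) :
    (1 + β * κ) ^ (-r) ≤ (1 + κ / k) ^ (-(k * β * r)) := by
  have h0 : 0 < 1 + κ / k := by
    rw [← div_self hk.ne', ← add_div]; exact div_pos (by linarith) hk
  have h1 : (1 + κ / k) ^ (β * k) ≤ 1 + (β * k) * (κ / k) :=
    rpow_one_add_le_one_add_mul_self (by linarith) (by positivity) hβk
  have h2 : 1 + (β * k) * (κ / k) = 1 + β * κ := by field_simp
  rw [h2] at h1
  have h3 : 0 < (1 + κ / k) ^ (β * k) := Real.rpow_pos_of_pos h0 _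
  calc (1 + β * κ) ^ (-r) ≤ ((1 + κ / k) ^ (β * k)) ^ (-r) :=
        Real.rpow_le_rpow_of_nonpos h3 h1 (by linarith)
    _ = _ := by rw [← Real.rpow_mul h0.le]; congr 1; ring

/-- Joint moments of `det ^ (-1/2)` and exponentials. The induction step writes one factor
`det ^ (-1/2)` as a Gaussian integral in `z`, which shifts the parameters `κ i` by
`⟨y i, z⟩ ^ 2 / 2`, and integrates the resulting powers by the Brascamp-Lieb inequality. -/
lemma lintegral_gaussianIntegral_pow_mul_le
    (hR : ∀ z, ∑ i, (R *ᵥ z) i ^ 2 ≤ 2 * ∑ j, z j ^ 2)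
    (hv : ∀ i, ∑ j, R i j ^ 2 = v i) (hvpos : ∀ i, 0 < v i) (ha : ∀ i, 0 ≤ a i)
    (hk : 0 < k) (hak : ∀ i, 4 * ((1 + b i ^ 2 / v i) * a i) * k ≤ 1)
    (hY : Yᵀ * diagonal (fun i => (v i + b i ^ 2) * a i) * Y = 1)
    (hY1 : ∀ i, (v i + b i ^ 2) * a i ≠ 0 → ∑ j, Y i j ^ 2 = 1)
    (hcp : ∑ i, (v i + b i ^ 2) * a i = p) (m : ℕ) (hm : (m : ℝ) = 0 ∨ 1 / 4 < k - m / 2)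
    {κ : Fin n → ℝ} (hκ : ∀ i, -k < κ i) :
    ∫⁻ g, gaussianIntegral (Yᵀ * diagonal (fun i => a i * ((R *ᵥ g) i + b i) ^ 2) * Y) ^ m
        * ENNReal.ofReal (Real.exp (-∑ i, κ i * (a i * ((R *ᵥ g) i + b i) ^ 2))) ∂(stdNormal n)
      ≤ ENNReal.ofReal (Real.exp (p * momentExponent k m)
        * ∏ i, (k + κ i) ^ (-((k - m / 2) * ((v i + b i ^ 2) * a i)))) := by
  set c : Fin n → ℝ := fun i => (v i + b i ^ 2) * a i with hc
  have hc0 : ∀ i, 0 ≤ c i := fun i =>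
    mul_nonneg (add_nonneg (hvpos i).le (sq_nonneg _)) (ha i)
  have hηm : ∀ i, Measurable fun g : Fin n → ℝ => (R *ᵥ g) i := measurable_mulVec_apply R
  induction m generalizing κ with
  | zero =>
    simp only [pow_zero, one_mul, Nat.cast_zero, zero_div, sub_zero, momentExponent, sub_self,
      zero_add, add_zero]
    have hpos : ∀ i, 0 < 1 + κ i / k := fun i => by
      rw [← div_self hk.ne', ← add_div]; exact div_pos (by linarith [hκ i]) hk
    have hβ0 : ∀ i, 0 ≤ 4 * ((1 + b i ^ 2 / v i) * a i) := fun i => by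
      have := hvpos i
      have := ha i
      positivity
    have hD : ∀ i, 4 * ((1 + b i ^ 2 / v i) * -(κ i * a i)) < 1 := by
      intro i
      have h1 := mul_le_mul_of_nonneg_left (hκ i).le (hβ0 i)
      by_cases h0 : 4 * ((1 + b i ^ 2 / v i) * a i) = 0
      · have : 4 * ((1 + b i ^ 2 / v i) * -(κ i * a i))
          = -κ i * (4 * ((1 + b i ^ 2 / v i) * a i)) := by ring
        rw [this, h0]; simp
      · have h2 := mul_lt_mul_of_pos_left (hκ i) (lt_of_le_of_ne (hβ0 i) (Ne.symm h0))
        have h3 := hak i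
        nlinarith
    have h := lintegral_exp_quadratic_le_of_inflate hR b (D := fun i => -(κ i * a i)) hv hvpos hD
    have e : ∀ g : Fin n → ℝ, -∑ i, κ i * (a i * ((R *ᵥ g) i + b i) ^ 2)
        = ∑ i, -(κ i * a i) * ((R *ᵥ g) i + b i) ^ 2 := fun g => by
      rw [← Finset.sum_neg_distrib]
      exact Finset.sum_congr rfl fun i _ => by ring
    simp_rw [e]
    refine h.trans (ENNReal.ofReal_le_ofReal ?_)
    have hkp : Real.exp (p * (k * Real.log k)) = ∏ i, k ^ (k * c i) := by
      rw [← Real.rpow_sum_of_pos hk, ← Finset.mul_sum, hcp, Real.rpow_def_of_pos hk]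
      congr 1; ring
    rw [hkp, ← Finset.prod_mul_distrib]
    refine Finset.prod_le_prod (fun i _ => Real.rpow_nonneg (by linarith [hD i]) _) fun i _ => ?_
    have h1 := one_add_mul_rpow_neg_le (β := 4 * ((1 + b i ^ 2 / v i) * a i)) (κ := κ i)
      (r := v i / 4) hk (hβ0 i) (hak i) (by linarith [hvpos i]) (hκ i)
    have e1 : 1 - 4 * ((1 + b i ^ 2 / v i) * -(κ i * a i))
        = 1 + 4 * ((1 + b i ^ 2 / v i) * a i) * κ i := by ring
    have e2 : k * (4 * ((1 + b i ^ 2 / v i) * a i)) * (v i / 4) = k * c i := by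
      have := (hvpos i).ne'
      simp only [hc]
      field_simp
    rw [e1, neg_div]
    refine h1.trans (le_of_eq ?_)
    rw [e2]
    have e3 : 1 + κ i / k = (k + κ i) / k := by field_simp
    rw [e3, Real.div_rpow (by linarith [hκ i]) hk.le, Real.rpow_neg hk.le, div_inv_eq_mul, mul_comm]
  | succ m ih =>
    have hm' : 1 / 4 < k - (m + 1 : ℕ) / 2 := by
      rcases hm with h | h
      · exact absurd h (by positivity)
      · exact h
    push_cast at hm'
    have hJ : Measurable fun g : Fin n → ℝ =>
        gaussianIntegral (Yᵀ * diagonal (fun i => a i * ((R *ᵥ g) i + b i) ^ 2) * Y) :=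
      measurable_gaussianIntegral_comp (D := fun g i => a i * ((R *ᵥ g) i + b i) ^ 2)
        (by fun_prop)
    set J : (Fin n → ℝ) → ℝ≥0∞ := fun g =>
      gaussianIntegral (Yᵀ * diagonal (fun i => a i * ((R *ᵥ g) i + b i) ^ 2) * Y) with hJdef
    set Q : ℝ := (√(2 * Real.pi))⁻¹ ^ p with hQ
    have hQ0 : 0 < Q := by positivity
    have hYm : ∀ i, Measurable fun z : Fin p → ℝ => (Y *ᵥ z) i := measurable_mulVec_apply Y
    have hexp : ∀ g, J g ^ (m + 1)
        * ENNReal.ofReal (Real.exp (-∑ i, κ i * (a i * ((R *ᵥ g) i + b i) ^ 2)))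
        = ∫⁻ z : Fin p → ℝ, ENNReal.ofReal Q * (J g ^ m * ENNReal.ofReal (Real.exp
          (-∑ i, (κ i + (Y *ᵥ z) i ^ 2 / 2) * (a i * ((R *ᵥ g) i + b i) ^ 2)))) := by
      intro g
      have h1 : J g = ∫⁻ z : Fin p → ℝ, ENNReal.ofReal (Q * Real.exp
          (-(∑ i, a i * ((R *ᵥ g) i + b i) ^ 2 * (Y *ᵥ z) i ^ 2) / 2)) := by
        simp only [hJdef, gaussianIntegral]
        refine lintegral_congr fun z => ?_
        rw [dotProduct_transpose_mul_diagonal]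
      have hmz : Measurable fun z : Fin p → ℝ => ENNReal.ofReal (Q * Real.exp
          (-(∑ i, a i * ((R *ᵥ g) i + b i) ^ 2 * (Y *ᵥ z) i ^ 2) / 2)) := by fun_prop
      rw [pow_succ, mul_right_comm]
      nth_rewrite 2 [h1]
      rw [← lintegral_const_mul _ hmz]
      refine lintegral_congr fun z => ?_
      have e : -∑ i, (κ i + (Y *ᵥ z) i ^ 2 / 2) * (a i * ((R *ᵥ g) i + b i) ^ 2)
          = -∑ i, κ i * (a i * ((R *ᵥ g) i + b i) ^ 2)
            + -(∑ i, a i * ((R *ᵥ g) i + b i) ^ 2 * (Y *ᵥ z) i ^ 2) / 2 := by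
        rw [neg_div, ← neg_add, Finset.sum_div, ← Finset.sum_add_distrib]
        congr 1
        exact Finset.sum_congr rfl fun i _ => by ring
      rw [e, Real.exp_add, ENNReal.ofReal_mul hQ0.le, ENNReal.ofReal_mul (Real.exp_pos _).le]
      ring
    rw [lintegral_congr hexp, lintegral_lintegral_swap]
    · have hstep : ∀ z : Fin p → ℝ, ∫⁻ g, ENNReal.ofReal Q * (J g ^ m * ENNReal.ofReal (Real.exp
          (-∑ i, (κ i + (Y *ᵥ z) i ^ 2 / 2) * (a i * ((R *ᵥ g) i + b i) ^ 2)))) ∂(stdNormal n)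
          ≤ ENNReal.ofReal (Q * Real.exp (p * momentExponent k m)) * ENNReal.ofReal
            (∏ i, (k + κ i + (Y *ᵥ z) i ^ 2 / 2) ^ (-((k - m / 2) * c i))) := by
        intro z
        rw [lintegral_const_mul' _ _ ENNReal.ofReal_ne_top, ENNReal.ofReal_mul hQ0.le, mul_assoc]
        gcongr
        have := ih (Or.inr (by linarith)) (κ := fun i => κ i + (Y *ᵥ z) i ^ 2 / 2)
          fun i => by have := hκ i; have := sq_nonneg ((Y *ᵥ z) i); linarith
        rw [← ENNReal.ofReal_mul (Real.exp_pos _).le]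
        simpa only [add_assoc] using this
      refine (lintegral_mono hstep).trans ?_
      rw [lintegral_const_mul' _ _ ENNReal.ofReal_ne_top]
      have hα : 3 / 4 < k - (m : ℝ) / 2 := by linarith
      refine (mul_le_mul_right (lintegral_prod_add_sq_rpow_le hc0 hY hY1 hcp
        (K := fun i => k + κ i) (fun i => by linarith [hκ i]) hα) _).trans ?_
      rw [← ENNReal.ofReal_mul (by positivity)]
      refine ENNReal.ofReal_le_ofReal ?_
      rw [← mul_assoc]
      have e1 : k - (m : ℝ) / 2 - 1 / 2 = k - (m + 1 : ℕ) / 2 := by push_cast; ring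
      rw [e1]
      refine mul_le_mul_of_nonneg_right ?_ (Finset.prod_nonneg fun i _ =>
        Real.rpow_nonneg (by linarith [hκ i]) _)
      refine le_trans (le_of_eq ?_) (exp_momentExponent_mul_le (p := p) hα)
      rw [hQ, mul_comm (_ ^ p) (Real.exp _), mul_assoc, ← mul_pow]
      congr 2
      rw [← Real.sqrt_inv, ← Real.sqrt_mul (by positivity)]
      congr 1
      have := Real.pi_pos.ne'
      field_simp
    · have h3 : Measurable fun gz : (Fin n → ℝ) × (Fin p → ℝ) => J gz.1 := hJ.comp measurable_fst
      have h4 : ∀ i, Measurable fun gz : (Fin n → ℝ) × (Fin p → ℝ) => (Y *ᵥ gz.2) i := fun i =>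
        (hYm i).comp measurable_snd
      have h5 : ∀ i, Measurable fun gz : (Fin n → ℝ) × (Fin p → ℝ) => (R *ᵥ gz.1) i := fun i =>
        (hηm i).comp measurable_fst
      refine Measurable.aemeasurable ?_
      unfold Function.uncurry
      fun_prop

end Moment

/-! ### Numerical estimates in dimension at least two -/

/-- The gain of Pinsker's inequality over `(e + t) / 2` for the distance, per square root of the
dimension, between `N(0, 1)` and a normal law whose covariance has its eigenvalues in
`[1 - e, 1 + e + t]`. It equals `(e + t) / 2 - max (0.7072 * (e + t)) (0.88 * e) / 2`. -/
noncomputable def slack (e t : ℝ) : ℝ := min (0.1464 * (e + t)) (0.06 * e + 0.5 * t)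

lemma slack_nonneg {e t : ℝ} (he : 0 ≤ e) (ht : 0 ≤ t) : 0 ≤ slack e t :=
  le_min (by positivity) (by positivity)

section Numeric

variable {e t ρ : ℝ}

/-- The hypothesis holds as soon as the target `√p * (ρ + (e + t) / 2)` is below one and `2 ≤ p`.
The factor `(1 - e + t) / (1 - e) ^ 2` is the loss from whitening and from the bias. -/
lemma sub_sq_le_aux (he0 : 0 ≤ e) (he : e ≤ 1 / 2) (ht : 0 ≤ t) (hρ : 0 ≤ ρ)
    (h : 2 * (ρ + (e + t) / 2) ^ 2 ≤ 1) : (1 - e + t) * ρ ^ 2 ≤ (1 - e) ^ 2 / 2 := by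
  obtain ⟨u, rfl⟩ : ∃ u, t = u - e := ⟨e + t, by ring⟩
  rw [add_sub_cancel] at h
  have hu : 0 ≤ u := by linarith
  set P := 1 - 0.707 * u with hP
  -- `√2 ≥ 1.414` gives `√2 ρ ≤ P`
  have h1 : 1.414 * (ρ + u / 2) ≤ 1 := by
    by_contra! hlt
    nlinarith
  have hP0 : 0 ≤ P := by rw [hP]; linarith
  have h2 : 2 * ρ ^ 2 ≤ P ^ 2 := by
    have h3 : √2 * (ρ + u / 2) ≤ 1 := by
      rw [← abs_of_nonneg (by positivity : 0 ≤ √2 * (ρ + u / 2)), ← sq_le_one_iff_abs_le_one,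
        mul_pow, Real.sq_sqrt zero_le_two]
      exact h
    have h4 : (1.414 : ℝ) ≤ √2 := Real.le_sqrt_of_sq_le (by norm_num)
    have h5 : √2 * ρ ≤ P := by rw [hP]; nlinarith
    calc 2 * ρ ^ 2 = (√2 * ρ) ^ 2 := by rw [mul_pow, Real.sq_sqrt zero_le_two]
      _ ≤ P ^ 2 := by gcongr
  have h3 : (1 - e + (u - e)) * P ^ 2 ≤ (1 - e) ^ 2 := by
    rcases le_total u 0.828 with h' | h'
    · have h4 : (1 - e) ^ 2 - (1 - e + (u - e)) * P ^ 2
          = (1 - e - P ^ 2) ^ 2 + P ^ 2 * (u * (0.414 - 0.499849 * u)) := by rw [hP]; ring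
      have h5 : 0 ≤ u * (0.414 - 0.499849 * u) := mul_nonneg hu (by linarith)
      nlinarith [sq_nonneg (1 - e - P ^ 2), mul_nonneg (sq_nonneg P) h5]
    · have h4 : P ≤ 0.415 := by rw [hP]; linarith
      have h5 : P ^ 2 ≤ 0.172225 := by nlinarith
      have h6 : u * P ^ 2 ≤ 0.2436 := by
        have : u ≤ 1.41443 := by rw [hP] at hP0; linarith
        nlinarith [sq_nonneg P]
      nlinarith [mul_nonneg (by linarith : 0 ≤ 1 / 2 - e) (by linarith : 0 ≤ 1.5 - e - 2 * P ^ 2)]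
  nlinarith [mul_le_mul_of_nonneg_left h2 (by linarith : 0 ≤ 1 - e + (u - e))]

/-- The inequality between the exponents in the deviation bound. The constants `1.8` and `1.02`
correspond to the choice of the moment in `exists_moment` and to a margin for rounding it. -/
lemma mul_sq_le_slack_aux (he0 : 0 ≤ e) (he : e ≤ 1 / 2) (ht : 0 ≤ t) (hρ : 0 ≤ ρ)
    (h : 2 * (ρ + (e + t) / 2) ^ 2 ≤ 1) :
    1.02 * ((1 - e + t) * ρ ^ 2) ≤ 1.8 * ((ρ + slack e t) ^ 2 * (1 - e) ^ 2) := by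
  have h1 : ρ ≤ 0.70711 - (e + t) / 2 := by
    by_contra! hlt
    nlinarith
  have hκ0 := slack_nonneg he0 ht
  set y := 1 - e + t with hy
  have hy0 : 0 ≤ y := by rw [hy]; linarith
  set A := (ρ + slack e t) * (1 - e) with hA
  have hA0 : 0 ≤ A := mul_nonneg (by linarith) (by linarith)
  rw [← mul_pow, ← hA]
  -- `√y` is bounded by its tangent at `1 / 2` or at `3 / 4`
  rcases min_choice (0.1464 * (e + t)) (0.06 * e + 0.5 * t) with hc | hc
  · have hs : slack e t = 0.1464 * (e + t) := hc
    have h2 : ρ * (-0.239275 + 0.5653 * e + 0.4347 * t) ≤ 0.1464 * (e + t) * (1 - e) := by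
      rcases le_total (-0.239275 + 0.5653 * e + 0.4347 * t) 0 with h3 | h3
      · nlinarith [mul_nonneg (by linarith : 0 ≤ e + t) (by linarith : 0 ≤ 1 - e),
          mul_nonneg hρ (neg_nonneg.2 h3)]
      · refine (mul_le_mul_of_nonneg_right h1 h3).trans ?_
        nlinarith [mul_nonneg he0 ht, mul_nonneg (by linarith : 0 ≤ 1 / 2 - e) ht,
          mul_nonneg he0 (by linarith : 0 ≤ 1 / 2 - e), sq_nonneg (t - 0.25), sq_nonneg (e - 1 / 2),
          sq_nonneg (e + t - 0.75)]
    have h4 : 0.4347 * (y + 3 / 4) * ρ ≤ A := by rw [hA, hs, hy]; nlinarith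
    have h5 : (0.4347 * (y + 3 / 4) * ρ) ^ 2 ≤ A ^ 2 := by gcongr
    nlinarith [mul_nonneg (sq_nonneg (y - 3 / 4)) (sq_nonneg ρ), mul_nonneg hy0 (sq_nonneg ρ)]
  · have hs : slack e t = 0.06 * e + 0.5 * t := hc
    have h2 : ρ * (-0.20155 + 0.4677 * e + 0.5323 * t) ≤ (0.06 * e + 0.5 * t) * (1 - e) := by
      rcases le_total (-0.20155 + 0.4677 * e + 0.5323 * t) 0 with h3 | h3
      · nlinarith [mul_nonneg (by linarith : 0 ≤ 0.06 * e + 0.5 * t) (by linarith : 0 ≤ 1 - e),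
          mul_nonneg hρ (neg_nonneg.2 h3)]
      · refine (mul_le_mul_of_nonneg_right h1 h3).trans ?_
        nlinarith [mul_nonneg he0 ht, mul_nonneg (by linarith : 0 ≤ 1 / 2 - e) ht,
          mul_nonneg he0 (by linarith : 0 ≤ 1 / 2 - e), sq_nonneg t, sq_nonneg (e - 1 / 2)]
    have h4 : 0.5323 * (y + 1 / 2) * ρ ≤ A := by rw [hA, hs, hy]; nlinarith
    have h5 : (0.5323 * (y + 1 / 2) * ρ) ^ 2 ≤ A ^ 2 := by gcongr
    nlinarith [mul_nonneg (sq_nonneg (y - 1 / 2)) (sq_nonneg ρ), mul_nonneg hy0 (sq_nonneg ρ)]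

/-- This is `2 ^ 19 ≤ 3 ^ 12`. -/
lemma nineteen_log_two_le : 19 * Real.log 2 ≤ 12 * Real.log 3 := by
  have h : Real.log ((2 : ℝ) ^ 19) ≤ Real.log ((3 : ℝ) ^ 12) :=
    Real.log_le_log (by positivity) (by norm_num)
  rw [Real.log_pow, Real.log_pow] at h
  exact_mod_cast h

lemma log_ten_le : Real.log 10 ≤ 2.3027 := by
  have h : Real.log ((10 : ℝ) ^ 59) ≤ Real.log ((2 : ℝ) ^ 196) :=
    Real.log_le_log (by positivity) (by norm_num)
  rw [Real.log_pow, Real.log_pow] at h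
  push_cast at h
  linarith [Real.log_two_lt_d9]

lemma le_log_mul_three_of_le {n : ℕ} (h1 : 1 ≤ n) (h2 : n ≤ 15) :
    (n : ℝ) / 4 ≤ Real.log (3 * n) := by
  have hn : (1 : ℝ) ≤ n := by exact_mod_cast h1
  have hn' : (n : ℝ) ≤ 15 := by exact_mod_cast h2
  rw [Real.le_log_iff_exp_le (by positivity)]
  -- convexity of `exp` between `1 / 4` and `15 / 4`
  have hc := convexOn_exp.2 (mem_univ (1 / 4 : ℝ)) (mem_univ (15 / 4 : ℝ))
    (by linarith : 0 ≤ (15 - (n : ℝ)) / 14) (by linarith : 0 ≤ ((n : ℝ) - 1) / 14) (by ring)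
  simp only [smul_eq_mul] at hc
  rw [show (15 - (n : ℝ)) / 14 * (1 / 4) + (n - 1) / 14 * (15 / 4) = n / 4 by ring] at hc
  have he := Real.exp_one_lt_d9
  have h15 : Real.exp (15 / 4) ≤ 45 := by
    rw [← pow_le_pow_iff_left₀ (Real.exp_pos _).le (by norm_num) (by norm_num : (4 : ℕ) ≠ 0),
      ← Real.exp_nat_mul]
    have : ((4 : ℕ) : ℝ) * (15 / 4) = (15 : ℕ) * 1 := by norm_num
    rw [this, Real.exp_nat_mul]
    calc Real.exp 1 ^ 15 ≤ 2.72 ^ 15 := by gcongr; linarith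
      _ ≤ 45 ^ 4 := by norm_num
  have h1' : Real.exp (1 / 4) ≤ 3 := by
    calc Real.exp (1 / 4) ≤ Real.exp 1 := Real.exp_le_exp.2 (by norm_num)
      _ ≤ 3 := by linarith
  nlinarith

/-- The choice of the moment `m` in Markov's inequality. Here `e` bounds the variance defect, `t`
the squared bias and `d` the squared column lengths, and `ρ` is the random part of the target. -/
lemma exists_moment {n p : ℕ} (hp : 2 ≤ p) (he0 : 0 ≤ e) (he : e ≤ 1 / 2) (ht : 0 ≤ t)
    (hρ : 0 ≤ ρ) (h : 2 * (ρ + (e + t) / 2) ^ 2 < 1) {d x : ℝ} (hd : 0 < d) (hnd : p ≤ n * d)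
    (hx : Real.log 3 ≤ x) (hρd : ρ ^ 2 = d * (x + Real.log n)) {k : ℝ}
    (hk : k * (4 * d * ((1 - e + t) / (1 - e) ^ 2)) = 1) :
    ∃ m : ℕ, m ≠ 0 ∧ 1 / 4 < k - m / 2 ∧
      p / 2 * (Real.log (k - 1 / 4) - Real.log (k - m / 2 - 1 / 4))
        - 4 * (m / 2) * (p * (ρ + slack e t) ^ 2) ≤ Real.log 3 - x := by
  have hp' : (2 : ℝ) ≤ p := by exact_mod_cast hp
  have hn0 : 1 ≤ n := by
    rcases Nat.eq_zero_or_pos n with h0 | h0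
    · subst h0; simp at hnd; omega
    · exact h0
  have hnpos : (0 : ℝ) < n := by exact_mod_cast hn0
  have hlog3 : 0 < Real.log 3 := Real.log_pos (by norm_num)
  -- for `n ≤ 15` already `ρ ^ 2 ≥ d n / 4 ≥ p / 4 ≥ 1 / 2`
  have hn16 : 16 ≤ n := by
    by_contra! hlt
    have h1 := le_log_mul_three_of_le hn0 (by omega)
    rw [Real.log_mul (by norm_num) hnpos.ne'] at h1
    have h2 : d * (n / 4) ≤ ρ ^ 2 := by rw [hρd]; gcongr; linarith
    have h3 : ρ ^ 2 ≤ (ρ + (e + t) / 2) ^ 2 := by gcongr; linarith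
    linarith
  set X := x + Real.log n with hX
  have hlogn : 4 * Real.log 2 ≤ Real.log n := by
    have : Real.log ((2 : ℝ) ^ 4) ≤ Real.log n :=
      Real.log_le_log (by positivity) (by norm_num; exact_mod_cast hn16)
    rw [Real.log_pow] at this
    exact_mod_cast this
  have hl2 := Real.log_two_gt_d9
  have hl3 := nineteen_log_two_le
  have hXlow : 3.8699 ≤ X := by rw [hX]; linarith
  have hXx : 3.8699 + (x - Real.log 3) ≤ X := by rw [hX]; linarith
  set w := (1 - e + t) / (1 - e) ^ 2 with hw
  have he1 : 0 < 1 - e := by linarith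
  have hw0 : 0 < w := div_pos (by linarith) (by positivity)
  have hwρ : w * ρ ^ 2 ≤ 1 / 2 := by
    have h1 := sub_sq_le_aux he0 he ht hρ h.le
    rw [hw, div_mul_eq_mul_div, div_le_iff₀ (by positivity)]
    linarith
  have hS : 1.02 * (w * ρ ^ 2) ≤ 1.8 * (ρ + slack e t) ^ 2 := by
    have h1 := mul_sq_le_slack_aux he0 he ht hρ h.le
    rw [hw, div_mul_eq_mul_div, mul_div_assoc', div_le_iff₀ (by positivity)]
    linarith
  have hk1 : k * (4 * (w * ρ ^ 2)) = X := by
    rw [hρd]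
    calc k * (4 * (w * (d * X))) = (k * (4 * d * w)) * X := by ring
      _ = X := by rw [hk, one_mul]
  have hk0 : 0 < k := by
    by_contra! hlt
    have := mul_nonpos_of_nonpos_of_nonneg hlt (by positivity : 0 ≤ 4 * d * w)
    linarith
  have hkX : X ≤ 2 * k := by linarith [mul_le_mul_of_nonneg_left hwρ hk0.le]
  -- this keeps `k - m / 2 - 1 / 4` above a tenth of `k - 1 / 4`, which bounds the logarithm below
  set m := ⌊1.8 * (k - 1 / 4)⌋₊ with hm
  have hm1 : (m : ℝ) ≤ 1.8 * (k - 1 / 4) := Nat.floor_le (by linarith)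
  have hm2 : 1.8 * (k - 1 / 4) < m + 1 := Nat.lt_floor_add_one _
  refine ⟨m, ?_, by linarith, ?_⟩
  · intro h0; rw [h0] at hm2; norm_num at hm2; linarith
  have hlog : Real.log (k - 1 / 4) - Real.log (k - m / 2 - 1 / 4) ≤ 2.3027 := by
    have h1 : Real.log (k - 1 / 4) ≤ Real.log (10 * (k - m / 2 - 1 / 4)) :=
      Real.log_le_log (by linarith) (by linarith)
    rw [Real.log_mul (by norm_num) (by linarith)] at h1
    linarith [log_ten_le]
  have hmain : 1.02 / 2 * (X - 1.6112) ≤ 4 * (m / 2) * (ρ + slack e t) ^ 2 := by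
    have h1 : (3.6 * k - 2.9) * (ρ + slack e t) ^ 2 ≤ 4 * (m / 2) * (ρ + slack e t) ^ 2 :=
      mul_le_mul_of_nonneg_right (by linarith) (sq_nonneg _)
    have h2 : (3.6 * k - 2.9) * (1.02 * (w * ρ ^ 2))
        ≤ (3.6 * k - 2.9) * (1.8 * (ρ + slack e t) ^ 2) :=
      mul_le_mul_of_nonneg_left hS (by linarith)
    have h3 : (3.6 * k - 2.9) * (1.02 * (w * ρ ^ 2)) = 0.918 * X - 2.958 * (w * ρ ^ 2) := by
      rw [← hk1]; ring
    linarith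
  have hp0 : (0 : ℝ) ≤ p / 2 - 1 := by linarith
  have h3 : 2.3027 + (x - Real.log 3) ≤ 1.02 * (X - 1.6112) := by linarith
  have h4 : (Real.log (k - 1 / 4) - Real.log (k - m / 2 - 1 / 4))
      - 2 * (4 * (m / 2) * (ρ + slack e t) ^ 2) ≤ Real.log 3 - x := by linarith
  have h5 := mul_le_mul_of_nonneg_left (h4.trans (by linarith : Real.log 3 - x ≤ 0)) hp0
  linarith

end Numeric

/-! ### Conditional coverage in dimension at least two -/

/-- The constant is `0.88 ^ 2`; the inequality is almost sharp at `e = 1 / 2`. -/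
lemma neg_sub_log_one_sub_le {e : ℝ} (he0 : 0 ≤ e) (he : e ≤ 1 / 2) :
    -e - Real.log (1 - e) ≤ 0.7744 * e ^ 2 := by
  set f : ℝ → ℝ := fun e => 0.7744 * e ^ 2 + e + Real.log (1 - e) with hf
  have hder : ∀ u : ℝ, u < 1 → HasDerivAt f (u * (1.5488 - (1 - u)⁻¹)) u := by
    intro u hu
    have h1 : 1 - u ≠ 0 := by linarith
    have h2 := (((hasDerivAt_pow 2 u).const_mul 0.7744).add (hasDerivAt_id u)).add
      (((hasDerivAt_id u).const_sub 1).log h1)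
    refine h2.congr_deriv ?_
    simp only [id]
    field_simp
    ring
  have hcont : ∀ s : Set ℝ, (∀ u ∈ s, u < 1) → ContinuousOn f s := fun s hs u hu =>
    (hder u (hs u hu)).continuousAt.continuousWithinAt
  -- `f` increases up to the zero of its derivative and decreases afterwards
  set u₀ : ℝ := 1 - 1 / 1.5488 with hu₀
  have hkey : 0 ≤ f e := by
    rcases le_total e u₀ with h | h
    · have hm : MonotoneOn f (Icc 0 u₀) := by
        refine monotoneOn_of_hasDerivWithinAt_nonneg (f' := fun u => u * (1.5488 - (1 - u)⁻¹))
          (convex_Icc _ _) (hcont _ fun u hu => ?_) (fun u hu => ?_) fun u hu => ?_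
        · have := hu.2; norm_num [hu₀] at this; linarith
        · rw [interior_Icc] at hu
          exact (hder u (by have := hu.2; norm_num [hu₀] at this; linarith)).hasDerivWithinAt
        · rw [interior_Icc] at hu
          have h1 : 1 / 1.5488 ≤ 1 - u := by have := hu.2; rw [hu₀] at this; linarith
          refine mul_nonneg hu.1.le (sub_nonneg.2 ?_)
          rw [inv_le_comm₀ (lt_of_lt_of_le (by norm_num) h1) (by norm_num), inv_eq_one_div]
          exact h1
      have := hm ⟨le_rfl, by norm_num [hu₀]⟩ ⟨he0, h⟩ he0
      simpa [hf] using this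
    · have hm : AntitoneOn f (Icc u₀ (1 / 2)) := by
        refine antitoneOn_of_hasDerivWithinAt_nonpos (f' := fun u => u * (1.5488 - (1 - u)⁻¹))
          (convex_Icc _ _) (hcont _ fun u hu => by linarith [hu.2]) (fun u hu => ?_) fun u hu => ?_
        · rw [interior_Icc] at hu
          exact (hder u (by linarith [hu.2])).hasDerivWithinAt
        · rw [interior_Icc] at hu
          have h1 : 1 - u ≤ 1 / 1.5488 := by have := hu.1; rw [hu₀] at this; linarith
          refine mul_nonpos_of_nonneg_of_nonpos ?_ (sub_nonpos.2 ?_)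
          · have := hu.1; norm_num [hu₀] at this; linarith
          · rw [le_inv_comm₀ (by norm_num) (by linarith [hu.2]), inv_eq_one_div]
            exact h1
      have h2 := hm ⟨h, he⟩ ⟨by norm_num [hu₀], le_rfl⟩ he
      have h3 : 0 ≤ f (1 / 2) := by
        have : Real.log (1 - 1 / 2) = -Real.log 2 := by
          rw [← Real.log_inv]; norm_num
        simp only [hf, this]
        linarith [Real.log_two_lt_d9]
      linarith
  simp only [hf] at hkey
  linarith

/-- The entropy term of an eigenvalue in `[1 - e, 1 + c]`; `0.7072` slightly exceeds `1 / √2`. -/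
lemma sub_one_sub_log_le {e c l : ℝ} (he : e ≤ 1 / 2) (h1 : 1 - e ≤ l) (h2 : l ≤ 1 + c) :
    l - 1 - Real.log l ≤ max (0.7072 * c) (0.88 * e) ^ 2 := by
  rcases le_total l 1 with h | h
  · have h3 := neg_sub_log_one_sub_le (e := 1 - l) (by linarith) (by linarith)
    rw [sub_sub_cancel] at h3
    have h4 : (0.88 * (1 - l)) ^ 2 ≤ max (0.7072 * c) (0.88 * e) ^ 2 := by
      have : 0 ≤ 0.88 * (1 - l) := by linarith
      gcongr
      exact le_max_of_le_right (by linarith)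
    nlinarith
  · have h3 := Real.le_log_one_add_of_nonneg (x := l - 1) (by linarith)
    rw [add_sub_cancel, div_le_iff₀ (by linarith)] at h3
    have h4 : (0.7072 * (l - 1)) ^ 2 ≤ max (0.7072 * c) (0.88 * e) ^ 2 := by
      have : 0 ≤ 0.7072 * (l - 1) := by linarith
      gcongr
      exact le_max_of_le_left (by linarith)
    have h5 : l - 1 - Real.log l ≤ (l - 1) ^ 2 / 2 := by
      by_contra! hlt
      nlinarith [mul_nonneg (sub_nonneg.2 h) (sq_nonneg (l - 1)),
        mul_lt_mul_of_pos_right hlt (by linarith : 0 < l - 1 + 2)]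
    nlinarith [sq_nonneg (l - 1)]

section

variable {n p : ℕ} {U : Matrix (Fin p) (Fin n) ℝ}

lemma sum_sq_transpose_mulVec (hU : U * Uᵀ = 1) (z : Fin p → ℝ) :
    ∑ i, (Uᵀ *ᵥ z) i ^ 2 = ∑ j, z j ^ 2 := by
  have h := dotProduct_transpose_mul_diagonal Uᵀ (fun _ => 1) z
  rw [transpose_transpose, diagonal_one, Matrix.mul_one, hU, one_mulVec] at h
  simpa [dotProduct, sq] using h.symm

/-- Each eigenvalue of `∑ M i • u i (u i)ᵀ` is the value of the quadratic form at a unit vector. -/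
lemma exists_eigenvalues_eq (hU : U * Uᵀ = 1) (M : Fin n → ℝ) (j : Fin p) :
    ∃ q : Fin n → ℝ, ∑ i, q i ^ 2 = 1 ∧
      (isHermitian_mul_diagonal_mul U M).eigenvalues j = ∑ i, M i * q i ^ 2 := by
  set hG := isHermitian_mul_diagonal_mul U M
  obtain ⟨O, hO, hO', hspec⟩ := exists_orthogonal_diagonal hG
  set z := O *ᵥ Pi.single j 1 with hz
  refine ⟨Uᵀ *ᵥ z, ?_, ?_⟩
  · rw [sum_sq_transpose_mulVec hU]
    have h := sum_sq_transpose_mulVec (U := Oᵀ) (by simpa using hO') (Pi.single j 1)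
    rw [transpose_transpose] at h
    rw [hz, h]
    simp [Pi.single_apply]
  · have h := dotProduct_transpose_mul_diagonal Uᵀ M z
    rw [transpose_transpose] at h
    obtain ⟨l, hl⟩ : ∃ l, l = hG.eigenvalues := ⟨_, rfl⟩
    rw [← hl] at hspec ⊢
    rw [← h, hspec, hz]
    have h1 : (O * diagonal l * Oᵀ) *ᵥ (O *ᵥ Pi.single j 1)
        = O *ᵥ (diagonal l *ᵥ Pi.single j 1) := by
      simp only [mulVec_mulVec, Matrix.mul_assoc, hO', Matrix.mul_one]
    rw [h1, dotProduct_mulVec, vecMul_mulVec, ← dotProduct_mulVec, mulVec_mulVec, hO',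
      Matrix.one_mul]
    simp

lemma eigenvalues_mem_Icc (hU : U * Uᵀ = 1) {M : Fin n → ℝ} {α β : ℝ} (hα : ∀ i, α ≤ M i)
    (hβ : ∀ i, M i ≤ β) (j : Fin p) :
    (isHermitian_mul_diagonal_mul U M).eigenvalues j ∈ Icc α β := by
  obtain ⟨q, hq, h⟩ := exists_eigenvalues_eq hU M j
  rw [h]
  constructor
  · calc α = ∑ i, α * q i ^ 2 := by rw [← Finset.mul_sum, hq, mul_one]
      _ ≤ _ := Finset.sum_le_sum fun i _ => mul_le_mul_of_nonneg_right (hα i) (sq_nonneg _)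
  · calc _ ≤ ∑ i, β * q i ^ 2 :=
        Finset.sum_le_sum fun i _ => mul_le_mul_of_nonneg_right (hβ i) (sq_nonneg _)
      _ = β := by rw [← Finset.mul_sum, hq, mul_one]

lemma posDef_mul_diagonal_mul (hU : U * Uᵀ = 1) {M : Fin n → ℝ} {α : ℝ} (hα0 : 0 < α)
    (hα : ∀ i, α ≤ M i) : (U * diagonal M * Uᵀ).PosDef := by
  rw [(isHermitian_mul_diagonal_mul U M).posDef_iff_eigenvalues_pos]
  intro j
  obtain ⟨q, hq, h⟩ := exists_eigenvalues_eq hU M j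
  rw [h]
  calc 0 < α := hα0
    _ = ∑ i, α * q i ^ 2 := by rw [← Finset.mul_sum, hq, mul_one]
    _ ≤ _ := Finset.sum_le_sum fun i _ => mul_le_mul_of_nonneg_right (hα i) (sq_nonneg _)

/-- Distance between `N(0, 1)` and the bootstrap law with the random weights replaced by their
means `M i`. -/
lemma tvDist_gaussLaw_mean_le (hU : U * Uᵀ = 1) {M : Fin n → ℝ} {e t : ℝ} (he0 : 0 ≤ e)
    (he : e ≤ 1 / 2) (h1 : ∀ i, 1 - e ≤ M i) (h2 : ∀ i, M i ≤ 1 + (e + t))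
    {B : Matrix (Fin p) (Fin p) ℝ} (hB : B * Bᵀ = U * diagonal M * Uᵀ) :
    tvDist (stdNormal p) (gaussLaw B) ≤ √p * ((e + t) / 2 - slack e t) := by
  set G := U * diagonal M * Uᵀ with hG
  have hGp : G.PosDef := posDef_mul_diagonal_mul hU (by linarith : 0 < 1 - e) h1
  have h := tvDist_gaussLaw_le (A := B) (by rw [hB]; exact hGp)
  rw [hB] at h
  refine h.trans ?_
  set K := max (0.7072 * (e + t)) (0.88 * e) with hK
  have hK0 : 0 ≤ K := le_max_of_le_right (by positivity)
  have h3 : G.trace - p - Real.log G.det ≤ p * K ^ 2 := by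
    have hH := isHermitian_mul_diagonal_mul U M
    have ht : G.trace = ∑ j, hH.eigenvalues j := by simpa using hH.trace_eq_sum_eigenvalues
    have hd : G.det = ∏ j, hH.eigenvalues j := by simpa using hH.det_eq_prod_eigenvalues
    have hpos : ∀ j, 0 < hH.eigenvalues j := fun j =>
      lt_of_lt_of_le (by linarith) (eigenvalues_mem_Icc hU h1 h2 j).1
    rw [ht, hd, Real.log_prod fun j _ => (hpos j).ne']
    have h4 : ∑ j, (hH.eigenvalues j - 1 - Real.log (hH.eigenvalues j)) ≤ ∑ _j : Fin p, K ^ 2 :=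
      Finset.sum_le_sum fun j _ => sub_one_sub_log_le he (eigenvalues_mem_Icc hU h1 h2 j).1
        (eigenvalues_mem_Icc hU h1 h2 j).2
    simpa [Finset.sum_sub_distrib] using h4
  have h5 : K / 2 ≤ (e + t) / 2 - slack e t := by
    have s1 : slack e t ≤ 0.1464 * (e + t) := min_le_left _ _
    have s2 : slack e t ≤ 0.06 * e + 0.5 * t := min_le_right _ _
    rcases max_choice (0.7072 * (e + t)) (0.88 * e) with hc | hc
    · rw [hK, hc]; linarith
    · rw [hK, hc]; linarith
  calc √(G.trace - p - Real.log G.det) / 2 ≤ √(p * K ^ 2) / 2 := by gcongr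
    _ = √p * (K / 2) := by
        rw [Real.sqrt_mul p.cast_nonneg, Real.sqrt_sq hK0]; ring
    _ ≤ _ := by gcongr

/-- If `B Bᵀ = ∑ M i • u i (u i)ᵀ ≥ α` then `B⁻¹ u` is at most `1 / √α` times as long as `u`. -/
lemma sum_sq_inv_mulVec_le (hU : U * Uᵀ = 1) {M : Fin n → ℝ} {α : ℝ} (hα0 : 0 < α)
    (hα : ∀ i, α ≤ M i) {B C : Matrix (Fin p) (Fin p) ℝ} (hB : B * Bᵀ = U * diagonal M * Uᵀ)
    (hBC : B * C = 1) (u : Fin p → ℝ) :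
    α * ∑ j, (C *ᵥ u) j ^ 2 ≤ ∑ j, u j ^ 2 := by
  have hCB : C * B = 1 := mul_eq_one_comm.1 hBC
  set y := C *ᵥ u with hy
  have hu : u = B *ᵥ y := by rw [hy, mulVec_mulVec, hBC, one_mulVec]
  set x := Cᵀ *ᵥ y with hx
  have hyx : y = Bᵀ *ᵥ x := by
    rw [hx, mulVec_mulVec, ← transpose_mul, hCB, transpose_one, one_mulVec]
  have h1 : y ⬝ᵥ y = ∑ i, M i * (Uᵀ *ᵥ x) i ^ 2 := by
    have h := dotProduct_transpose_mul_diagonal Uᵀ M x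
    rw [transpose_transpose, ← hB, ← mulVec_mulVec, dotProduct_mulVec, ← mulVec_transpose,
      ← hyx] at h
    exact h
  have h2 : α * ∑ j, x j ^ 2 ≤ y ⬝ᵥ y := by
    rw [h1, ← sum_sq_transpose_mulVec hU x, Finset.mul_sum]
    exact Finset.sum_le_sum fun i _ => mul_le_mul_of_nonneg_right (hα i) (sq_nonneg _)
  have h3 : y ⬝ᵥ y = u ⬝ᵥ x := by
    rw [hx, dotProduct_mulVec u, vecMul_transpose]
  have h4 : 2 * (u ⬝ᵥ x) ≤ α⁻¹ * ∑ j, u j ^ 2 + α * ∑ j, x j ^ 2 := by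
    simp only [dotProduct, Finset.mul_sum]
    rw [← Finset.sum_add_distrib]
    refine Finset.sum_le_sum fun j _ => ?_
    have : α⁻¹ * u j ^ 2 + α * x j ^ 2 - 2 * (u j * x j) = α⁻¹ * (u j - α * x j) ^ 2 := by
      field_simp; ring
    nlinarith [mul_nonneg (inv_pos.2 hα0).le (sq_nonneg (u j - α * x j))]
  have h5 : y ⬝ᵥ y ≤ α⁻¹ * ∑ j, u j ^ 2 := by linarith
  have h6 : y ⬝ᵥ y = ∑ j, y j ^ 2 := by simp [dotProduct, sq]
  rw [← h6]
  calc α * (y ⬝ᵥ y) ≤ α * (α⁻¹ * ∑ j, u j ^ 2) := by gcongr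
    _ = _ := by field_simp

/-- Moment bound for the total variation distance between `N(0, 1)` and the bootstrap law, after
whitening by the mean `∑ M i • u i (u i)ᵀ = B Bᵀ`. Markov's inequality is applied to
`exp (m / 2 * (tr G - p - log det G))`, where `G` is the whitened bootstrap covariance; by Pinsker's
inequality this controls the distance. -/
lemma measure_lt_tvDist_whitened_le {R : Matrix (Fin n) (Fin n) ℝ} {b v : Fin n → ℝ}
    (hR : ∀ z, ∑ i, (R *ᵥ z) i ^ 2 ≤ 2 * ∑ j, z j ^ 2)
    (hv : ∀ i, ∑ j, R i j ^ 2 = v i) (hvpos : ∀ i, 0 < v i)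
    {B C : Matrix (Fin p) (Fin p) ℝ}
    (hB : B * Bᵀ = U * diagonal (fun i => v i + b i ^ 2) * Uᵀ) (hBC : B * C = 1)
    {k : ℝ} (hk : 0 < k)
    (hak : ∀ i, 4 * ((1 + b i ^ 2 / v i) * ∑ j, (C * U) j i ^ 2) * k ≤ 1)
    {m : ℕ} (hm0 : m ≠ 0) (hm : 1 / 4 < k - m / 2) {r : ℝ} (hr : 0 ≤ r) :
    stdNormal n {g | r < tvDist (stdNormal p)
        (gaussLaw (C * (U * diagonal fun i => (R *ᵥ g) i + b i)))}
      ≤ ENNReal.ofReal (Real.exp (p / 2 * (Real.log (k - 1 / 4) - Real.log (k - m / 2 - 1 / 4))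
        - 4 * (m / 2) * r ^ 2)) := by
  have hCB : C * B = 1 := mul_eq_one_comm.1 hBC
  set a : Fin n → ℝ := fun i => ∑ j, (C * U) j i ^ 2 with ha
  have ha0 : ∀ i, 0 ≤ a i := fun i => Finset.sum_nonneg fun j _ => sq_nonneg _
  -- the rows of `Y` are the whitened columns of `U`, normalised to unit length
  set Y : Matrix (Fin n) (Fin p) ℝ := Matrix.of fun i j => (C * U) j i / √(a i) with hYdef
  have hscale : ∀ q : Fin n → ℝ, Yᵀ * diagonal (fun i => q i * a i) * Y
      = (C * U) * diagonal q * (C * U)ᵀ := by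
    intro q
    ext j l
    rw [mul_apply, mul_apply]
    simp only [mul_diagonal, transpose_apply, hYdef, of_apply]
    refine Finset.sum_congr rfl fun i _ => ?_
    by_cases h : a i = 0
    · have h1 := (Finset.sum_eq_zero_iff_of_nonneg fun j _ => sq_nonneg _).1 h j (Finset.mem_univ _)
      have h2 : (C * U) j i = 0 := by simpa using h1
      simp [h2]
    · have h1 : √(a i) * √(a i) = a i := Real.mul_self_sqrt (ha0 i)
      have h2 : √(a i) ≠ 0 := fun h0 => h (by rw [← h1, h0, mul_zero])
      field_simp
      rw [Real.sq_sqrt (ha0 i)]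
      ring
  have hY : Yᵀ * diagonal (fun i => (v i + b i ^ 2) * a i) * Y = 1 := by
    rw [hscale fun i => v i + b i ^ 2, transpose_mul, Matrix.mul_assoc C, Matrix.mul_assoc C,
      ← Matrix.mul_assoc _ Uᵀ, ← hB, Matrix.mul_assoc B, ← Matrix.mul_assoc C, hCB,
      Matrix.one_mul, ← transpose_mul, hCB, transpose_one]
  have hY1 : ∀ i, (v i + b i ^ 2) * a i ≠ 0 → ∑ j, Y i j ^ 2 = 1 := by
    intro i hi
    have h : a i ≠ 0 := right_ne_zero_of_mul hi
    simp only [hYdef, of_apply, div_pow, Real.sq_sqrt (ha0 i)]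
    rw [← Finset.sum_div]
    exact div_self h
  have hcp : ∑ i, (v i + b i ^ 2) * a i = p := by
    rw [← trace_transpose_mul_diagonal hY1, hY]; simp
  set s : ℝ := m / 2 with hs
  have hs0 : 0 ≤ s := by positivity
  set G : (Fin n → ℝ) → Matrix (Fin p) (Fin p) ℝ := fun g =>
    Yᵀ * diagonal (fun i => a i * ((R *ᵥ g) i + b i) ^ 2) * Y with hG
  set X : (Fin n → ℝ) → ℝ≥0∞ := fun g => gaussianIntegral (G g) ^ m
    * ENNReal.ofReal (Real.exp (-∑ i, -s * (a i * ((R *ᵥ g) i + b i) ^ 2))) with hX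
  have hηm : ∀ i, Measurable fun g : Fin n → ℝ => (R *ᵥ g) i := measurable_mulVec_apply R
  have hXm : Measurable X := by
    have hJ : Measurable fun g => gaussianIntegral (G g) :=
      measurable_gaussianIntegral_comp (D := fun g i => a i * ((R *ᵥ g) i + b i) ^ 2)
        (by fun_prop)
    fun_prop
  have hmom : ∫⁻ g, X g ∂(stdNormal n) ≤ ENNReal.ofReal (Real.exp (p * momentExponent k m)
      * ∏ i, (k + -s) ^ (-((k - m / 2) * ((v i + b i ^ 2) * a i)))) :=
    lintegral_gaussianIntegral_pow_mul_le hR hv hvpos ha0 hk hak hY hY1 hcp m (Or.inr hm)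
      (κ := fun _ => -s) fun i => by linarith
  have hks : 0 < k - s := by linarith
  have hprod : ∏ i, (k + -s) ^ (-((k - m / 2) * ((v i + b i ^ 2) * a i)))
      = Real.exp (-(p * ((k - s) * Real.log (k - s)))) := by
    rw [← sub_eq_add_neg, ← Real.rpow_sum_of_pos hks, Finset.sum_neg_distrib, ← Finset.mul_sum, hcp,
      Real.rpow_def_of_pos hks]
    congr 1; ring
  rw [hprod, ← Real.exp_add] at hmom
  set E : ℝ := s * p + 4 * s * r ^ 2 with hE
  have hlow : {g | r < tvDist (stdNormal p)
      (gaussLaw (C * (U * diagonal fun i => (R *ᵥ g) i + b i)))}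
      ⊆ {g | ENNReal.ofReal (Real.exp E) ≤ X g} := by
    intro g hg
    simp only [Set.mem_ofPred_eq] at hg ⊢
    set A := C * (U * diagonal fun i => (R *ᵥ g) i + b i) with hA
    have hAG : A * Aᵀ = G g := by
      have h1 := hscale fun i => ((R *ᵥ g) i + b i) ^ 2
      have h2 : G g = Yᵀ * diagonal (fun i => ((R *ᵥ g) i + b i) ^ 2 * a i) * Y := by
        simp only [hG, mul_comm (a _)]
      rw [h2, h1, hA, ← Matrix.mul_assoc, transpose_mul, diagonal_transpose,
        Matrix.mul_assoc (C * U), ← Matrix.mul_assoc (diagonal _), diagonal_mul_diagonal,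
        ← Matrix.mul_assoc]
      simp only [sq]
    -- if `G` is singular then the Gaussian integral, hence `X`, is infinite
    by_cases hpd : (G g).PosDef
    · have hd := hpd.det_pos
      have h1 : gaussianIntegral (G g) ^ m
          = ENNReal.ofReal (Real.exp (-(s * Real.log (G g).det))) := by
        rw [gaussianIntegral_of_posDef hpd, ← ENNReal.ofReal_pow (by positivity),
          Real.sqrt_eq_rpow, Real.rpow_def_of_pos hd, ← Real.exp_neg, ← Real.exp_nat_mul]
        congr 2
        rw [hs]; ring
      have htr : (G g).trace = ∑ i, a i * ((R *ᵥ g) i + b i) ^ 2 :=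
        trace_transpose_mul_diagonal fun i hi =>
          hY1 i (mul_ne_zero (by have := hvpos i; positivity) (left_ne_zero_of_mul hi))
      have h2 := tvDist_gaussLaw_le (A := A) (by rw [hAG]; exact hpd)
      rw [hAG] at h2
      have h3 : (2 * r) ^ 2 ≤ (G g).trace - p - Real.log (G g).det := by
        have h4 : 2 * r ≤ √((G g).trace - p - Real.log (G g).det) := by linarith
        have h5 : 0 ≤ (G g).trace - p - Real.log (G g).det := by
          by_contra! hlt
          rw [Real.sqrt_eq_zero_of_nonpos hlt.le] at h2
          linarith
        calc (2 * r) ^ 2 ≤ √((G g).trace - p - Real.log (G g).det) ^ 2 := by gcongr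
          _ = _ := Real.sq_sqrt h5
      simp only [hX]
      rw [h1, ← ENNReal.ofReal_mul (Real.exp_pos _).le, ← Real.exp_add]
      refine ENNReal.ofReal_le_ofReal (Real.exp_le_exp.2 ?_)
      have h6 : -∑ i, -s * (a i * ((R *ᵥ g) i + b i) ^ 2) = s * (G g).trace := by
        rw [htr, ← Finset.mul_sum]; ring
      rw [h6, hE]
      nlinarith [mul_le_mul_of_nonneg_left h3 hs0]
    · have hsd : (G g).PosSemidef := by
        rw [← hAG, ← conjTranspose_eq_transpose_of_trivial]
        exact posSemidef_self_mul_conjTranspose A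
      simp only [hX]
      rw [gaussianIntegral_of_not_posDef hsd hpd, ENNReal.top_pow hm0, ENNReal.top_mul]
      · exact le_top
      · simp [Real.exp_pos]
  have hmarkov := mul_meas_ge_le_lintegral₀ (μ := stdNormal n) hXm.aemeasurable
    (ENNReal.ofReal (Real.exp E))
  have hE0 : ENNReal.ofReal (Real.exp E) ≠ 0 := by simp [Real.exp_pos]
  calc _ ≤ stdNormal n {g | ENNReal.ofReal (Real.exp E) ≤ X g} := measure_mono hlow
    _ ≤ ENNReal.ofReal (Real.exp (p * momentExponent k m + -(p * ((k - s) * Real.log (k - s)))))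
        / ENNReal.ofReal (Real.exp E) := by
        rw [ENNReal.le_div_iff_mul_le (Or.inl hE0) (Or.inl ENNReal.ofReal_ne_top), mul_comm]
        exact hmarkov.trans hmom
    _ = _ := by
        rw [← ENNReal.ofReal_div_of_pos (Real.exp_pos _), ← Real.exp_sub]
        congr 2
        rw [hE, momentExponent, ← hs]
        ring

/-- The bootstrap approximation in dimension at least two, for the whitened design `U`, the residual
noise matrix `R` and the standardized bias `b`. By the triangle inequality at the normal law with
the mean covariance, the bound splits into a deterministic part, where `slack` is gained, and
a random part, where it is spent. -/
theorem measure_lt_tvDist_le_of_two_le (hp : 2 ≤ p) {R : Matrix (Fin n) (Fin n) ℝ}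
    {b v : Fin n → ℝ} (hU : U * Uᵀ = 1) (hR : ∀ z, ∑ i, (R *ᵥ z) i ^ 2 ≤ 2 * ∑ j, z j ^ 2)
    (hv : ∀ i, ∑ j, R i j ^ 2 = v i) {e t d x : ℝ} (he0 : 0 ≤ e) (he : e ≤ 1 / 2)
    (hve : ∀ i, |v i - 1| ≤ e) (ht : 0 ≤ t) (hbt : ∀ i, b i ^ 2 ≤ t)
    (hd : ∀ i, ∑ j, U j i ^ 2 ≤ d) (hx : Real.log 3 ≤ x) :
    stdNormal n {g | √(d * p * (x + Real.log n)) + (e + t) / 2 * √p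
        < tvDist (gaussLaw U) (gaussLaw (U * diagonal fun i => (R *ᵥ g) i + b i))}
      ≤ ENNReal.ofReal (3 * Real.exp (-x)) := by
  have hp' : (2 : ℝ) ≤ p := by exact_mod_cast hp
  have hnd : p ≤ n * d := by
    have h1 : (U * Uᵀ).trace = ∑ i, ∑ j, U j i ^ 2 := by
      rw [Finset.sum_comm]
      simp [trace, mul_apply, sq]
    rw [hU, trace_one, Fintype.card_fin] at h1
    rw [h1]
    refine (Finset.sum_le_sum fun i _ => hd i).trans ?_
    simp
  have hd0 : 0 < d := by
    by_contra! hlt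
    have := mul_nonpos_of_nonneg_of_nonpos (n.cast_nonneg (α := ℝ)) hlt
    linarith
  have hX0 : 0 ≤ x + Real.log n := add_nonneg
    ((Real.log_pos (by norm_num : (1 : ℝ) < 3)).le.trans hx) (Real.log_natCast_nonneg n)
  set ρ := √(d * (x + Real.log n)) with hρ
  have hρ0 : 0 ≤ ρ := Real.sqrt_nonneg _
  have hρd : ρ ^ 2 = d * (x + Real.log n) := Real.sq_sqrt (by positivity)
  have htarget : √(d * p * (x + Real.log n)) + (e + t) / 2 * √p = √p * (ρ + (e + t) / 2) := by
    rw [show d * p * (x + Real.log n) = p * (d * (x + Real.log n)) by ring,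
      Real.sqrt_mul p.cast_nonneg]
    ring
  rw [htarget]
  -- a total variation distance never exceeds one
  rcases le_or_gt 1 (√p * (ρ + (e + t) / 2)) with hbig | hsmall
  · have : {g | √p * (ρ + (e + t) / 2)
        < tvDist (gaussLaw U) (gaussLaw (U * diagonal fun i => (R *ᵥ g) i + b i))} = ∅ := by
      refine Set.eq_empty_of_forall_notMem fun g hg => ?_
      have h1 := tvDist_le_one (gaussLaw U) (gaussLaw (U * diagonal fun i => (R *ᵥ g) i + b i))
      simp only [Set.mem_ofPred_eq] at hg
      linarith
    rw [this, measure_empty]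
    exact zero_le
  have hρt : 2 * (ρ + (e + t) / 2) ^ 2 < 1 := by
    have h1 : (√p * (ρ + (e + t) / 2)) ^ 2 < 1 := by
      rw [sq_lt_one_iff_abs_lt_one, abs_of_nonneg (by positivity)]
      exact hsmall
    rw [mul_pow, Real.sq_sqrt p.cast_nonneg] at h1
    nlinarith [sq_nonneg (ρ + (e + t) / 2)]
  have he1 : 0 < 1 - e := by linarith
  have hve1 : ∀ i, 1 - e ≤ v i := fun i => by linarith [(abs_le.1 (hve i)).1]
  have hvpos : ∀ i, 0 < v i := fun i => he1.trans_le (hve1 i)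
  have hM1 : ∀ i, 1 - e ≤ v i + b i ^ 2 := fun i => by linarith [hve1 i, sq_nonneg (b i)]
  have hM2 : ∀ i, v i + b i ^ 2 ≤ 1 + (e + t) := fun i => by
    linarith [(abs_le.1 (hve i)).2, hbt i]
  have hGp := posDef_mul_diagonal_mul hU he1 hM1
  -- `B` is a square root of the mean covariance; `B⁻¹` whitens by it
  obtain ⟨O, hO, hO', hspec⟩ := exists_orthogonal_diagonal hGp.isHermitian
  have hl := hGp.eigenvalues_pos
  set l := hGp.isHermitian.eigenvalues
  set B := O * diagonal fun j => √(l j) with hBdef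
  have hB : B * Bᵀ = U * diagonal (fun i => v i + b i ^ 2) * Uᵀ := by
    rw [hspec, hBdef, transpose_mul, diagonal_transpose, Matrix.mul_assoc O,
      ← Matrix.mul_assoc (diagonal _), diagonal_mul_diagonal, ← Matrix.mul_assoc]
    simp_rw [Real.mul_self_sqrt (hl _).le]
  have hBu : IsUnit B.det := by
    have h1 := hGp.det_pos
    rw [← hB, det_mul] at h1
    exact isUnit_iff_ne_zero.2 (left_ne_zero_of_mul h1.ne')
  have hBC : B * B⁻¹ = 1 := mul_nonsing_inv B hBu
  -- `1 / k` bounds four times the squared whitened columns, inflated by the bias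
  set w := (1 - e + t) / (1 - e) ^ 2 with hw
  have hw0 : 0 < w := div_pos (by linarith) (by positivity)
  set k := (4 * d * w)⁻¹ with hk
  have hk0 : 0 < k := by positivity
  have hk1 : k * (4 * d * w) = 1 := inv_mul_cancel₀ (by positivity)
  have hak : ∀ i, 4 * ((1 + b i ^ 2 / v i) * ∑ j, (B⁻¹ * U) j i ^ 2) * k ≤ 1 := by
    intro i
    have h1 := sum_sq_inv_mulVec_le hU he1 hM1 hB hBC (U.col i)
    have h2 : ∀ j, (B⁻¹ *ᵥ U.col i) j = (B⁻¹ * U) j i := fun j => rfl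
    simp only [h2, col_apply] at h1
    have h3 : ∑ j, (B⁻¹ * U) j i ^ 2 ≤ d / (1 - e) := by
      rw [le_div_iff₀ he1]; linarith [hd i]
    have h4 : 1 + b i ^ 2 / v i ≤ (1 - e + t) / (1 - e) := by
      have : b i ^ 2 / v i ≤ t / (1 - e) := div_le_div₀ ht (hbt i) he1 (hve1 i)
      rw [add_div, div_self he1.ne']
      linarith
    have h5 : (1 + b i ^ 2 / v i) * ∑ j, (B⁻¹ * U) j i ^ 2 ≤ d * w := by
      refine (mul_le_mul h4 h3 (Finset.sum_nonneg fun j _ => sq_nonneg _)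
        (div_nonneg (by linarith) he1.le)).trans (le_of_eq ?_)
      rw [hw]; field_simp
    nlinarith
  obtain ⟨m, hm0, hm, hnum⟩ := exists_moment hp he0 he ht hρ0 hρt hd0 hnd hx hρd hk1
  have hκ0 := slack_nonneg he0 ht
  have htail := measure_lt_tvDist_whitened_le hR hv hvpos hB hBC hk0 hak hm0 hm
    (r := √p * (ρ + slack e t)) (by positivity)
  have hsub : {g | √p * (ρ + (e + t) / 2)
        < tvDist (gaussLaw U) (gaussLaw (U * diagonal fun i => (R *ᵥ g) i + b i))}
      ⊆ {g | √p * (ρ + slack e t) < tvDist (stdNormal p)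
        (gaussLaw (B⁻¹ * (U * diagonal fun i => (R *ᵥ g) i + b i)))} := by
    intro g hg
    simp only [Set.mem_ofPred_eq] at hg ⊢
    set A := U * diagonal fun i => (R *ᵥ g) i + b i with hA
    have h1 := tvDist_gaussLaw_mean_le hU he0 he hM1 hM2 hB
    have h2 : tvDist (gaussLaw B) (gaussLaw A) ≤ tvDist (stdNormal p) (gaussLaw (B⁻¹ * A)) := by
      have e1 : gaussLaw A = (gaussLaw (B⁻¹ * A)).map fun z => B *ᵥ z := by
        rw [← gaussLaw_mul, ← Matrix.mul_assoc, hBC, Matrix.one_mul]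
      rw [e1]
      exact tvDist_map_le (stdNormal p) _ (measurable_mulVec B)
    have h3 := tvDist_triangle (stdNormal p) (gaussLaw B) (gaussLaw A)
    rw [gaussLaw_eq_stdNormal hU] at hg
    linarith
  refine (measure_mono hsub).trans (htail.trans (ENNReal.ofReal_le_ofReal ?_))
  rw [mul_pow, Real.sq_sqrt p.cast_nonneg]
  have h3 : 3 * Real.exp (-x) = Real.exp (Real.log 3 - x) := by
    rw [Real.exp_sub, Real.exp_log (by norm_num), Real.exp_neg]; rfl
  rw [h3]
  exact Real.exp_le_exp.2 hnum

end

/-! ### Total variation distance between centred Gaussian laws on the line -/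

lemma gaussianPDFReal_std (x : ℝ) :
    gaussianPDFReal 0 1 x = (√(2 * Real.pi))⁻¹ * Real.exp (-x ^ 2 / 2) := by
  simp [gaussianPDFReal]

/-- The probability that a standard normal variable lies in `[-x, x]`. -/
noncomputable def centralProb (x : ℝ) : ℝ := ∫ y in (-x)..x, gaussianPDFReal 0 1 y

lemma continuous_gaussianPDFReal_std : Continuous (gaussianPDFReal 0 1) := by
  unfold gaussianPDFReal; fun_prop

lemma hasDerivAt_centralProb (x : ℝ) :
    HasDerivAt centralProb (2 * gaussianPDFReal 0 1 x) x := by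
  have hc := continuous_gaussianPDFReal_std
  have hF : ∀ x, HasDerivAt (fun x => ∫ y in (0 : ℝ)..x, gaussianPDFReal 0 1 y)
      (gaussianPDFReal 0 1 x) x := fun x =>
    intervalIntegral.integral_hasDerivAt_right (hc.intervalIntegrable _ _)
      (hc.stronglyMeasurableAtFilter _ _) hc.continuousAt
  have h : centralProb = fun x => (∫ y in (0 : ℝ)..x, gaussianPDFReal 0 1 y)
      - ∫ y in (0 : ℝ)..(-x), gaussianPDFReal 0 1 y := by
    ext x
    rw [intervalIntegral.integral_interval_sub_left (hc.intervalIntegrable _ _)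
      (hc.intervalIntegrable _ _), centralProb]
  rw [h]
  have h2 := (hF x).sub ((hF (-x)).comp x (hasDerivAt_neg x))
  refine h2.congr_deriv ?_
  rw [gaussianPDFReal_std, gaussianPDFReal_std]
  ring_nf

lemma measureReal_Icc_eq_centralProb {x : ℝ} (hx : 0 ≤ x) :
    (gaussianReal 0 1).real (Icc (-x) x) = centralProb x := by
  rw [measureReal_def, gaussianReal_apply_eq_integral _ one_ne_zero, ENNReal.toReal_ofReal
    (integral_nonneg fun y => gaussianPDFReal_nonneg _ _ _), centralProb,
    intervalIntegral.integral_of_le (by linarith), integral_Icc_eq_integral_Ioc]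

/-- For `L > 0`, the point where the densities of `N(0, 1)` and `N(0, exp (-L))` agree, measured in
standard deviations of the latter law. -/
noncomputable def crossing (L : ℝ) : ℝ := √(L / (1 - Real.exp (-L)))

/-- The total variation distance between `N(0, 1)` and `N(0, exp (-L))` for `L > 0`. -/
noncomputable def gaussSep (L : ℝ) : ℝ :=
  centralProb (crossing L) - centralProb (crossing L * Real.exp (-L / 2))

lemma one_sub_exp_neg_pos {L : ℝ} (hL : 0 < L) : 0 < 1 - Real.exp (-L) :=
  sub_pos.2 (Real.exp_lt_one_iff.2 (neg_lt_zero.2 hL))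

lemma crossing_pos {L : ℝ} (hL : 0 < L) : 0 < crossing L :=
  Real.sqrt_pos.2 (div_pos hL (one_sub_exp_neg_pos hL))

lemma crossing_sq {L : ℝ} (hL : 0 < L) : crossing L ^ 2 = L / (1 - Real.exp (-L)) :=
  Real.sq_sqrt (div_pos hL (one_sub_exp_neg_pos hL)).le

lemma crossing_mul_exp_sq {L : ℝ} (hL : 0 < L) :
    (crossing L * Real.exp (-L / 2)) ^ 2 = crossing L ^ 2 - L := by
  have h : Real.exp (-L / 2) ^ 2 = Real.exp (-L) := by
    rw [← Real.exp_nat_mul]; congr 1; push_cast; ring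
  have := (one_sub_exp_neg_pos hL).ne'
  rw [mul_pow, h, crossing_sq hL]
  field_simp
  ring

/-- The derivative of the crossing point cancels, because the two densities agree there. -/
lemma hasDerivAt_gaussSep {L : ℝ} (hL : 0 < L) :
    HasDerivAt gaussSep (crossing L * gaussianPDFReal 0 1 (crossing L)) L := by
  have he : HasDerivAt (fun L : ℝ => Real.exp (-L)) (-Real.exp (-L)) L := by
    simpa using (hasDerivAt_neg L).exp
  have hq := (hasDerivAt_id L).div (he.const_sub 1) (one_sub_exp_neg_pos hL).ne'
  obtain ⟨u', hu⟩ : ∃ u', HasDerivAt crossing u' L :=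
    ⟨_, hq.sqrt (div_pos hL (one_sub_exp_neg_pos hL)).ne'⟩
  have he2 : HasDerivAt (fun L : ℝ => Real.exp (-L / 2)) (Real.exp (-L / 2) * (-1 / 2)) L :=
    ((hasDerivAt_neg L).div_const 2).exp
  have h1 := (hasDerivAt_centralProb (crossing L)).comp L hu
  have h2 := (hasDerivAt_centralProb (crossing L * Real.exp (-L / 2))).comp L (hu.mul he2)
  refine (h1.sub h2).congr_deriv ?_
  have h3 : gaussianPDFReal 0 1 (crossing L * Real.exp (-L / 2)) * Real.exp (-L / 2)
      = gaussianPDFReal 0 1 (crossing L) := by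
    rw [gaussianPDFReal_std, gaussianPDFReal_std, crossing_mul_exp_sq hL, mul_assoc, ← Real.exp_add]
    congr 2
    ring
  linear_combination (-2 * u' + crossing L) * h3

/-- The difference of the two laws is largest on the interval `[-a, a]` where the density of the
narrower law dominates. -/
lemma tvDist_gaussianReal_le_gaussSep {L : ℝ} (hL : 0 < L) :
    tvDist (gaussianReal 0 1) (gaussianReal 0 (Real.toNNReal (Real.exp (-L)))) ≤ gaussSep L := by
  set u := crossing L with hu
  set a := u * Real.exp (-L / 2) with ha
  have hu0 : 0 < u := crossing_pos hL
  have ha0 : 0 < a := mul_pos hu0 (Real.exp_pos _)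
  set v := Real.toNNReal (Real.exp (-L)) with hv
  have hv0 : v ≠ 0 := by rw [hv]; simp [Real.exp_pos]
  have hvc : (v : ℝ) = Real.exp (-L) := Real.coe_toNNReal _ (Real.exp_pos _).le
  have hsq : Real.exp (-L / 2) ^ 2 = Real.exp (-L) := by
    rw [← Real.exp_nat_mul]; congr 1; push_cast; ring
  have hq : ∀ x, gaussianPDFReal 0 v x = gaussianPDFReal 0 1 x
      * Real.exp (L / 2 - x ^ 2 * (Real.exp L - 1) / 2) := by
    intro x
    have h1 : √(2 * Real.pi * v) = √(2 * Real.pi) * Real.exp (-L / 2) := by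
      rw [Real.sqrt_mul (by positivity), hvc, ← hsq, Real.sqrt_sq (Real.exp_pos _).le]
    rw [gaussianPDFReal_std, gaussianPDFReal, h1, hvc, mul_inv, ← Real.exp_neg, mul_assoc,
      mul_assoc, ← Real.exp_add, ← Real.exp_add, sub_zero]
    congr 2
    have h2 : Real.exp L * Real.exp (-L) = 1 := by rw [← Real.exp_add]; simp
    have h3 := (Real.exp_pos (-L)).ne'
    field_simp
    linear_combination (x ^ 2) * h2
  have ha2 : a ^ 2 * (Real.exp L - 1) = L := by
    have h2 : Real.exp L * Real.exp (-L) = 1 := by rw [← Real.exp_add]; simp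
    have h3 := (one_sub_exp_neg_pos hL).ne'
    rw [ha, mul_pow, hsq, hu, crossing_sq hL]
    field_simp
    linear_combination h2
  have heL : 0 < Real.exp L - 1 := sub_pos.2 (Real.one_lt_exp_iff.2 hL)
  have hge : ∀ x ∈ Icc (-a) a, gaussianPDFReal 0 1 x ≤ gaussianPDFReal 0 v x := by
    intro x hx
    rw [hq]
    refine le_mul_of_one_le_right (gaussianPDFReal_nonneg _ _ _) (Real.one_le_exp ?_)
    have h1 : x ^ 2 ≤ a ^ 2 := sq_le_sq' hx.1 hx.2
    have := mul_le_mul_of_nonneg_right h1 heL.le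
    linarith
  have hle : ∀ x ∉ Icc (-a) a, gaussianPDFReal 0 v x ≤ gaussianPDFReal 0 1 x := by
    intro x hx
    rw [hq]
    refine mul_le_of_le_one_right (gaussianPDFReal_nonneg _ _ _) (Real.exp_le_one_iff.2 ?_)
    have h1 : a ^ 2 ≤ x ^ 2 := by
      rw [sq_le_sq, abs_of_pos ha0]
      by_contra! h
      exact hx (abs_le.1 h.le)
    have := mul_le_mul_of_nonneg_right h1 heL.le
    linarith
  have hreal : ∀ (w : NNReal), w ≠ 0 → ∀ A, (gaussianReal 0 w).real A
      = ∫ x in A, gaussianPDFReal 0 w x := fun w hw A => by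
    rw [measureReal_def, gaussianReal_apply_eq_integral _ hw, ENNReal.toReal_ofReal
      (integral_nonneg fun y => gaussianPDFReal_nonneg _ _ _)]
  have hint : ∀ w A, IntegrableOn (gaussianPDFReal 0 w) A := fun w A =>
    (integrable_gaussianPDFReal 0 w).integrableOn
  have hI : (gaussianReal 0 v).real (Icc (-a) a) = centralProb u := by
    have h1 : gaussianReal 0 v = (gaussianReal 0 1).map (fun x => Real.exp (-L / 2) * x) := by
      rw [gaussianReal_map_const_mul]
      simp only [mul_zero, mul_one]
      congr 1
      ext
      rw [hvc, ← hsq]; simp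
    rw [h1, map_measureReal_apply (by fun_prop) measurableSet_Icc,
      ← measureReal_Icc_eq_centralProb hu0.le]
    congr 1
    ext x
    have := Real.exp_pos (-L / 2)
    simp only [mem_preimage, mem_Icc, ha]
    constructor
    · rintro ⟨h1, h2⟩; constructor <;> nlinarith
    · rintro ⟨h1, h2⟩; constructor <;> nlinarith
  refine tvDist_le_of_sub_le fun A hA => ?_
  have hIm : MeasurableSet (Icc (-a) a) := measurableSet_Icc
  have s1 : ∀ ν : Measure ℝ, [IsProbabilityMeasure ν] →
      ν.real A = ν.real (A ∩ Icc (-a) a) + ν.real (A \ Icc (-a) a) := fun ν _ =>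
    (measureReal_inter_add_sdiff hIm).symm
  have s2 : ∀ ν : Measure ℝ, [IsProbabilityMeasure ν] →
      ν.real (Icc (-a) a) = ν.real (Icc (-a) a ∩ A) + ν.real (Icc (-a) a \ A) := fun ν _ =>
    (measureReal_inter_add_sdiff hA).symm
  have s3 : (gaussianReal 0 v).real (A \ Icc (-a) a)
      ≤ (gaussianReal 0 1).real (A \ Icc (-a) a) := by
    rw [hreal _ hv0, hreal _ one_ne_zero]
    exact setIntegral_mono_on (hint _ _) (hint _ _) (hA.diff hIm) fun x hx => hle x hx.2
  have s4 : (gaussianReal 0 1).real (Icc (-a) a \ A)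
      ≤ (gaussianReal 0 v).real (Icc (-a) a \ A) := by
    rw [hreal _ hv0, hreal _ one_ne_zero]
    exact setIntegral_mono_on (hint _ _) (hint _ _) (hIm.diff hA) fun x hx => hge x hx.1
  have s5 := s2 (gaussianReal 0 1)
  have s6 := s2 (gaussianReal 0 v)
  rw [s1, s1 (gaussianReal 0 1), gaussSep, ← hu, ← ha, ← hI,
    ← measureReal_Icc_eq_centralProb ha0.le, s5, s6, inter_comm A]
  linarith

lemma one_le_crossing {L : ℝ} (hL : 0 < L) : 1 ≤ crossing L := by
  rw [← sq_le_sq₀ zero_le_one (crossing_pos hL).le, crossing_sq hL, one_pow,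
    le_div_iff₀ (one_sub_exp_neg_pos hL)]
  linarith [Real.add_one_le_exp (-L)]

/-- `gaussSep` has derivative `u φ(u)` at the crossing point `u`; it decreases in `u ≥ 1`. -/
lemma crossing_mul_gaussianPDFReal_le {L y s : ℝ} (hL : 0 < L) (hy : 1 ≤ y)
    (hyL : y ≤ crossing L ^ 2) (hs : 0 ≤ s) (hys : y * Real.exp (-y) ≤ 2 * Real.pi * s ^ 2) :
    crossing L * gaussianPDFReal 0 1 (crossing L) ≤ s := by
  set z := crossing L ^ 2 with hz
  have h1 : z * Real.exp (-z) ≤ y * Real.exp (-y) := by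
    have h2 : z ≤ y * Real.exp (z - y) := by
      have := Real.add_one_le_exp (z - y)
      nlinarith
    calc z * Real.exp (-z) ≤ (y * Real.exp (z - y)) * Real.exp (-z) := by gcongr
      _ = y * Real.exp (-y) := by rw [mul_assoc, ← Real.exp_add]; congr 2; ring
  have hpos := crossing_pos hL
  rw [← sq_le_sq₀ (mul_nonneg hpos.le (gaussianPDFReal_nonneg _ _ _)) hs, gaussianPDFReal_std,
    mul_pow, mul_pow, inv_pow, Real.sq_sqrt (by positivity), ← Real.exp_nat_mul, ← hz]
  have h3 : ((2 : ℕ) : ℝ) * (-z / 2) = -z := by push_cast; ring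
  rw [h3, mul_left_comm, inv_mul_le_iff₀ (by positivity)]
  linarith

/-- One step of a piecewise linear majorant of `gaussSep`. -/
lemma gaussSep_le_add {L₀ L y s : ℝ} (hL₀ : 0 < L₀) (hL : L₀ ≤ L) (hy : 1 ≤ y)
    (hyL : ∀ l, L₀ ≤ l → y ≤ crossing l ^ 2) (hs : 0 ≤ s)
    (hys : y * Real.exp (-y) ≤ 2 * Real.pi * s ^ 2) :
    gaussSep L ≤ gaussSep L₀ + s * (L - L₀) := by
  have h := image_le_of_deriv_right_le_deriv_boundary (a := L₀) (b := L) (f := gaussSep)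
    (f' := fun L => crossing L * gaussianPDFReal 0 1 (crossing L))
    (B := fun L => gaussSep L₀ + s * (L - L₀)) (B' := fun _ => s)
    (fun l hl => (hasDerivAt_gaussSep (hL₀.trans_le hl.1)).continuousAt.continuousWithinAt)
    (fun l hl => (hasDerivAt_gaussSep (hL₀.trans_le hl.1)).hasDerivWithinAt)
    (by simp) (by fun_prop)
    (fun l _ => by
      simpa using ((((hasDerivAt_id l).sub_const L₀).const_mul s).const_add
        (gaussSep L₀)).hasDerivWithinAt)
    (fun l hl => crossing_mul_gaussianPDFReal_le (hL₀.trans_le hl.1) hy (hyL l hl.1) hs hys)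
  exact h ⟨hL, le_rfl⟩

lemma le_crossing_sq {L₀ l y : ℝ} (hL₀ : 0 < L₀) (hl : L₀ ≤ l) (hy0 : 0 ≤ y)
    (h1 : y * (1 - Real.exp (-L₀)) ≤ L₀) (h2 : y * Real.exp (-L₀) ≤ 1) : y ≤ crossing l ^ 2 := by
  have hl0 := hL₀.trans_le hl
  rw [crossing_sq hl0, le_div_iff₀ (one_sub_exp_neg_pos hl0)]
  have h3 : Real.exp (-L₀) * (1 - (l - L₀)) ≤ Real.exp (-l) := by
    calc Real.exp (-L₀) * (1 - (l - L₀)) ≤ Real.exp (-L₀) * Real.exp (-(l - L₀)) := by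
          have := Real.add_one_le_exp (-(l - L₀))
          have := Real.exp_pos (-L₀)
          nlinarith
      _ = Real.exp (-l) := by rw [← Real.exp_add]; congr 1; ring
  have h4 := mul_le_mul_of_nonneg_left h3 hy0
  nlinarith [mul_nonneg (sub_nonneg.2 hl) (sub_nonneg.2 h2)]

/-- The slope `u φ(u)` of `gaussSep` is at most `φ(1)`, and `0.242` slightly exceeds this value. -/
lemma gaussSep_le {L : ℝ} (hL : 0 < L) : gaussSep L ≤ 0.242 * L := by
  -- a rough bound, needed only to see that `gaussSep` vanishes at zero
  have hsmall : ∀ l, 0 < l → gaussSep l ≤ l := by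
    intro l hl
    have hm : ∀ x, centralProb x ≤ centralProb (crossing l * Real.exp (-l / 2))
        + (x - crossing l * Real.exp (-l / 2)) ∨ x < crossing l * Real.exp (-l / 2) := by
      intro x
      rcases lt_or_ge x (crossing l * Real.exp (-l / 2)) with h | h
      · exact Or.inr h
      left
      have h1 := image_le_of_deriv_right_le_deriv_boundary (a := crossing l * Real.exp (-l / 2))
        (b := x) (f := centralProb) (f' := fun x => 2 * gaussianPDFReal 0 1 x)
        (B := fun x => centralProb (crossing l * Real.exp (-l / 2))
          + (x - crossing l * Real.exp (-l / 2))) (B' := fun _ => 1)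
        (fun y _ => (hasDerivAt_centralProb y).continuousAt.continuousWithinAt)
        (fun y _ => (hasDerivAt_centralProb y).hasDerivWithinAt) (by simp) (by fun_prop)
        (fun y _ => by
          simpa using (((hasDerivAt_id y).sub_const (crossing l * Real.exp (-l / 2))).const_add
            (centralProb (crossing l * Real.exp (-l / 2)))).hasDerivWithinAt)
        (fun y _ => by
          have h2 : Real.exp (-y ^ 2 / 2) ≤ 1 := Real.exp_le_one_iff.2 (by nlinarith [sq_nonneg y])
          have h3 : 2 ≤ √(2 * Real.pi) := Real.le_sqrt_of_sq_le (by linarith [Real.pi_gt_three])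
          rw [gaussianPDFReal_std, ← mul_assoc, ← div_eq_mul_inv]
          calc 2 / √(2 * Real.pi) * Real.exp (-y ^ 2 / 2) ≤ 1 * 1 := by
                gcongr
                rw [div_le_one (by positivity)]; exact h3
            _ = 1 := one_mul 1)
      exact h1 ⟨h, le_rfl⟩
    have h1 := crossing_pos hl
    have h2 : Real.exp (-l / 2) < 1 := Real.exp_lt_one_iff.2 (by linarith)
    have h3 := crossing_mul_exp_sq hl
    have h4 := one_le_crossing hl
    have h5 := mul_pos h1 (Real.exp_pos (-l / 2))
    rcases hm (crossing l) with h | h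
    · rw [gaussSep]; nlinarith
    · nlinarith
  have hstep : ∀ l, 0 < l → l ≤ L → gaussSep L ≤ l + 0.242 * (L - l) := by
    intro l hl hlL
    refine (gaussSep_le_add hl hlL le_rfl (fun z hz => ?_) (by norm_num) ?_).trans
      (add_le_add_left (hsmall l hl) _)
    · rw [← one_pow 2]
      exact pow_le_pow_left₀ zero_le_one (one_le_crossing (hl.trans_le hz)) 2
    · have h1 : Real.exp (-1) ≤ 0.36788 := by
        rw [Real.exp_neg, inv_le_comm₀ (Real.exp_pos _) (by norm_num)]
        linarith [Real.exp_one_gt_d9, (by norm_num : (0.36788 : ℝ)⁻¹ ≤ 2.7182818283)]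
      nlinarith [Real.pi_gt_d4]
  by_contra! hlt
  set ε := (gaussSep L - 0.242 * L) with hε
  have h1 := hstep (min L ε) (lt_min hL (sub_pos.2 hlt)) (min_le_left _ _)
  have h2 : 0 < min L ε := lt_min hL (sub_pos.2 hlt)
  have h3 : min L ε ≤ ε := min_le_right _ _
  linarith

/-! ### Numerical estimates in dimension one -/

lemma exp_neg_tenth_bounds (k : ℕ) :
    (0.904837 : ℝ) ^ k ≤ Real.exp (-(k / 10)) ∧ Real.exp (-(k / 10)) ≤ 0.904838 ^ k := by
  have h1 : Real.exp (-(k / 10)) = Real.exp (-(1 / 10)) ^ k := by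
    rw [← Real.exp_nat_mul]; congr 1; ring
  have h2 : Real.exp (-(1 / 10)) ^ 10 = (Real.exp 1)⁻¹ := by
    rw [← Real.exp_nat_mul, ← Real.exp_neg]; congr 1; norm_num
  have hlo : (0.904837 : ℝ) ≤ Real.exp (-(1 / 10)) := by
    rw [← pow_le_pow_iff_left₀ (by norm_num) (Real.exp_pos _).le (by norm_num : (10 : ℕ) ≠ 0), h2,
      le_inv_comm₀ (by norm_num) (Real.exp_pos _)]
    exact Real.exp_one_lt_d9.le.trans (by norm_num)
  have hhi : Real.exp (-(1 / 10)) ≤ 0.904838 := by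
    rw [← pow_le_pow_iff_left₀ (Real.exp_pos _).le (by norm_num) (by norm_num : (10 : ℕ) ≠ 0), h2,
      inv_le_comm₀ (Real.exp_pos _) (by norm_num)]
    exact le_trans (by norm_num) Real.exp_one_gt_d9.le
  rw [h1]
  exact ⟨pow_le_pow_left₀ (by norm_num) hlo k, pow_le_pow_left₀ (Real.exp_pos _).le hhi k⟩

/-- One linear piece of the majorant of `gaussSep`, on `[k₀ / 10, k₁ / 10]`, with the comparison
with the large deviation rate on that piece. -/
lemma gaussSep_piece {k₀ k₁ j : ℕ} {a b y s K : ℝ} (hK : gaussSep a ≤ K) (ha : a = k₀ / 10)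
    (hb : b = k₁ / 10) (hy : y = j / 10) (hk₀ : 0 < a) (hab : a ≤ b) (hy1 : 1 ≤ y) (hs : 0 ≤ s)
    (h1 : y * (1 - 0.904837 ^ k₀) ≤ a) (h2 : y * 0.904838 ^ k₀ ≤ 1)
    (h3 : y * 0.904838 ^ j ≤ 6.283 * s ^ 2)
    (h4 : (2 * K - 1 / 2) ^ 2 ≤ 0.904837 ^ k₁ * (1 + b - a) - 0.84658 + a / 2)
    (h5 : (2 * (K + s * (b - a)) - 1 / 2) ^ 2 ≤ 0.904837 ^ k₁ - 0.84658 + b / 2) :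
    gaussSep b ≤ K + s * (b - a) ∧ ∀ L, a ≤ L → L ≤ b → ∀ D, 1 / 4 ≤ D → D ≤ gaussSep L →
      (2 * D - 1 / 2) ^ 2 ≤ Real.exp (-L) - 1 / 2 - Real.log 2 / 2 + L / 2 := by
  have e0 := exp_neg_tenth_bounds k₀
  have e1 := exp_neg_tenth_bounds k₁
  have ej := exp_neg_tenth_bounds j
  rw [← ha] at e0
  rw [← hb] at e1
  rw [← hy] at ej
  have hle : ∀ L, a ≤ L → gaussSep L ≤ K + s * (L - a) := by
    intro L hL
    refine (gaussSep_le_add hk₀ hL hy1 (fun l hl => le_crossing_sq hk₀ hl (by linarith) ?_ ?_) hs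
      ?_).trans (add_le_add_left hK _)
    · exact (mul_le_mul_of_nonneg_left (by linarith) (by linarith)).trans h1
    · exact (mul_le_mul_of_nonneg_left e0.2 (by linarith)).trans h2
    · refine (mul_le_mul_of_nonneg_left ej.2 (by linarith)).trans (h3.trans ?_)
      have := Real.pi_gt_d4
      nlinarith [sq_nonneg s]
  refine ⟨hle b hab, fun L hL hLb D hD hDs => ?_⟩
  have hD2 := hDs.trans (hle L hL)
  have h6 : (2 * D - 1 / 2) ^ 2 ≤ (2 * (K + s * (L - a)) - 1 / 2) ^ 2 :=
    pow_le_pow_left₀ (by linarith) (by linarith) 2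
  have h7 : 0.904837 ^ k₁ * (1 + b - L) ≤ Real.exp (-L) := by
    calc (0.904837 : ℝ) ^ k₁ * (1 + b - L) ≤ Real.exp (-b) * Real.exp (b - L) := by
          have := Real.add_one_le_exp (b - L)
          exact mul_le_mul e1.1 (by linarith) (by linarith) (Real.exp_pos _).le
      _ = Real.exp (-L) := by rw [← Real.exp_add]; congr 1; ring
  have h8 := Real.log_two_lt_d9
  -- the difference is concave in `L`, and nonnegative at both ends
  have h9 : (2 * (K + s * (L - a)) - 1 / 2) ^ 2
      ≤ 0.904837 ^ k₁ * (1 + b - L) - 0.84658 + L / 2 := by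
    rcases hab.eq_or_lt with h | h
    · have : L = b := le_antisymm hLb (h ▸ hL)
      rw [this]; linarith
    · set c : ℝ := 0.904837 ^ k₁
      have hw := sub_pos.2 h
      have e : (b - a) * (c * (1 + b - L) - 0.84658 + L / 2 - (2 * (K + s * (L - a)) - 1 / 2) ^ 2)
          = (b - L) * (c * (1 + b - a) - 0.84658 + a / 2 - (2 * K - 1 / 2) ^ 2)
            + (L - a) * (c - 0.84658 + b / 2 - (2 * (K + s * (b - a)) - 1 / 2) ^ 2)
            + (b - a) * (4 * s ^ 2 * ((L - a) * (b - L))) := by ring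
      have := mul_nonneg (sub_nonneg.2 hLb) (sub_nonneg.2 h4)
      have := mul_nonneg (sub_nonneg.2 hL) (sub_nonneg.2 h5)
      have := mul_nonneg hw.le (mul_nonneg (by positivity : 0 ≤ 4 * s ^ 2)
        (mul_nonneg (sub_nonneg.2 hL) (sub_nonneg.2 hLb)))
      have h10 := nonneg_of_mul_nonneg_right (by rw [e]; positivity) hw
      linarith
  linarith

/-- Comparison of the total variation distance between `N(0, 1)` and `N(0, exp (-L))` with the
lower deviation rate of the bootstrap variance, for the smallest admissible mean `1 / 2`. -/
lemma sq_sub_half_le_rate {L D : ℝ} (hL : 0 < L) (hD : 1 / 4 ≤ D) (hD1 : D ≤ 1)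
    (hDs : D ≤ gaussSep L) :
    (2 * D - 1 / 2) ^ 2 ≤ Real.exp (-L) - 1 / 2 - Real.log 2 / 2 + L / 2 := by
  -- for smaller `L` the distance is below `1 / 4`
  have hL1 : 1 ≤ L := by
    have := gaussSep_le hL
    linarith
  have p0 : gaussSep 1 ≤ 0.242 := by
    have := gaussSep_le one_pos
    linarith
  -- nine linear pieces majorise `gaussSep` on `[1, 6.2]`
  have p1 := gaussSep_piece (k₀ := 10) (k₁ := 12) (j := 15) (b := 1.2) (y := 1.5)
    (s := 0.231) p0 (by norm_num) (by norm_num) (by norm_num) (by norm_num) (by norm_num)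
    (by norm_num) (by norm_num) (by norm_num) (by norm_num) (by norm_num) (by norm_num)
    (by norm_num)
  have p2 := gaussSep_piece (k₀ := 12) (k₁ := 16) (j := 17) (b := 1.6) (y := 1.7)
    (s := 0.2225) p1.1 (by norm_num) (by norm_num) (by norm_num) (by norm_num) (by norm_num)
    (by norm_num) (by norm_num) (by norm_num) (by norm_num) (by norm_num) (by norm_num)
    (by norm_num)
  have p3 := gaussSep_piece (k₀ := 16) (k₁ := 20) (j := 20) (b := 2) (y := 2)
    (s := 0.2077) p2.1 (by norm_num) (by norm_num) (by norm_num) (by norm_num) (by norm_num)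
    (by norm_num) (by norm_num) (by norm_num) (by norm_num) (by norm_num) (by norm_num)
    (by norm_num)
  have p4 := gaussSep_piece (k₀ := 20) (k₁ := 25) (j := 23) (b := 2.5) (y := 2.3)
    (s := 0.192) p3.1 (by norm_num) (by norm_num) (by norm_num) (by norm_num) (by norm_num)
    (by norm_num) (by norm_num) (by norm_num) (by norm_num) (by norm_num) (by norm_num)
    (by norm_num)
  have p5 := gaussSep_piece (k₀ := 25) (k₁ := 30) (j := 27) (b := 3) (y := 2.7)
    (s := 0.17) p4.1 (by norm_num) (by norm_num) (by norm_num) (by norm_num) (by norm_num)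
    (by norm_num) (by norm_num) (by norm_num) (by norm_num) (by norm_num) (by norm_num)
    (by norm_num)
  have p6 := gaussSep_piece (k₀ := 30) (k₁ := 35) (j := 31) (b := 3.5) (y := 3.1)
    (s := 0.15) p5.1 (by norm_num) (by norm_num) (by norm_num) (by norm_num) (by norm_num)
    (by norm_num) (by norm_num) (by norm_num) (by norm_num) (by norm_num) (by norm_num)
    (by norm_num)
  have p7 := gaussSep_piece (k₀ := 35) (k₁ := 40) (j := 36) (b := 4) (y := 3.6)
    (s := 0.126) p6.1 (by norm_num) (by norm_num) (by norm_num) (by norm_num) (by norm_num)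
    (by norm_num) (by norm_num) (by norm_num) (by norm_num) (by norm_num) (by norm_num)
    (by norm_num)
  have p8 := gaussSep_piece (k₀ := 40) (k₁ := 50) (j := 40) (b := 5) (y := 4)
    (s := 0.108) p7.1 (by norm_num) (by norm_num) (by norm_num) (by norm_num) (by norm_num)
    (by norm_num) (by norm_num) (by norm_num) (by norm_num) (by norm_num) (by norm_num)
    (by norm_num)
  have p9 := gaussSep_piece (k₀ := 50) (k₁ := 62) (j := 50) (b := 6.2) (y := 5)
    (s := 0.074) p8.1 (by norm_num) (by norm_num) (by norm_num) (by norm_num) (by norm_num)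
    (by norm_num) (by norm_num) (by norm_num) (by norm_num) (by norm_num) (by norm_num)
    (by norm_num)
  rcases le_total L 1.2 with h | h1
  · exact p1.2 L hL1 h D hD hDs
  rcases le_total L 1.6 with h | h2
  · exact p2.2 L h1 h D hD hDs
  rcases le_total L 2 with h | h3
  · exact p3.2 L h2 h D hD hDs
  rcases le_total L 2.5 with h | h4
  · exact p4.2 L h3 h D hD hDs
  rcases le_total L 3 with h | h5
  · exact p5.2 L h4 h D hD hDs
  rcases le_total L 3.5 with h | h6
  · exact p6.2 L h5 h D hD hDs
  rcases le_total L 4 with h | h7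
  · exact p7.2 L h6 h D hD hDs
  rcases le_total L 5 with h | h8
  · exact p8.2 L h7 h D hD hDs
  rcases le_total L 6.2 with h | h9
  · exact p9.2 L h8 h D hD hDs
  -- beyond `6.2` the trivial bound `D ≤ 1` is enough
  have h9 : Real.exp (-6.2) + (6.2 - L) * Real.exp (-6.2) ≤ Real.exp (-L) := by
    have h10 : Real.exp (-L) = Real.exp (-6.2) * Real.exp (6.2 - L) := by
      rw [← Real.exp_add]; congr 1; ring
    rw [h10]
    have := Real.add_one_le_exp (6.2 - L)
    nlinarith [Real.exp_pos (-6.2)]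
  have h10 := exp_neg_tenth_bounds 62
  rw [show -(((62 : ℕ) : ℝ) / 10) = -6.2 by norm_num] at h10
  have h11 : (0.002 : ℝ) ≤ Real.exp (-6.2) := le_trans (by norm_num) h10.1
  have h12 : Real.exp (-6.2) ≤ 0.0021 := h10.2.trans (by norm_num)
  have h13 : (2 * D - 1 / 2) ^ 2 ≤ (3 / 2) ^ 2 := pow_le_pow_left₀ (by linarith) (by linarith) 2
  have h14 := Real.log_two_lt_d9
  nlinarith

/-- In dimension one, the total variation distance `D` between `N(0, 1)` and `N(0, g)`, corrected
for the deviation `1 - v` of the mean variance, is dominated by the large deviation rate of the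
bootstrap variance at `g`. The difference of the two sides of the last inequality is concave in
`v ∈ [1/2, 1]`; at `v = 1` it is Pinsker's inequality. -/
lemma sq_le_rate {g v D : ℝ} (hg0 : 0 < g) (hg1 : g < 1) (hv : 1 / 2 ≤ v) (hv1 : v ≤ 1)
    (hD1 : D ≤ 1) (hP : 4 * D ^ 2 ≤ g - 1 - Real.log g) (hDs : D ≤ gaussSep (-Real.log g))
    (hlt : 1 - v < 2 * D) :
    g < v ∧ (2 * D - 1 + v) ^ 2 ≤ g - v + v * Real.log (v / g) := by
  have hL : 0 < -Real.log g := neg_pos.2 (Real.log_neg hg0 hg1)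
  have hD0 : 0 < D := by linarith
  have hgv : g < v := by
    by_contra! h
    have h1 := gaussSep_le hL
    have h2 := Real.one_sub_inv_le_log_of_pos hg0
    have h3 : g⁻¹ - 1 ≤ 2 * (1 - g) := by
      rw [inv_eq_one_div, div_sub_one hg0.ne', div_le_iff₀ hg0]
      nlinarith
    linarith
  refine ⟨hgv, ?_⟩
  set F : ℝ → ℝ := fun u => g - u + (u * Real.log u - u * Real.log g) - (2 * D - 1 + u) ^ 2 with hF
  have hFconc : ConcaveOn ℝ (Icc (1 / 2) 1) F := by
    have hder : ∀ u : ℝ, u ≠ 0 →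
        HasDerivAt F (-1 + (Real.log u + 1 - Real.log g) - 2 * (2 * D - 1 + u)) u := by
      intro u hu
      have h1 := (((hasDerivAt_id u).const_sub g).add ((Real.hasDerivAt_mul_log hu).sub
        ((hasDerivAt_id u).mul_const (Real.log g)))).sub
        (((hasDerivAt_id u).const_add (2 * D - 1)).pow 2)
      refine h1.congr_deriv ?_
      simp
    refine concaveOn_of_hasDerivWithinAt2_nonpos
      (f' := fun u => -1 + (Real.log u + 1 - Real.log g) - 2 * (2 * D - 1 + u))
      (f'' := fun u => u⁻¹ - 2) (convex_Icc _ _)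
      (fun u hu => (hder u (by linarith [hu.1])).continuousAt.continuousWithinAt)
      (fun u hu => ?_) (fun u hu => ?_) fun u hu => ?_
    · rw [interior_Icc] at hu
      exact (hder u (by linarith [hu.1])).hasDerivWithinAt
    · rw [interior_Icc] at hu
      have h1 := ((((Real.hasDerivAt_log (by linarith [hu.1] : u ≠ 0)).add_const 1).sub_const
        (Real.log g)).const_add (-1)).sub (((hasDerivAt_id u).const_add (2 * D - 1)).const_mul 2)
      refine (h1.congr_deriv ?_).hasDerivWithinAt
      simp
    · rw [interior_Icc] at hu
      rw [sub_nonpos, inv_le_comm₀ (by linarith [hu.1]) two_pos]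
      linarith [hu.1]
  have hF1 : 0 ≤ F 1 := by
    simp only [hF, Real.log_one]
    nlinarith
  have hF0 : 0 ≤ F (max (1 / 2) (1 - 2 * D)) := by
    rcases le_total (1 - 2 * D) (1 / 2) with h | h
    · rw [max_eq_left h]
      have h1 := sq_sub_half_le_rate hL (by linarith) hD1 hDs
      rw [neg_neg, Real.exp_log hg0] at h1
      have h2 : Real.log (1 / 2) = -Real.log 2 := by rw [one_div, Real.log_inv]
      simp only [hF, h2]
      nlinarith
    · rw [max_eq_right h]
      set u := 1 - 2 * D with hu
      have hu0 : 0 < u := by linarith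
      have h1 := Real.one_sub_inv_le_log_of_pos (div_pos hu0 hg0)
      rw [Real.log_div hu0.ne' hg0.ne', inv_div] at h1
      have h2 := mul_le_mul_of_nonneg_left h1 hu0.le
      rw [mul_sub, mul_div_cancel₀ _ hu0.ne'] at h2
      have h3 : 2 * D - 1 + u = 0 := by rw [hu]; ring
      simp only [hF, h3]
      linarith
  have h1 := hFconc.min_le_of_mem_Icc (x := max (1 / 2) (1 - 2 * D)) (y := 1) (z := v)
    ⟨le_max_left _ _, max_le (by norm_num) (by linarith)⟩ ⟨by norm_num, le_rfl⟩
    ⟨max_le hv (by linarith), hv1⟩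
  have h2 := (le_min hF0 hF1).trans h1
  simp only [hF] at h2
  rw [Real.log_div (by linarith) hg0.ne']
  linarith

/-! ### Conditional coverage in dimension one -/

section

variable {n : ℕ} {R : Matrix (Fin n) (Fin n) ℝ} {b v w : Fin n → ℝ}

/-- Markov's inequality for an exponential moment. -/
lemma measure_le_of_lintegral_exp_le {X : (Fin n → ℝ) → ℝ} (hX : Measurable X) {E c : ℝ}
    (h : ∫⁻ g, ENNReal.ofReal (Real.exp (X g)) ∂(stdNormal n) ≤ ENNReal.ofReal (Real.exp E)) :
    stdNormal n {g | c ≤ X g} ≤ ENNReal.ofReal (Real.exp (E - c)) := by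
  have hc : ENNReal.ofReal (Real.exp c) ≠ 0 := by simp [Real.exp_pos]
  have hm := mul_meas_ge_le_lintegral₀ (μ := stdNormal n)
    (f := fun g => ENNReal.ofReal (Real.exp (X g))) (by fun_prop) (ENNReal.ofReal (Real.exp c))
  calc stdNormal n {g | c ≤ X g}
      ≤ stdNormal n {g | ENNReal.ofReal (Real.exp c) ≤ ENNReal.ofReal (Real.exp (X g))} :=
        measure_mono fun g hg => ENNReal.ofReal_le_ofReal (Real.exp_le_exp.2 hg)
    _ ≤ ENNReal.ofReal (Real.exp E) / ENNReal.ofReal (Real.exp c) := by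
        rw [ENNReal.le_div_iff_mul_le (Or.inl hc) (Or.inl ENNReal.ofReal_ne_top), mul_comm]
        exact hm.trans h
    _ = _ := by rw [← ENNReal.ofReal_div_of_pos (Real.exp_pos _), ← Real.exp_sub]

/-- Lower deviations of the bootstrap variance `∑ w i * η i ^ 2`. The bias can only help. -/
lemma measure_sum_le_le (hR : ∀ z, ∑ i, (R *ᵥ z) i ^ 2 ≤ 2 * ∑ j, z j ^ 2)
    (hv : ∀ i, ∑ j, R i j ^ 2 = v i) {v₀ d y : ℝ} (hv₀ : 0 ≤ v₀) (hvle : ∀ i, v₀ ≤ v i)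
    (hw : ∀ i, 0 ≤ w i) (hd : 0 < d) (hwd : ∀ i, w i ≤ d) (hw1 : ∑ i, w i = 1) (hy : 0 ≤ y) :
    stdNormal n {g | ∑ i, w i * ((R *ᵥ g) i + b i) ^ 2 ≤ v₀ / (1 + y)}
      ≤ ENNReal.ofReal (Real.exp (-((v₀ / (1 + y) - v₀ + v₀ * Real.log (1 + y)) / (4 * d)))) := by
  -- the optimal parameter in Chernoff's method
  set s : ℝ := y / (4 * d) with hs
  have hs0 : 0 ≤ s := by positivity
  have hvi : ∀ i, 0 ≤ v i := fun i => hv₀.trans (hvle i)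
  have hmom : ∫⁻ g, ENNReal.ofReal (Real.exp (∑ i, -(s * w i) * ((R *ᵥ g) i + b i) ^ 2))
      ∂(stdNormal n) ≤ ENNReal.ofReal (Real.exp (-(v₀ / (4 * d)) * Real.log (1 + y))) := by
    refine (lintegral_exp_quadratic_le hR b fun i => ?_).trans (ENNReal.ofReal_le_ofReal ?_)
    · have := mul_nonneg hs0 (hw i); linarith
    have h1 : ∑ i, b i ^ 2 * -(s * w i) / (1 - 4 * -(s * w i)) ≤ 0 := by
      refine Finset.sum_nonpos fun i _ => div_nonpos_of_nonpos_of_nonneg ?_ ?_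
      · have := mul_nonneg (sq_nonneg (b i)) (mul_nonneg hs0 (hw i)); linarith
      · have := mul_nonneg hs0 (hw i); linarith
    have h2 : ∏ i, (1 - 4 * -(s * w i)) ^ (-(∑ j, R i j ^ 2) / 4)
        ≤ Real.exp (-(v₀ / (4 * d)) * Real.log (1 + y)) := by
      calc ∏ i, (1 - 4 * -(s * w i)) ^ (-(∑ j, R i j ^ 2) / 4)
          ≤ ∏ i, (1 + y) ^ (-(d⁻¹ * w i * (v i / 4))) := by
            refine Finset.prod_le_prod (fun i _ => Real.rpow_nonneg ?_ _) fun i _ => ?_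
            · have := mul_nonneg hs0 (hw i); linarith
            have h3 := one_add_mul_rpow_neg_le (k := d⁻¹) (β := w i) (κ := 4 * s) (r := v i / 4)
              (inv_pos.2 hd) (hw i) (by rw [← div_eq_mul_inv]; exact (div_le_one hd).2 (hwd i))
              (by linarith [hvi i]) (by have := inv_pos.2 hd; linarith)
            have e1 : 1 - 4 * -(s * w i) = 1 + w i * (4 * s) := by ring
            have e2 : 4 * s / d⁻¹ = y := by rw [hs]; field_simp
            rw [e2] at h3
            rw [e1, hv, neg_div]
            exact h3
        _ = (1 + y) ^ (-(∑ i, w i * v i) / (4 * d)) := by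
            rw [← Real.rpow_sum_of_pos (by linarith), ← Finset.sum_neg_distrib, Finset.sum_div]
            congr 1
            exact Finset.sum_congr rfl fun i _ => by field_simp
        _ ≤ (1 + y) ^ (-(v₀ / (4 * d))) := by
            refine Real.rpow_le_rpow_of_exponent_le (by linarith) ?_
            rw [neg_div, neg_le_neg_iff]
            gcongr
            calc v₀ = ∑ i, w i * v₀ := by rw [← Finset.sum_mul, hw1, one_mul]
              _ ≤ _ := Finset.sum_le_sum fun i _ => mul_le_mul_of_nonneg_left (hvle i) (hw i)
        _ = _ := by rw [Real.rpow_def_of_pos (by linarith), mul_comm]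
    calc _ ≤ Real.exp (-(v₀ / (4 * d)) * Real.log (1 + y)) * 1 := by
          refine mul_le_mul h2 (Real.exp_le_one_iff.2 h1) (Real.exp_pos _).le (Real.exp_pos _).le
      _ = _ := mul_one _
  have hηm := measurable_mulVec_apply R
  have hmark := measure_le_of_lintegral_exp_le (by fun_prop) hmom (c := -(s * (v₀ / (1 + y))))
  refine (measure_mono fun g hg => ?_).trans (hmark.trans (le_of_eq ?_))
  · simp only [Set.mem_ofPred_eq] at hg ⊢
    have e : ∑ i, -(s * w i) * ((R *ᵥ g) i + b i) ^ 2
        = -(s * ∑ i, w i * ((R *ᵥ g) i + b i) ^ 2) := by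
      rw [Finset.mul_sum, ← Finset.sum_neg_distrib]
      exact Finset.sum_congr rfl fun i _ => by ring
    rw [e]
    exact neg_le_neg (mul_le_mul_of_nonneg_left hg hs0)
  · congr 2
    have : 1 + y ≠ 0 := by linarith
    rw [hs]
    field_simp
    ring

/-- Upper deviations of the bootstrap variance `∑ w i * η i ^ 2`; the bias inflates the noise by a
factor of at most `m`. -/
lemma measure_le_sum_le (hR : ∀ z, ∑ i, (R *ᵥ z) i ^ 2 ≤ 2 * ∑ j, z j ^ 2)
    (hv : ∀ i, ∑ j, R i j ^ 2 = v i) (hvpos : ∀ i, 0 < v i) {M m d y : ℝ} (hm0 : 0 < m)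
    (hM : ∀ i, v i + b i ^ 2 ≤ M) (hm : ∀ i, 1 + b i ^ 2 / v i ≤ m)
    (hw : ∀ i, 0 ≤ w i) (hd : 0 < d) (hwd : ∀ i, w i ≤ d) (hw1 : ∑ i, w i = 1) (hy : 0 ≤ y)
    (hy1 : y < 1) :
    stdNormal n {g | M / (1 - y) ≤ ∑ i, w i * ((R *ᵥ g) i + b i) ^ 2}
      ≤ ENNReal.ofReal
        (Real.exp (-((M / (1 - y) - M + M * Real.log (1 - y)) / (4 * (d * m))))) := by
  -- the optimal parameter in Chernoff's method
  set s : ℝ := y / (4 * (d * m)) with hs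
  have hs0 : 0 ≤ s := by positivity
  have hdm : 0 < d * m := mul_pos hd hm0
  have hci : ∀ i, 0 ≤ 1 + b i ^ 2 / v i := fun i => by
    have := div_nonneg (sq_nonneg (b i)) (hvpos i).le; linarith
  have hβ : ∀ i, (1 + b i ^ 2 / v i) * w i ≤ d * m := fun i => by
    rw [mul_comm d m]; exact mul_le_mul (hm i) (hwd i) (hw i) hm0.le
  have hD : ∀ i, 4 * ((1 + b i ^ 2 / v i) * (s * w i)) < 1 := by
    intro i
    calc 4 * ((1 + b i ^ 2 / v i) * (s * w i)) = 4 * s * ((1 + b i ^ 2 / v i) * w i) := by ring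
      _ ≤ 4 * s * (d * m) := mul_le_mul_of_nonneg_left (hβ i) (by positivity)
      _ = y := by rw [hs]; field_simp
      _ < 1 := hy1
  have hmom : ∫⁻ g, ENNReal.ofReal (Real.exp (∑ i, s * w i * ((R *ᵥ g) i + b i) ^ 2))
      ∂(stdNormal n) ≤ ENNReal.ofReal (Real.exp (-(M / (4 * (d * m))) * Real.log (1 - y))) := by
    refine (lintegral_exp_quadratic_le_of_inflate hR b hv hvpos hD).trans
      (ENNReal.ofReal_le_ofReal ?_)
    calc ∏ i, (1 - 4 * ((1 + b i ^ 2 / v i) * (s * w i))) ^ (-(v i) / 4)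
        ≤ ∏ i, (1 - y) ^ (-((d * m)⁻¹ * ((1 + b i ^ 2 / v i) * w i) * (v i / 4))) := by
          refine Finset.prod_le_prod (fun i _ => Real.rpow_nonneg (by linarith [hD i]) _)
            fun i _ => ?_
          have e2 : -(4 * s) / (d * m)⁻¹ = -y := by rw [hs]; field_simp
          have h3 := one_add_mul_rpow_neg_le (k := (d * m)⁻¹) (β := (1 + b i ^ 2 / v i) * w i)
            (κ := -(4 * s)) (r := v i / 4) (inv_pos.2 hdm) (mul_nonneg (hci i) (hw i))
            (by rw [← div_eq_mul_inv]; exact (div_le_one hdm).2 (hβ i)) (by linarith [hvpos i])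
            (by
              have h4 : 4 * s = y * (d * m)⁻¹ := by rw [hs]; field_simp
              have := inv_pos.2 hdm
              rw [h4]; nlinarith)
          have e1 : 1 - 4 * ((1 + b i ^ 2 / v i) * (s * w i))
              = 1 + (1 + b i ^ 2 / v i) * w i * -(4 * s) := by ring
          rw [e2, ← sub_eq_add_neg] at h3
          rw [e1, neg_div]
          exact h3
      _ = (1 - y) ^ (-(∑ i, w i * (v i + b i ^ 2)) / (4 * (d * m))) := by
          rw [← Real.rpow_sum_of_pos (by linarith), ← Finset.sum_neg_distrib, Finset.sum_div]
          congr 1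
          refine Finset.sum_congr rfl fun i _ => ?_
          have := (hvpos i).ne'
          field_simp
      _ ≤ (1 - y) ^ (-(M / (4 * (d * m)))) := by
          refine Real.rpow_le_rpow_of_exponent_ge (by linarith) (by linarith) ?_
          rw [neg_div, neg_le_neg_iff]
          gcongr
          calc _ ≤ ∑ i, w i * M :=
                Finset.sum_le_sum fun i _ => mul_le_mul_of_nonneg_left (hM i) (hw i)
            _ = M := by rw [← Finset.sum_mul, hw1, one_mul]
      _ = _ := by rw [Real.rpow_def_of_pos (by linarith), mul_comm]
  have hηm := measurable_mulVec_apply R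
  have hmark := measure_le_of_lintegral_exp_le (by fun_prop) hmom (c := s * (M / (1 - y)))
  refine (measure_mono fun g hg => ?_).trans (hmark.trans (le_of_eq ?_))
  · simp only [Set.mem_ofPred_eq] at hg ⊢
    have e : ∑ i, s * w i * ((R *ᵥ g) i + b i) ^ 2
        = s * ∑ i, w i * ((R *ᵥ g) i + b i) ^ 2 := by
      rw [Finset.mul_sum]
      exact Finset.sum_congr rfl fun i _ => by ring
    rw [e]
    exact mul_le_mul_of_nonneg_left hg hs0
  · congr 2
    have : 1 - y ≠ 0 := by linarith
    rw [hs]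
    field_simp
    ring

end

lemma tvDist_stdNormal_one_le {n : ℕ} {A : Matrix (Fin 1) (Fin n) ℝ} {G : ℝ} (hG : 0 ≤ G)
    (hA : A * Aᵀ = Matrix.diagonal fun _ => G) :
    tvDist (stdNormal 1) (gaussLaw A)
      ≤ tvDist (gaussianReal 0 1) (gaussianReal 0 (Real.toNNReal G)) := by
  have h1 : gaussLaw A = Measure.pi fun _ : Fin 1 => gaussianReal 0 (Real.toNNReal G) := by
    have h2 : gaussLaw A = gaussLaw (diagonal fun _ : Fin 1 => √G) := by
      refine gaussLaw_congr ?_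
      rw [hA, diagonal_transpose, diagonal_mul_diagonal]
      simp only [Real.mul_self_sqrt hG]
    rw [h2, gaussLaw_diagonal]
    simp only [Real.sq_sqrt hG]
  have h3 : ∀ μ : Measure ℝ, [IsProbabilityMeasure μ] → (Measure.pi fun _ : Fin 1 => μ)
      = μ.map (MeasurableEquiv.funUnique (Fin 1) ℝ).symm := fun μ _ =>
    (measurePreserving_funUnique μ (Fin 1)).symm.map_eq.symm
  rw [h1, stdNormal, h3, h3]
  exact tvDist_map_le _ _ (MeasurableEquiv.measurable _)

/-- Scaling reduces a variance `G > 1` to the variance `1 / G`, with the two laws interchanged. -/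
lemma tvDist_gaussianReal_le_of_one_le {G : ℝ} (hG : 1 ≤ G) :
    tvDist (gaussianReal 0 1) (gaussianReal 0 (Real.toNNReal G)) ≤ Real.log G / 4 := by
  rcases hG.eq_or_lt with rfl | hG
  · simp [tvDist_self]
  have hG0 : 0 < G := by linarith
  have hL : 0 < Real.log G := Real.log_pos hG
  have hmap : ∀ u : ℝ, 0 ≤ u → (gaussianReal 0 (Real.toNNReal u)).map (fun x => √G * x)
      = gaussianReal 0 (Real.toNNReal (G * u)) := by
    intro u hu
    rw [gaussianReal_map_const_mul]
    simp only [mul_zero]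
    congr 1
    ext
    rw [NNReal.coe_mul, Real.coe_toNNReal _ hu, Real.coe_toNNReal _ (by positivity)]
    simp [Real.sq_sqrt hG0.le]
  have h1 : gaussianReal 0 1
      = (gaussianReal 0 (Real.toNNReal (Real.exp (-Real.log G)))).map (fun x => √G * x) := by
    rw [hmap _ (Real.exp_pos _).le, Real.exp_neg, Real.exp_log hG0, mul_inv_cancel₀ hG0.ne']
    simp
  have h2 : gaussianReal 0 (Real.toNNReal G) = (gaussianReal 0 1).map (fun x => √G * x) := by
    have := hmap 1 zero_le_one
    rw [mul_one, Real.toNNReal_one] at this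
    exact this.symm
  have h3 := tvDist_map_le (gaussianReal 0 (Real.toNNReal (Real.exp (-Real.log G))))
    (gaussianReal 0 1) (f := fun x => √G * x) (by fun_prop)
  rw [← h1, ← h2, tvDist_comm (gaussianReal 0 (Real.toNNReal _))] at h3
  have h4 := tvDist_gaussianReal_le_gaussSep hL
  have h5 := gaussSep_le hL
  linarith

/-- The point `g` below the mean `v` at which the lower deviation rate equals `r`, parametrised as
`g = v / (1 + y)`. -/
lemma exists_rate_eq {v r : ℝ} (hv : 0 < v) (hr : 0 ≤ r) :
    ∃ y, 0 ≤ y ∧ v / (1 + y) - v + v * Real.log (1 + y) = r := by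
  set Y := Real.exp (1 + r / v) - 1 with hY
  have hY0 : 0 ≤ Y := by
    have := Real.add_one_le_exp (1 + r / v)
    have : 0 ≤ r / v := by positivity
    rw [hY]; linarith
  have hc : ContinuousOn (fun y => v / (1 + y) - v + v * Real.log (1 + y)) (Icc 0 Y) := by
    have h1 : ∀ y ∈ Icc (0 : ℝ) Y, 1 + y ≠ 0 := fun y hy => by linarith [hy.1]
    fun_prop (disch := assumption)
  have h := intermediate_value_Icc hY0 hc
  obtain ⟨y, hy, hyr⟩ := h ⟨by simpa using hr, by
    have e : 1 + Y = Real.exp (1 + r / v) := by rw [hY]; ring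
    simp only [e, Real.log_exp, mul_add, mul_div_cancel₀ _ hv.ne']
    have := div_pos hv (Real.exp_pos (1 + r / v))
    linarith⟩
  exact ⟨y, hy.1, hyr⟩

/-- The bootstrap approximation in dimension one. The bootstrap law is `N(0, S)` with
`S = ∑ U i ^ 2 * η i ^ 2`, so that a large distance means that `S` deviates from its mean, upwards
or downwards; each of the two events has probability at most `exp (-x)`. -/
theorem measure_lt_tvDist_le_of_eq_one {n : ℕ} {U : Matrix (Fin 1) (Fin n) ℝ}
    {R : Matrix (Fin n) (Fin n) ℝ}
    {b v : Fin n → ℝ} (hU : U * Uᵀ = 1) (hR : ∀ z, ∑ i, (R *ᵥ z) i ^ 2 ≤ 2 * ∑ j, z j ^ 2)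
    (hv : ∀ i, ∑ j, R i j ^ 2 = v i) {e t d x : ℝ} (he0 : 0 ≤ e) (he : e ≤ 1 / 2)
    (hve : ∀ i, |v i - 1| ≤ e) (ht : 0 ≤ t) (hbt : ∀ i, b i ^ 2 ≤ t)
    (hd : ∀ i, U 0 i ^ 2 ≤ d) (hx : 0 ≤ x) :
    stdNormal n {g | √(d * (x + Real.log n)) + (e + t) / 2
        < tvDist (gaussLaw U) (gaussLaw (U * diagonal fun i => (R *ᵥ g) i + b i))}
      ≤ ENNReal.ofReal (3 * Real.exp (-x)) := by
  set w : Fin n → ℝ := fun i => U 0 i ^ 2 with hw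
  have hw0 : ∀ i, 0 ≤ w i := fun i => sq_nonneg _
  have hw1 : ∑ i, w i = 1 := by
    have h := congrFun (congrFun hU 0) 0
    simpa [mul_apply, sq, hw] using h
  have hd0 : 0 < d := by
    by_contra! hlt
    have : ∑ i, w i ≤ 0 := Finset.sum_nonpos fun i _ => (hd i).trans hlt
    linarith
  have hX0 : 0 ≤ x + Real.log n := add_nonneg hx (Real.log_natCast_nonneg n)
  set X := x + Real.log n with hX
  have hxX : x ≤ X := by rw [hX]; linarith [Real.log_natCast_nonneg n]
  set h := √(d * X) with hh
  have hh0 : 0 ≤ h := Real.sqrt_nonneg _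
  have hh2 : h ^ 2 = d * X := Real.sq_sqrt (by positivity)
  have hve1 : ∀ i, 1 - e ≤ v i := fun i => by linarith [(abs_le.1 (hve i)).1]
  have hvpos : ∀ i, 0 < v i := fun i => by linarith [hve1 i]
  set S : (Fin n → ℝ) → ℝ := fun g => ∑ i, w i * ((R *ᵥ g) i + b i) ^ 2 with hS
  have hS0 : ∀ g, 0 ≤ S g := fun g => Finset.sum_nonneg fun i _ =>
    mul_nonneg (hw0 i) (sq_nonneg _)
  have hUone : gaussLaw U = stdNormal 1 := gaussLaw_eq_stdNormal hU
  have hAA : ∀ g, (U * diagonal fun i => (R *ᵥ g) i + b i)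
      * (U * diagonal fun i => (R *ᵥ g) i + b i)ᵀ = Matrix.diagonal fun _ => S g := by
    intro g
    ext i j
    rw [Subsingleton.elim i 0, Subsingleton.elim j 0, diagonal_apply_eq, mul_apply]
    simp only [transpose_apply, mul_diagonal, hS, hw]
    exact Finset.sum_congr rfl fun i _ => by ring
  -- upper deviations: `y₁` is chosen so that the threshold `M / (1 - y₁)` is `exp (4 τ)`
  set M := 1 + (e + t) with hM
  set m := 1 + 2 * t with hm
  set τ := h + (e + t) / 2 with hτ
  set y₁ := 1 - M / Real.exp (4 * τ) with hy₁
  have hM0 : 0 < M := by rw [hM]; linarith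
  have hMexp : M ≤ Real.exp (4 * τ) := by
    have := Real.add_one_le_exp (4 * τ)
    rw [hM]; rw [hτ] at this ⊢; linarith
  have hy₁0 : 0 ≤ y₁ := sub_nonneg.2 ((div_le_one (Real.exp_pos _)).2 hMexp)
  have hy₁1 : y₁ < 1 := by
    have := div_pos hM0 (Real.exp_pos (4 * τ)); rw [hy₁]; linarith
  have hup := measure_le_sum_le (b := b) hR hv hvpos (M := M) (m := m) (by rw [hm]; linarith)
    (fun i => by rw [hM]; linarith [(abs_le.1 (hve i)).2, hbt i])
    (fun i => by
      have h1 : b i ^ 2 / v i ≤ t / (1 / 2) :=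
        div_le_div₀ ht (hbt i) (by norm_num) (by linarith [hve1 i])
      rw [hm]; linarith) hw0 hd0 hd hw1 hy₁0 hy₁1
  have e1 : M / (1 - y₁) = Real.exp (4 * τ) := by
    rw [hy₁, sub_sub_cancel, div_div_cancel₀ hM0.ne']
  have hrate : X ≤ (M / (1 - y₁) - M + M * Real.log (1 - y₁)) / (4 * (d * m)) := by
    set l := 4 * τ - Real.log M with hl
    have hl4 : 4 * h ≤ l := by
      have := Real.log_le_sub_one_of_pos hM0
      rw [hl, hτ]; rw [hM] at this ⊢; linarith
    have e2 : Real.log (1 - y₁) = -l := by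
      rw [hy₁, sub_sub_cancel, Real.log_div hM0.ne' (Real.exp_pos _).ne', Real.log_exp, hl]; ring
    have e3 : M / (1 - y₁) = M * Real.exp l := by
      rw [e1, hl, Real.exp_sub, Real.exp_log hM0]; field_simp
    have h1 := Real.quadratic_le_exp_of_nonneg (by linarith : 0 ≤ l)
    have hm0 : 0 < m := by rw [hm]; linarith
    rw [e2, e3, le_div_iff₀ (by positivity)]
    have h2 : (4 * h) ^ 2 ≤ l ^ 2 := by gcongr
    have h3 : m ≤ 2 * M := by rw [hm, hM]; linarith
    calc X * (4 * (d * m)) = 4 * h ^ 2 * m := by rw [hh2]; ring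
      _ ≤ 4 * h ^ 2 * (2 * M) := by gcongr
      _ = M * ((4 * h) ^ 2 / 2) := by ring
      _ ≤ M * (Real.exp l - 1 - l) := mul_le_mul_of_nonneg_left (by linarith) hM0.le
      _ = _ := by ring
  -- lower deviations: the threshold is where the rate equals `4 h² = 4 d X`
  obtain ⟨y₂, hy₂, hr₂⟩ := exists_rate_eq (v := 1 - e) (r := 4 * h ^ 2) (by linarith)
    (by positivity)
  have hlow := measure_sum_le_le (b := b) hR hv (v₀ := 1 - e) (by linarith) hve1 hw0 hd0 hd hw1 hy₂
  rw [hr₂] at hlow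
  have e4 : 4 * h ^ 2 / (4 * d) = X := by rw [hh2]; field_simp
  rw [e4] at hlow
  have hsub : {g | τ < tvDist (gaussLaw U) (gaussLaw (U * diagonal fun i => (R *ᵥ g) i + b i))}
      ⊆ {g | S g ≤ (1 - e) / (1 + y₂)} ∪ {g | M / (1 - y₁) ≤ S g} := by
    intro g hg
    simp only [Set.mem_ofPred_eq, Set.mem_union] at hg ⊢
    set A := U * diagonal fun i => (R *ᵥ g) i + b i with hA
    rw [hUone] at hg
    set D := tvDist (stdNormal 1) (gaussLaw A) with hD
    have h1 := tvDist_stdNormal_one_le (hS0 g) (hAA g)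
    rw [← hA, ← hD] at h1
    rcases le_or_gt 1 (S g) with hbig | hsmall
    · right
      have h2 := tvDist_gaussianReal_le_of_one_le hbig
      rw [e1, ← Real.le_log_iff_exp_le (by linarith)]
      linarith
    · left
      rcases (hS0 g).eq_or_lt with h0 | h0
      · rw [← h0]; exact div_nonneg (by linarith) (by linarith)
      have hpd : (A * Aᵀ).PosDef := by
        rw [hAA g]; exact PosDef.diagonal fun _ => h0
      have h2 := tvDist_gaussLaw_le hpd
      rw [hAA g] at h2
      simp only [trace_diagonal, Finset.univ_unique, Finset.sum_const, Finset.card_singleton,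
        one_smul, det_diagonal, Finset.prod_const, pow_one, Nat.cast_one] at h2
      rw [← hD] at h2
      have hD0 : 0 ≤ D := by linarith
      have h3 : 4 * D ^ 2 ≤ S g - 1 - Real.log (S g) := by
        have h4 := Real.log_le_sub_one_of_pos h0
        calc 4 * D ^ 2 = (2 * D) ^ 2 := by ring
          _ ≤ √(S g - 1 - Real.log (S g)) ^ 2 := pow_le_pow_left₀ (by linarith) (by linarith) 2
          _ = _ := Real.sq_sqrt (by linarith)
      have h5 : D ≤ gaussSep (-Real.log (S g)) := by
        have h6 := tvDist_gaussianReal_le_gaussSep (neg_pos.2 (Real.log_neg h0 hsmall))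
        rw [neg_neg, Real.exp_log h0] at h6
        exact h1.trans h6
      obtain ⟨h7, h8⟩ := sq_le_rate h0 hsmall (by linarith : 1 / 2 ≤ 1 - e) (by linarith)
        (tvDist_le_one _ _) h3 h5 (by linarith)
      -- the rate decreases on `(0, 1 - e]`
      by_contra! hlt
      set g₂ := (1 - e) / (1 + y₂) with hg₂
      have hg₂0 : 0 < g₂ := div_pos (by linarith) (by linarith)
      have e5 : 1 + y₂ = (1 - e) / g₂ := by
        rw [hg₂, div_div_cancel₀ (by linarith)]
      rw [e5] at hr₂
      have h9 : (2 * h) ^ 2 < (2 * D - 1 + (1 - e)) ^ 2 :=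
        pow_lt_pow_left₀ (by linarith) (by linarith) two_ne_zero
      have h10 := Real.one_sub_inv_le_log_of_pos (div_pos h0 hg₂0)
      rw [Real.log_div h0.ne' hg₂0.ne', inv_div] at h10
      rw [Real.log_div (by linarith) hg₂0.ne'] at hr₂
      rw [Real.log_div (by linarith) h0.ne'] at h8
      have h11 : S g - g₂ ≤ (1 - e) * (1 - g₂ / S g) := by
        have : (1 - e) * (1 - g₂ / S g) = (1 - e) / S g * (S g - g₂) := by field_simp
        rw [this]
        refine le_mul_of_one_le_left (by linarith) ?_
        rw [one_le_div h0]; exact h7.le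
      have h12 := mul_le_mul_of_nonneg_left h10 (by linarith : 0 ≤ 1 - e)
      nlinarith
  have hexp : Real.exp (-X) ≤ Real.exp (-x) := Real.exp_le_exp.2 (neg_le_neg hxX)
  calc _ ≤ stdNormal n ({g | S g ≤ (1 - e) / (1 + y₂)} ∪ {g | M / (1 - y₁) ≤ S g}) :=
        measure_mono hsub
    _ ≤ stdNormal n {g | S g ≤ (1 - e) / (1 + y₂)} + stdNormal n {g | M / (1 - y₁) ≤ S g} :=
        measure_union_le _ _
    _ ≤ ENNReal.ofReal (Real.exp (-x)) + ENNReal.ofReal (Real.exp (-x)) := by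
        refine add_le_add (hlow.trans (ENNReal.ofReal_le_ofReal hexp)) (hup.trans
          (ENNReal.ofReal_le_ofReal (Real.exp_le_exp.2 (neg_le_neg (hxX.trans hrate)))))
    _ ≤ _ := by
        rw [← ENNReal.ofReal_add (Real.exp_pos _).le (Real.exp_pos _).le]
        exact ENNReal.ofReal_le_ofReal (by linarith [Real.exp_pos (-x)])

/-! ### Conditional laws given the observations -/

/-- Freezing lemma: given `X`, a function of `X` and an independent `Z` has the law obtained by
fixing the first argument. -/
lemma condDistrib_ae_eq_map_of_indepFun {Ω E G H : Type*} [MeasurableSpace Ω] [MeasurableSpace E]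
    [MeasurableSpace G] [MeasurableSpace H] [StandardBorelSpace H] [Nonempty H] {μ : Measure Ω}
    [IsProbabilityMeasure μ] {X : Ω → E} {Z : Ω → G} (hX : AEMeasurable X μ)
    (hZ : AEMeasurable Z μ) (hXZ : IndepFun X Z μ) {F : E → G → H}
    (hF : Measurable (Function.uncurry F)) :
    ∀ᵐ x ∂(μ.map X), condDistrib (fun ω => F (X ω) (Z ω)) X μ x = (μ.map Z).map (F x) := by
  have := Measure.isProbabilityMeasure_map (μ := μ) hX
  have := Measure.isProbabilityMeasure_map (μ := μ) hZ
  have hFx : ∀ x, Measurable (F x) := fun x => hF.comp measurable_prodMk_left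
  set κ : Kernel E H := (Kernel.id ×ₖ Kernel.const E (μ.map Z)).map (Function.uncurry F) with hκ
  have hκx : ∀ x, κ x = (μ.map Z).map (F x) := by
    intro x
    rw [hκ, Kernel.map_apply _ hF, Kernel.prod_apply, Kernel.id_apply, Kernel.const_apply,
      Measure.dirac_prod, Measure.map_map hF measurable_prodMk_left]
    rfl
  have hκm : IsMarkovKernel κ := Kernel.IsMarkovKernel.map _ hF
  have hXZ' := (indepFun_iff_map_prod_eq_prod_map_map hX hZ).1 hXZ
  have key : μ.map (fun ω => (X ω, F (X ω) (Z ω))) = μ.map X ⊗ₘ κ := by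
    have hG : Measurable fun u : E × G => (u.1, Function.uncurry F u) := measurable_fst.prodMk hF
    have h1 : μ.map (fun ω => (X ω, F (X ω) (Z ω)))
        = ((μ.map X).prod (μ.map Z)).map fun u : E × G => (u.1, Function.uncurry F u) := by
      rw [← hXZ', AEMeasurable.map_map_of_aemeasurable hG.aemeasurable (hX.prodMk hZ)]
      rfl
    rw [h1]
    ext s hs
    rw [Measure.map_apply hG hs, Measure.prod_apply (hG hs), Measure.compProd_apply hs]
    refine lintegral_congr fun x => ?_
    rw [hκx, Measure.map_apply (hFx x) (measurable_prodMk_left hs)]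
    rfl
  have hFm : AEMeasurable (fun ω => F (X ω) (Z ω)) μ := hF.comp_aemeasurable (hX.prodMk hZ)
  filter_upwards [condDistrib_ae_eq_of_measure_eq_compProd X hFm key] with x hx
  rw [hx, hκx]

/-! ### Whitening -/

lemma transpose_invSqrt {p : ℕ} (S : Matrix (Fin p) (Fin p) ℝ) : (invSqrt S)ᵀ = invSqrt S := by
  have h : IsSelfAdjoint (invSqrt S) := cfc_predicate _ S
  rwa [isSelfAdjoint_iff, star_eq_conjTranspose, conjTranspose_eq_transpose_of_trivial] at h

lemma invSqrt_mul_mul_invSqrt {p : ℕ} {S : Matrix (Fin p) (Fin p) ℝ} (hS : S.PosDef) :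
    invSqrt S * S * invSqrt S = 1 := by
  have hsa : IsSelfAdjoint S := hS.isHermitian
  have hc : ∀ g : ℝ → ℝ, ContinuousOn g (spectrum ℝ S) := fun g =>
    S.finite_real_spectrum.continuousOn g
  have h : invSqrt S * S * invSqrt S = cfc (fun t : ℝ => (√t)⁻¹ * t * (√t)⁻¹) S := by
    rw [cfc_mul _ _ S (hc _) (hc _), cfc_mul _ _ S (hc _) (hc _), cfc_id' ℝ S]
    rfl
  rw [h, ← cfc_one ℝ S]
  refine cfc_congr fun t ht => ?_
  rw [hS.isHermitian.spectrum_real_eq_range_eigenvalues] at ht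
  obtain ⟨i, rfl⟩ := ht
  have hpos := Real.sqrt_pos.2 (hS.eigenvalues_pos i)
  have hsq := Real.mul_self_sqrt (hS.eigenvalues_pos i).le
  simp only [Pi.one_apply]
  field_simp
  nlinarith

section

variable {n p : ℕ} {Ψ : Matrix (Fin p) (Fin n) ℝ} {σ : Fin n → ℝ}

lemma scoreCov_eq (Ψ : Matrix (Fin p) (Fin n) ℝ) (σ : Fin n → ℝ) :
    scoreCov Ψ σ = (Ψ * diagonal σ) * (Ψ * diagonal σ)ᵀ := by
  rw [scoreCov, noiseCov, transpose_mul, diagonal_transpose, Matrix.mul_assoc Ψ (diagonal σ),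
    ← Matrix.mul_assoc (diagonal σ), diagonal_mul_diagonal, ← Matrix.mul_assoc]
  simp only [sq]

lemma posDef_scoreCov (hS : IsUnit (scoreCov Ψ σ).det) : (scoreCov Ψ σ).PosDef := by
  have h : (scoreCov Ψ σ).PosSemidef := by
    rw [scoreCov_eq, ← conjTranspose_eq_transpose_of_trivial]
    exact posSemidef_self_mul_conjTranspose _
  exact h.posDef_iff_isUnit.2 ((isUnit_iff_isUnit_det _).2 hS)

/-- The whitened design `S^{-1/2} Ψ Σ^{1/2}`. -/
noncomputable def whitened (Ψ : Matrix (Fin p) (Fin n) ℝ) (σ : Fin n → ℝ) :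
    Matrix (Fin p) (Fin n) ℝ :=
  invSqrt (scoreCov Ψ σ) * (Ψ * diagonal σ)

lemma whitened_mul_transpose (hS : IsUnit (scoreCov Ψ σ).det) :
    whitened Ψ σ * (whitened Ψ σ)ᵀ = 1 := by
  have h := invSqrt_mul_mul_invSqrt (posDef_scoreCov hS)
  rw [whitened, transpose_mul, transpose_invSqrt]
  generalize invSqrt (scoreCov Ψ σ) = C at h ⊢
  rw [scoreCov_eq] at h
  simpa only [Matrix.mul_assoc] using h

lemma mul_invSqrt_mul_whitened (hS : IsUnit (scoreCov Ψ σ).det) :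
    scoreCov Ψ σ * invSqrt (scoreCov Ψ σ) * whitened Ψ σ = Ψ * diagonal σ := by
  have h := invSqrt_mul_mul_invSqrt (posDef_scoreCov hS)
  rw [Matrix.mul_assoc] at h
  rw [whitened, ← Matrix.mul_assoc, mul_eq_one_comm.1 h, Matrix.one_mul]

lemma l2norm_sq {k : ℕ} (v : Fin k → ℝ) : l2norm v ^ 2 = ∑ i, v i ^ 2 := by
  rw [l2norm, EuclideanSpace.norm_sq_eq]
  simp

/-- The columns of the whitened design are bounded by the design regularity. -/
lemma sum_sq_whitened_le (hσ : ∀ i, 0 < σ i) (i : Fin n) :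
    ∑ j, whitened Ψ σ j i ^ 2 ≤ designReg Ψ σ ^ 2 := by
  have h1 : ∀ j, whitened Ψ σ j i = (invSqrt (scoreCov Ψ σ) *ᵥ Ψ.col i) j * σ i := by
    intro j
    rw [whitened, ← Matrix.mul_assoc, mul_diagonal]
    rfl
  have h2 : ∑ j, whitened Ψ σ j i ^ 2
      = (l2norm (invSqrt (scoreCov Ψ σ) *ᵥ Ψ.col i) * σ i) ^ 2 := by
    simp_rw [h1, mul_pow, l2norm_sq, Finset.sum_mul]
  rw [h2]
  refine pow_le_pow_left₀ (mul_nonneg (norm_nonneg _) (hσ i).le) ?_ 2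
  exact le_ciSup (f := fun i => l2norm (invSqrt (scoreCov Ψ σ) *ᵥ Ψ.col i) * σ i)
    (Set.finite_range _).bddAbove i

/-- The stochastic terms are a fixed measurable function of the score `S^{-1/2} Ψ Σ^{1/2} z`. -/
lemma exists_stochTerms_eq {q : ℕ} {ι : Type*} (hS : IsUnit (scoreCov Ψ σ).det)
    (W : Matrix (Fin q) (Fin p) ℝ) (P : ι → Matrix (Fin p) (Fin p) ℝ) :
    ∃ Φ : (Fin p → ℝ) → (ι × ι → Fin q → ℝ), Measurable Φ ∧
      ∀ z : Fin n → ℝ, stochTerms Ψ W P (fun i => σ i * z i) = Φ (whitened Ψ σ *ᵥ z) := by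
  set L : ι → Matrix (Fin p) (Fin p) ℝ := fun m =>
    symPinv (modelFeatures Ψ (P m) * (modelFeatures Ψ (P m))ᵀ) * P m
  have hlse : ∀ m, lse Ψ (P m) = L m * Ψ := fun m => (Matrix.mul_assoc _ _ _).symm
  refine ⟨fun s mm => (W * (L mm.1 - L mm.2) * (scoreCov Ψ σ * invSqrt (scoreCov Ψ σ))) *ᵥ s,
    measurable_pi_lambda _ fun mm => measurable_mulVec _, fun z => ?_⟩
  have hz : (fun i => σ i * z i) = diagonal σ *ᵥ z := by
    ext i; rw [mulVec_diagonal]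
  ext mm : 1
  simp only [stochTerms]
  rw [hz, hlse, hlse, ← Matrix.sub_mul, mulVec_mulVec, mulVec_mulVec, Matrix.mul_assoc,
    Matrix.mul_assoc, Matrix.mul_assoc (W * (L mm.1 - L mm.2)), mul_invSqrt_mul_whitened hS,
    Matrix.mul_assoc]

end

/-! ### Moments of the standardized noise -/

section

variable {n : ℕ} {Ω : Type*} [MeasurableSpace Ω] {μ : Measure Ω}

lemma map_standardize (f : Fin n → ℝ) {σ : Fin n → ℝ} (hσ : ∀ i, 0 < σ i) :
    (diagGaussian f σ).map (fun y i => (y i - f i) / σ i) = stdNormal n := by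
  rw [diagGaussian, Measure.pi_map_pi (f := fun i y => (y - f i) / σ i)
    (fun i => by fun_prop), stdNormal]
  congr 1
  ext1 i
  have h1 : (fun y : ℝ => (y - f i) / σ i) = (fun y => y / σ i) ∘ fun y => y - f i := rfl
  rw [h1, ← Measure.map_map (by fun_prop) (by fun_prop), gaussianReal_map_sub_const,
    gaussianReal_map_div_const, sub_self, zero_div]
  congr 1
  ext
  have : σ i ^ 2 ≠ 0 := (pow_pos (hσ i) 2).ne'
  simp [Real.coe_toNNReal _ (sq_nonneg _), div_self this]

lemma memLp_eval_stdNormal (j : Fin n) : MemLp (fun g : Fin n → ℝ => g j) 2 (stdNormal n) :=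
  (memLp_id_gaussianReal' 2 (by simp)).comp_measurePreserving
    (measurePreserving_eval (fun _ : Fin n => gaussianReal 0 1) j)

lemma integral_eval_stdNormal (j : Fin n) : ∫ g, g j ∂(stdNormal n) = 0 := by
  have h := (measurePreserving_eval (fun _ : Fin n => gaussianReal 0 1) j).map_eq
  have h2 := integral_id_gaussianReal (μ := 0) (v := 1)
  rw [← h, integral_map (measurable_pi_apply j).aemeasurable (by fun_prop)] at h2
  exact h2

lemma covariance_eval_stdNormal (j k : Fin n) :
    cov[fun g => g j, fun g => g k; stdNormal n] = if j = k then 1 else 0 := by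
  split_ifs with h
  · subst h
    have h := (measurePreserving_eval (fun _ : Fin n => gaussianReal 0 1) j).hasLaw.variance_eq
    rw [variance_id_gaussianReal] at h
    rw [covariance_self (measurable_pi_apply j).aemeasurable]
    exact h
  · refine IndepFun.covariance_eq_zero ?_ (memLp_eval_stdNormal j) (memLp_eval_stdNormal k)
    exact (iIndepFun_pi (μ := fun _ : Fin n => gaussianReal 0 1) (X := fun _ x => x)
      (fun _ => by fun_prop)).indepFun h

lemma covMat_mulVec {Z : Ω → Fin n → ℝ} (hZ : HasLaw Z (stdNormal n) μ)
    (R : Matrix (Fin n) (Fin n) ℝ) : covMat μ (fun ω => R *ᵥ Z ω) = R * Rᵀ := by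
  ext i k
  have h := hZ.covariance_fun_comp (f := fun g => (R *ᵥ g) i) (g := fun g => (R *ᵥ g) k)
    (measurable_mulVec_apply R i).aemeasurable (measurable_mulVec_apply R k).aemeasurable
  rw [covMat, of_apply, h]
  simp only [mulVec, dotProduct]
  rw [covariance_fun_sum_fun_sum (fun j => (memLp_eval_stdNormal j).const_mul _)
    (fun j => (memLp_eval_stdNormal j).const_mul _)]
  simp [covariance_const_mul_left, covariance_const_mul_right, covariance_eval_stdNormal,
    mul_apply, mul_comm]

lemma integral_sq_mulVec {Z : Ω → Fin n → ℝ} (hZ : HasLaw Z (stdNormal n) μ)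
    (R : Matrix (Fin n) (Fin n) ℝ) (i : Fin n) :
    ∫ ω, (R *ᵥ Z ω) i ^ 2 ∂μ = ∑ j, R i j ^ 2 := by
  have hm : MemLp (fun g => (R *ᵥ g) i) 2 (stdNormal n) := by
    simp only [mulVec, dotProduct]
    exact memLp_finsetSum _ fun j _ => (memLp_eval_stdNormal j).const_mul _
  have h0 : ∫ g, (R *ᵥ g) i ∂(stdNormal n) = 0 := by
    simp only [mulVec, dotProduct]
    rw [integral_finsetSum _ fun j _ =>
      ((memLp_eval_stdNormal j).integrable one_le_two).const_mul _]
    simp [integral_const_mul, integral_eval_stdNormal]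
  have h1 := congrFun (congrFun (covMat_mulVec HasLaw.id R) i) i
  rw [covMat, of_apply] at h1
  simp only [id] at h1
  rw [covariance_self hm.aemeasurable, variance_of_integral_eq_zero hm.aemeasurable h0] at h1
  have h2 : ∫ ω, (R *ᵥ Z ω) i ^ 2 ∂μ = _ := hZ.integral_comp (hm.aestronglyMeasurable.pow 2)
  rw [h2]
  refine h1.trans ?_
  simp [mul_apply, sq]

end

/-! ### Operator norm bounds -/

section

variable {n : ℕ}

lemma abs_dotProduct_mulVec_le (A : Matrix (Fin n) (Fin n) ℝ) (x : Fin n → ℝ) :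
    |x ⬝ᵥ A *ᵥ x| ≤ opNorm A * ∑ i, x i ^ 2 := by
  have h1 : inner ℝ (WithLp.toLp 2 x) (toEuclideanCLM (n := Fin n) (𝕜 := ℝ) A (WithLp.toLp 2 x))
      = x ⬝ᵥ A *ᵥ x := by
    rw [toEuclideanCLM_toLp, EuclideanSpace.inner_toLp_toLp, dotProduct_comm]
    simp
  rw [← h1, ← l2norm_sq, l2norm, opNorm]
  calc _ ≤ ‖WithLp.toLp 2 x‖ * ‖toEuclideanCLM (n := Fin n) (𝕜 := ℝ) A (WithLp.toLp 2 x)‖ :=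
        abs_real_inner_le_norm _ _
    _ ≤ ‖WithLp.toLp 2 x‖ * (‖toEuclideanCLM (n := Fin n) (𝕜 := ℝ) A‖ * ‖WithLp.toLp 2 x‖) := by
        gcongr
        exact ContinuousLinearMap.le_opNorm _ _
    _ = _ := by ring

/-- If `R Rᵀ` is within operator distance one of the identity, then `‖R‖² ≤ 2`. -/
lemma sum_sq_mulVec_le {R : Matrix (Fin n) (Fin n) ℝ} (hR : opNorm (R * Rᵀ - 1) ≤ 1)
    (z : Fin n → ℝ) : ∑ i, (R *ᵥ z) i ^ 2 ≤ 2 * ∑ j, z j ^ 2 := by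
  have hT : ∀ x : Fin n → ℝ, ∑ i, (Rᵀ *ᵥ x) i ^ 2 ≤ 2 * ∑ j, x j ^ 2 := by
    intro x
    have h1 := (le_abs_self _).trans (abs_dotProduct_mulVec_le (R * Rᵀ - 1) x)
    have h2 : ∑ i, (Rᵀ *ᵥ x) i ^ 2 = x ⬝ᵥ (R * Rᵀ - 1) *ᵥ x + ∑ i, x i ^ 2 := by
      rw [sum_sq_eq_dotProduct, sum_sq_eq_dotProduct, sub_mulVec, one_mulVec, dotProduct_sub,
        ← mulVec_mulVec, dotProduct_mulVec x R, ← mulVec_transpose]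
      ring
    have h3 : 0 ≤ ∑ i, x i ^ 2 := Finset.sum_nonneg fun _ _ => sq_nonneg _
    nlinarith
  set r : ℝ := ∑ i, (R *ᵥ z) i ^ 2 with hr
  have hr0 : 0 ≤ r := Finset.sum_nonneg fun _ _ => sq_nonneg _
  -- Cauchy-Schwarz for `‖R z‖² = ⟨Rᵀ R z, z⟩`
  have h1 : r ^ 2 ≤ (∑ i, (Rᵀ *ᵥ (R *ᵥ z)) i ^ 2) * ∑ i, z i ^ 2 := by
    have h2 : r = ∑ i, (Rᵀ *ᵥ (R *ᵥ z)) i * z i := by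
      rw [hr, sum_sq_eq_dotProduct, dotProduct_mulVec, ← mulVec_transpose]
      rfl
    conv_lhs => rw [h2]
    exact Finset.sum_mul_sq_le_sq_mul_sq _ _ _
  have h3 := hT (R *ᵥ z)
  have h4 : 0 ≤ ∑ i, z i ^ 2 := Finset.sum_nonneg fun _ _ => sq_nonneg _
  rcases hr0.eq_or_lt with h | h
  · rw [← h]; positivity
  · have h5 : r * r ≤ r * (2 * ∑ j, z j ^ 2) := by
      nlinarith [mul_le_mul_of_nonneg_right h3 h4]
    exact le_of_mul_le_mul_left h5 h

end

/-! ### Total variation bound for the score -/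

section

variable {n p : ℕ} {U : Matrix (Fin p) (Fin n) ℝ} {R : Matrix (Fin n) (Fin n) ℝ}
  {b v : Fin n → ℝ}

/-- The bootstrap approximation in whitened coordinates, in every dimension. The bounds `e`, `t` and
`d` stand for `δ_ε`, `‖b‖_∞²` and `δ_Ψ²`. -/
lemma measure_lt_tvDist_le (hU : U * Uᵀ = 1)
    (hR : ∀ z, ∑ i, (R *ᵥ z) i ^ 2 ≤ 2 * ∑ j, z j ^ 2) (hv : ∀ i, ∑ j, R i j ^ 2 = v i)
    {e t d x : ℝ} (he0 : 0 ≤ e) (he : e ≤ 1 / 2) (hve : ∀ i, |v i - 1| ≤ e) (ht : 0 ≤ t)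
    (hbt : ∀ i, b i ^ 2 ≤ t) (hd : ∀ i, ∑ j, U j i ^ 2 ≤ d) (hx : Real.log 3 ≤ x) :
    stdNormal n {g | √(d * p * (x + Real.log n)) + (e + t) / 2 * √p <
        tvDist (gaussLaw U) (gaussLaw (U * diagonal fun i => (R *ᵥ g) i + b i))}
      ≤ ENNReal.ofReal (3 * Real.exp (-x)) := by
  obtain rfl | rfl | hp : p = 0 ∨ p = 1 ∨ 2 ≤ p := by omega
  · have h : ∀ A : Matrix (Fin 0) (Fin n) ℝ, tvDist (gaussLaw U) (gaussLaw A) = 0 := fun A => by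
      rw [gaussLaw_congr (Subsingleton.elim (U * Uᵀ) (A * Aᵀ)), tvDist_self]
    simp [h]
  · have hx0 : 0 ≤ x := (Real.log_nonneg (by norm_num)).trans hx
    simpa using measure_lt_tvDist_le_of_eq_one hU hR hv he0 he hve ht hbt
      (fun i => by simpa using hd i) hx0
  · exact measure_lt_tvDist_le_of_two_le hp hU hR hv he0 he hve ht hbt hd hx

end

/-! ### Rewriting the residuals in terms of the standardized noise -/

section

variable {n p : ℕ} {σ : Fin n → ℝ}

/-- The matrix `Σ^{-1/2} (1 - Π) Σ^{1/2}` turning standardized noise into standardized residual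
noise. -/
noncomputable def residualMat (σ : Fin n → ℝ) (Pre : Matrix (Fin n) (Fin n) ℝ) :
    Matrix (Fin n) (Fin n) ℝ :=
  diagonal (fun i => (σ i)⁻¹) * (1 - Pre) * diagonal σ

lemma stdResidual_eq (σ : Fin n → ℝ) (Pre : Matrix (Fin n) (Fin n) ℝ) (v : Fin n → ℝ) :
    stdResidual σ Pre v = (diagonal (fun i => (σ i)⁻¹) * (1 - Pre)) *ᵥ v := by
  rw [stdResidual, ← mulVec_mulVec, sub_mulVec, one_mulVec]

lemma stdResidual_add (σ : Fin n → ℝ) (Pre : Matrix (Fin n) (Fin n) ℝ) (u v : Fin n → ℝ) :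
    stdResidual σ Pre (u + v) = stdResidual σ Pre u + stdResidual σ Pre v := by
  simp only [stdResidual_eq, mulVec_add]

lemma stdResidual_mul (σ : Fin n → ℝ) (Pre : Matrix (Fin n) (Fin n) ℝ) (z : Fin n → ℝ) :
    stdResidual σ Pre (fun i => σ i * z i) = residualMat σ Pre *ᵥ z := by
  have hz : (fun i => σ i * z i) = diagonal σ *ᵥ z := by
    ext i; rw [mulVec_diagonal]
  rw [stdResidual_eq, residualMat, hz, mulVec_mulVec]

lemma bootNoise_eq (hσ : ∀ i, 0 < σ i) (Pre : Matrix (Fin n) (Fin n) ℝ) (y w : Fin n → ℝ) :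
    bootNoise Pre y w = fun i => σ i * (diagonal (stdResidual σ Pre y) *ᵥ w) i := by
  ext i
  have := (hσ i).ne'
  rw [bootNoise, mulVec_diagonal, mulVec_diagonal, stdResidual, mulVec_diagonal]
  field_simp

lemma sq_le_supnorm_sq (v : Fin n → ℝ) (i : Fin n) : v i ^ 2 ≤ supnorm v ^ 2 := by
  have h : |v i| ≤ supnorm v := le_ciSup (f := fun i => |v i|) (Set.finite_range _).bddAbove i
  rw [← sq_abs]
  exact pow_le_pow_left₀ (abs_nonneg _) h 2

/-- The last summand of `errorTwo` is nonnegative and is discarded. -/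
lemma le_half_errorTwo (p : ℕ) {δΨ δε : ℝ} (hδε : 0 ≤ δε) (B : Fin n → ℝ) (x : ℝ) :
    √(δΨ ^ 2 * p * (x + Real.log n)) + (δε + supnorm B ^ 2) / 2 * √p
      ≤ 1 / 2 * errorTwo p δΨ δε B x := by
  have h1 : √(δε ^ 2 * p) = δε * √p := by
    rw [Real.sqrt_mul (sq_nonneg _), Real.sqrt_sq hδε]
  have h2 : √(supnorm B ^ 4 * p) = supnorm B ^ 2 * √p := by
    rw [Real.sqrt_mul (by positivity), show supnorm B ^ 4 = (supnorm B ^ 2) ^ 2 by ring,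
      Real.sqrt_sq (by positivity)]
  have h3 : 0 ≤ 4 * δΨ ^ 2 * l2norm B * (1 + √x) :=
    mul_nonneg (mul_nonneg (by positivity) (norm_nonneg _)) (by positivity)
  rw [errorTwo, h1, h2]
  linarith

end

end OrderedSelection

theorem mainTheorem3 {n p q : ℕ} {ι : Type*} [Fintype ι]
    {Ω : Type*} [MeasurableSpace Ω] (μ : Measure Ω) [IsProbabilityMeasure μ]
    (f σ : Fin n → ℝ) (hσ : ∀ i, 0 < σ i)
    (Ψ : Matrix (Fin p) (Fin n) ℝ) (hS : IsUnit (OrderedSelection.scoreCov Ψ σ).det)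
    (W : Matrix (Fin q) (Fin p) ℝ)
    (P : ι → Matrix (Fin p) (Fin p) ℝ) (hP : ∀ m, IsStarProjection (P m))
    (Pre : Matrix (Fin n) (Fin n) ℝ)
    (Y w ε εs : Ω → Fin n → ℝ)
    (hY : HasLaw Y (OrderedSelection.diagGaussian f σ) μ)
    (hw : HasLaw w (OrderedSelection.diagGaussian (fun _ => 0) (fun _ => 1)) μ)
    (hYw : IndepFun Y w μ)
    (hε : ∀ ω, ε ω = Y ω - f)
    (hεs : ∀ ω, εs ω = OrderedSelection.stdResidual σ Pre (ε ω))
    (hδ₁ : OrderedSelection.delta1 μ εs ≤ 1)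
    (hδε : OrderedSelection.deltaEps μ εs ≤ 1 / 2)
    (x : ℝ) (hx : 0 ≤ x) :
    ∃ A : Set Ω, MeasurableSet A ∧ 1 - 3 * Real.exp (-x) ≤ μ.real A ∧
      ∀ ω ∈ A,
        OrderedSelection.tvDist
          (μ.map fun ω' => OrderedSelection.stochTerms Ψ W P (ε ω'))
          (condDistrib
            (fun ω' => OrderedSelection.stochTerms Ψ W P
              (OrderedSelection.bootNoise Pre (Y ω') (w ω'))) Y μ (Y ω))
        ≤ 1 / 2 * OrderedSelection.errorTwo p (OrderedSelection.designReg Ψ σ)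
            (OrderedSelection.deltaEps μ εs) (OrderedSelection.stdResidual σ Pre f) x := by
  open OrderedSelection in
  -- for small `x` the probability bound is void and the empty event will do
  rcases lt_or_ge x (Real.log 3) with hx3 | hx3
  · refine ⟨∅, .empty, ?_, by simp⟩
    have h1 : Real.exp (-Real.log 3) ≤ Real.exp (-x) := Real.exp_le_exp.2 (by linarith)
    rw [Real.exp_neg, Real.exp_log (by norm_num)] at h1
    simp only [measureReal_empty]
    linarith
  -- the standardized noise; the residuals are `R z + b`
  set z : Ω → Fin n → ℝ := fun ω i => (Y ω i - f i) / σ i with hz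
  have hzlaw : HasLaw z (stdNormal n) μ :=
    HasLaw.comp (X := Y) (Y := fun y i => (y i - f i) / σ i)
      ⟨(measurable_pi_lambda _ fun i =>
        ((measurable_pi_apply i).sub_const _).div_const _).aemeasurable, map_standardize f hσ⟩ hY
  have hεz : ∀ ω, ε ω = fun i => σ i * z ω i := by
    intro ω
    ext i
    have := (hσ i).ne'
    simp only [hε, hz, Pi.sub_apply]
    field_simp
  set R := residualMat σ Pre with hRdef
  set b := stdResidual σ Pre f with hb
  have hεsR : εs = fun ω => R *ᵥ z ω := by
    ext1 ω
    rw [hεs, hεz, stdResidual_mul]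
  have hres : ∀ ω, stdResidual σ Pre (Y ω) = fun i => (R *ᵥ z ω) i + b i := by
    intro ω
    have h : Y ω = (fun i => σ i * z ω i) + f := by rw [← hεz, hε, sub_add_cancel]
    rw [h, stdResidual_add, stdResidual_mul]
    rfl
  have hRop : opNorm (R * Rᵀ - 1) ≤ 1 := by
    rwa [delta1, hεsR, covMat_mulVec hzlaw] at hδ₁
  have he0 : 0 ≤ deltaEps μ εs := Real.iSup_nonneg fun _ => abs_nonneg _
  have hve : ∀ i, |(∑ j, R i j ^ 2) - 1| ≤ deltaEps μ εs := by
    intro i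
    have h := le_ciSup (f := fun i => |∫ ω, εs ω i ^ 2 ∂μ - 1|) (Set.finite_range _).bddAbove i
    rw [← integral_sq_mulVec hzlaw R i]
    simpa only [deltaEps, hεsR] using h
  -- both families are images under `Φ` of Gaussian laws on `ℝᵖ`
  obtain ⟨Φ, hΦ, hΦeq⟩ := exists_stochTerms_eq hS W P
  set U := whitened Ψ σ with hU
  have hreal : μ.map (fun ω => stochTerms Ψ W P (ε ω)) = (gaussLaw U).map Φ := by
    rw [gaussLaw, Measure.map_map hΦ (measurable_mulVec U), ← hzlaw.map_eq,
      AEMeasurable.map_map_of_aemeasurable (hΦ.comp (measurable_mulVec U)).aemeasurable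
        hzlaw.aemeasurable]
    congr 1
    ext1 ω
    rw [hεz, hΦeq]
    rfl
  have hwlaw : μ.map w = stdNormal n := by
    rw [hw.map_eq, diagGaussian, stdNormal]
    simp
  have hboot : ∀ y, (μ.map w).map (fun w => stochTerms Ψ W P (bootNoise Pre y w))
      = (gaussLaw (U * diagonal (stdResidual σ Pre y))).map Φ := by
    intro y
    rw [hwlaw, gaussLaw, Measure.map_map hΦ (measurable_mulVec _)]
    congr 1
    ext1 w
    rw [bootNoise_eq hσ, hΦeq, mulVec_mulVec]
    rfl
  have hF : Measurable (Function.uncurry fun y w : Fin n → ℝ =>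
      stochTerms Ψ W P (bootNoise Pre y w)) := by
    refine measurable_pi_lambda _ fun mm => (measurable_mulVec _).comp ?_
    refine measurable_pi_lambda _ fun i => ?_
    simp only [bootNoise, mulVec_diagonal, Pi.sub_apply]
    exact (((measurable_pi_apply i).comp measurable_fst).sub
      ((measurable_mulVec_apply Pre i).comp measurable_fst)).mul
        ((measurable_pi_apply i).comp measurable_snd)
  have hcond := ae_of_ae_map hY.aemeasurable
    (condDistrib_ae_eq_map_of_indepFun hY.aemeasurable hw.aemeasurable hYw hF)
  set c := 1 / 2 * errorTwo p (designReg Ψ σ) (deltaEps μ εs) b x with hc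
  set bad : Set (Fin n → ℝ) :=
    {g | c < tvDist (gaussLaw U) (gaussLaw (U * diagonal fun i => (R *ᵥ g) i + b i))} with hbad
  have hbadle : stdNormal n bad ≤ ENNReal.ofReal (3 * Real.exp (-x)) :=
    (measure_mono fun g hg => (le_half_errorTwo p he0 b x).trans_lt hg).trans
      (measure_lt_tvDist_le (whitened_mul_transpose hS) (sum_sq_mulVec_le hRop) (fun _ => rfl)
        he0 hδε hve (sq_nonneg _) (sq_le_supnorm_sq b) (sum_sq_whitened_le hσ) hx3)
  -- the exceptional event: the conditional law is determined only almost surely, and `bad` need not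
  -- be measurable, so that a measurable hull is removed
  set E : Set Ω := {ω | ¬ condDistrib (fun ω' => stochTerms Ψ W P (bootNoise Pre (Y ω') (w ω'))) Y μ
    (Y ω) = (μ.map w).map fun w => stochTerms Ψ W P (bootNoise Pre (Y ω) w)} ∪ z ⁻¹' bad with hE
  have hEle : μ E ≤ ENNReal.ofReal (3 * Real.exp (-x)) := by
    refine (measure_union_le _ _).trans ?_
    rw [ae_iff.1 hcond, zero_add]
    refine le_trans (measure_mono (Set.preimage_mono (subset_toMeasurable (stdNormal n) bad))) ?_
    rw [← Measure.map_apply_of_aemeasurable hzlaw.aemeasurable (measurableSet_toMeasurable _ _),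
      hzlaw.map_eq, measure_toMeasurable]
    exact hbadle
  refine ⟨(toMeasurable μ E)ᶜ, (measurableSet_toMeasurable _ _).compl, ?_, fun ω hω => ?_⟩
  · rw [probReal_compl_eq_one_sub (measurableSet_toMeasurable _ _), measureReal_def,
      measure_toMeasurable]
    have := ENNReal.toReal_le_of_le_ofReal (by positivity) hEle
    linarith
  · have hωE : ω ∉ E := fun h => hω (subset_toMeasurable μ E h)
    simp only [hE, Set.mem_union, not_or, Set.mem_ofPred_eq, not_not, Set.mem_preimage, hbad,
      not_lt] at hωE
    rw [hreal, hωE.1, hboot, hres]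
    exact (tvDist_map_le _ _ hΦ).trans hωE.2
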